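/- Let $M$ be a smooth finite-dimensional manifold (Hausdorff, $\sigma$-compact, without boundary), let $G\subset GL(k,\mathbb R)$ be a subgroup with the structure of a Lie group for which the inclusion into $GL(k,\mathbb R)$ is a smooth embedding (for instance a compact Lie subgroup), with Lie algebra $\mathfrak g$, and let $\pi_E:E\to M$ be a smooth real vector bundle of rank $k$ with a given smooth trivialization atlas whose transition maps all take values in $G$ (a $G$-vector bundle). A linear isomorphism $u:\mathbb R^k\to E_x$ is an admissible frame at $x$ if its expression in a trivialization of the atlas around $x$ is an element of $G$ (this does not depend on the trivialization). Let $\pi:P(E)\to M$ be the bundle of admissible frames; it is a smooth manifold, with local charts to $M\times G$ given by the trivializations of $E$, and $G$ acts on it by $p\cdot g=p\circ g$. For $X\in\mathfrak g$ put $I_p(X)=\frac{d}{dt}\big|_{t=0}\,p\circ\exp(tX)\in T_pP(E)$. A connection on $E$ is an $\mathbb R$-linear map $\nabla:\Gamma(E)\to\Gamma(T^*M\otimes E)$ on smooth sections with $\nabla(fs)=f\nabla s+df\otimes s$ for all smooth functions $f$. It is admissible if, for every smooth curve $\sigma:[0,1]\to M$, parallel transport $E_{\sigma(0)}\to E_{\sigma(1)}$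 along $\sigma$ takes admissible frames to admissible frames. Given a smooth local section $s$ of $P(E)$ (a moving admissible frame), $v\in T_xM$ and $X\in\mathfrak g\subset\mathfrak{gl}(k,\mathbb R)$, write $\omega^s_{\nabla}(v)=X$ if $\nabla_v(s\,\xi)=s(x)(X\xi)$ for all constant $\xi\in\mathbb R^k$, i.e. $\nabla_v s_i=\sum_j X^j_{\ i}\,s_j(x)$. A connection on $P(E)$ is a smooth distribution $H$ on $P(E)$ of rank $\dim M$ with $T_pP(E)=H_p\oplus\ker d\pi_p$ for all $p$, that is invariant under $G$: $d(R_g)_p(H_p)=H_{p\cdot g}$, where $R_g(p)=p\cdot g$. Its connection form $\omega_H$ is determined by $\omega_H(w)=X$ if and only if $w-I_p(X)\in H_p$, for $w\in T_pP(E)$, $X\in\mathfrak g$. Theorem. There is a bijection $\nabla\mapsto H$ from the set of admissible connections on $E$ onto the set of connections on $P(E)$, characterized as follows: $H$ is the image of $\nabla$ if and only if $\omega^s_\nabla=s^*\omega_H$ for every smooth local section $s$ of $P(E)$, that is, for all $x$ in the (open) domain of $s$, all $v\in T_xM$ and all $X\in\mathfrak g$, one has $\omega_H(ds_x(v))=X$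 if and only if $\omega^s_\nabla(v)=X$. -/

import Mathlib

open Bundle Manifold Set Topology
open scoped Manifold ContDiff Bundle Topology

noncomputable section

/-- A vector bundle with structure group `G ≤ GL(F)`: the transition maps between any two of its
trivializations take values in `G`. -/
class IsGVectorBundle {F : Type*} [NormedAddCommGroup F] [NormedSpace ℝ F]
    (G : Subgroup (F →L[ℝ] F)ˣ)
    {M : Type*} [TopologicalSpace M] (E : M → Type*) [TopologicalSpace (TotalSpace F E)]
    [∀ x, AddCommGroup (E x)] [∀ x, Module ℝ (E x)] [∀ x, TopologicalSpace (E x)]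
    [FiberBundle F E] [VectorBundle ℝ F E] : Prop where
  exists_mem : ∀ (e e' : Trivialization F (π F E)) [MemTrivializationAtlas e]
    [MemTrivializationAtlas e'] (x : M), x ∈ e.baseSet → x ∈ e'.baseSet →
    ∃ g ∈ G, ∀ v : F, (g : F →L[ℝ] F) v = e.coordChangeL ℝ e' x v

/-- A subgroup `G` of `GL(F)`, with a manifold structure, is a smoothly embedded submanifold. -/
class IsEmbeddedLieSubgroup {F : Type*} [NormedAddCommGroup F] [NormedSpace ℝ F]
    [FiniteDimensional ℝ F]
    (G : Subgroup (F →L[ℝ] F)ˣ) {EG : Type*} [NormedAddCommGroup EG] [NormedSpace ℝ EG]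
    [ChartedSpace EG G] : Prop where
  isSmoothEmbedding : IsSmoothEmbedding 𝓘(ℝ, EG) 𝓘(ℝ, F →L[ℝ] F) ∞
    (Subtype.val : G → (F →L[ℝ] F)ˣ)

section FrameBundle

variable {F : Type*} [NormedAddCommGroup F] [NormedSpace ℝ F]
  (G : Subgroup (F →L[ℝ] F)ˣ)
  {M : Type*} [TopologicalSpace M] (E : M → Type*) [TopologicalSpace (TotalSpace F E)]
  [∀ x, AddCommGroup (E x)] [∀ x, Module ℝ (E x)] [∀ x, TopologicalSpace (E x)]
  [FiberBundle F E] [VectorBundle ℝ F E]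

/-- The `G`-admissible frames of `E` at `x`: linear isomorphisms `u : F → E x` which, read in some
trivialization of the bundle, are elements of `G`. -/
def AdmFrame (x : M) : Type _ :=
  {u : F ≃L[ℝ] E x // ∃ e : Trivialization F (π F E), MemTrivializationAtlas e ∧ x ∈ e.baseSet ∧
    ∃ g ∈ G, ∀ ξ : F, (e ⟨x, u ξ⟩).2 = (g : F →L[ℝ] F) ξ}

/-- The bundle `P(E)` of `G`-admissible frames. -/
abbrev FrameBundle : Type _ := TotalSpace G (AdmFrame G E)

variable {G E}

namespace AdmFrame

/-- The coordinate in `G` of an admissible frame, in a trivialization of the bundle. -/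
def coord [IsGVectorBundle G E] (e : Trivialization F (π F E)) [MemTrivializationAtlas e] {x : M} (hx : x ∈ e.baseSet)
    (u : AdmFrame G E x) : G :=
  ⟨ContinuousLinearEquiv.toUnit (u.1.trans (e.continuousLinearEquivAt ℝ x hx)), by
    obtain ⟨u, e', he', hx', g, hg, h⟩ := u
    obtain ⟨c, hc, hc'⟩ := IsGVectorBundle.exists_mem (G := G) e' e x hx' hx
    convert G.mul_mem hc hg
    ext ξ
    change (e ⟨x, u ξ⟩).2 = (c : F →L[ℝ] F) ((g : F →L[ℝ] F) ξ)
    rw [hc', ← h, Trivialization.coordChangeL_apply e' e ⟨hx', hx⟩,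
      e'.symm_apply_apply_mk hx']⟩

/-- The admissible frame with a given coordinate in `G`, in a trivialization of the bundle. -/
def ofCoord (e : Trivialization F (π F E)) [MemTrivializationAtlas e] {x : M} (hx : x ∈ e.baseSet)
    (g : G) : AdmFrame G E x :=
  ⟨(ContinuousLinearEquiv.ofUnit g.1).trans (e.continuousLinearEquivAt ℝ x hx).symm,
    e, ‹_›, hx, g.1, g.2, fun ξ => by
      change e.continuousLinearEquivAt ℝ x hx ((e.continuousLinearEquivAt ℝ x hx).symm
        (((g : (F →L[ℝ] F)ˣ) : F →L[ℝ] F) ξ)) = _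
      exact ContinuousLinearEquiv.apply_symm_apply _ _⟩

theorem coord_apply [IsGVectorBundle G E] (e : Trivialization F (π F E)) [MemTrivializationAtlas e] {x : M}
    (hx : x ∈ e.baseSet) (u : AdmFrame G E x) (ξ : F) :
    ((u.coord e hx : (F →L[ℝ] F)ˣ) : F →L[ℝ] F) ξ = (e ⟨x, u.1 ξ⟩).2 := rfl

theorem ofCoord_apply (e : Trivialization F (π F E)) [MemTrivializationAtlas e] {x : M}
    (hx : x ∈ e.baseSet) (g : G) (ξ : F) :
    (ofCoord e hx g : AdmFrame G E x).1 ξ =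
      (e.continuousLinearEquivAt ℝ x hx).symm (((g : (F →L[ℝ] F)ˣ) : F →L[ℝ] F) ξ) := rfl

variable [IsGVectorBundle G E]

theorem coord_ofCoord (e : Trivialization F (π F E)) [MemTrivializationAtlas e] {x : M}
    (hx : x ∈ e.baseSet) (g : G) : (ofCoord e hx g : AdmFrame G E x).coord e hx = g := by
  ext ξ
  rw [coord_apply, ofCoord_apply]
  exact (e.continuousLinearEquivAt ℝ x hx).apply_symm_apply _

theorem ofCoord_coord (e : Trivialization F (π F E)) [MemTrivializationAtlas e] {x : M}
    (hx : x ∈ e.baseSet) (u : AdmFrame G E x) : ofCoord e hx (u.coord e hx) = u := by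
  apply Subtype.ext
  ext ξ
  rw [ofCoord_apply, coord_apply]
  exact (e.continuousLinearEquivAt ℝ x hx).symm_apply_apply _

theorem coord_coord (e e' : Trivialization F (π F E)) [MemTrivializationAtlas e]
    [MemTrivializationAtlas e'] {x : M} (hx : x ∈ e.baseSet) (hx' : x ∈ e'.baseSet) (g : G) :
    (((ofCoord e hx g : AdmFrame G E x).coord e' hx' : (F →L[ℝ] F)ˣ) : F →L[ℝ] F) =
      (e.coordChangeL ℝ e' x : F →L[ℝ] F) * ((g : (F →L[ℝ] F)ˣ) : F →L[ℝ] F) := by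
  ext ξ
  rw [coord_apply, ofCoord_apply]
  change _ = e.coordChangeL ℝ e' x _
  rw [Trivialization.coordChangeL_apply e e' ⟨hx, hx'⟩]
  rfl

variable (G E) in
/-- A trivialization `e` of `E` identifies the admissible frames over its base set with elements
of `G`. -/
def pretriv (e : Trivialization F (π F E)) [MemTrivializationAtlas e] :
    Pretrivialization G (π G (AdmFrame G E)) where
  toFun p := by
    classical
    exact (p.1, if hx : p.1 ∈ e.baseSet then p.2.coord e hx else 1)
  invFun q := by
    classical
    exact ⟨q.1, if hx : q.1 ∈ e.baseSet then ofCoord e hx q.2 else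
      ofCoord (trivializationAt F E q.1) (mem_baseSet_trivializationAt F E q.1) 1⟩
  source := π G (AdmFrame G E) ⁻¹' e.baseSet
  target := e.baseSet ×ˢ univ
  map_source' p (hp : p.1 ∈ e.baseSet) := ⟨hp, mem_univ _⟩
  map_target' q hq := hq.1
  left_inv' := by
    rintro ⟨x, u⟩ (hx : x ∈ e.baseSet)
    simp [hx, ofCoord_coord]
  right_inv' := by
    rintro ⟨x, g⟩ ⟨hx : x ∈ e.baseSet, -⟩
    simp [hx, coord_ofCoord]
  open_target := e.open_baseSet.prod isOpen_univ
  baseSet := e.baseSet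
  open_baseSet := e.open_baseSet
  source_eq := rfl
  target_eq := rfl
  proj_toFun _ _ := rfl

theorem pretriv_mk (e : Trivialization F (π F E)) [MemTrivializationAtlas e] {x : M}
    (hx : x ∈ e.baseSet) (u : AdmFrame G E x) : pretriv G E e ⟨x, u⟩ = (x, u.coord e hx) :=
  Prod.ext rfl (dif_pos hx)

theorem pretriv_symm_mk (e : Trivialization F (π F E)) [MemTrivializationAtlas e] {x : M}
    (hx : x ∈ e.baseSet) (g : G) :
    (pretriv G E e).toPartialEquiv.symm (x, g) = ⟨x, ofCoord e hx g⟩ :=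
  congrArg (TotalSpace.mk x) (dif_pos hx)

theorem continuousOn_val_pretriv_change (e e' : Trivialization F (π F E))
    [MemTrivializationAtlas e] [MemTrivializationAtlas e'] :
    ContinuousOn (fun q : M × G =>
        (((pretriv G E e) ((pretriv G E e').toPartialEquiv.symm q)).2 : (F →L[ℝ] F)ˣ).val)
      ((e'.baseSet ∩ e.baseSet) ×ˢ univ) := by
  have h1 : ContinuousOn (fun q : M × G => (e'.coordChangeL ℝ e q.1 : F →L[ℝ] F) *
      ((q.2 : (F →L[ℝ] F)ˣ) : F →L[ℝ] F)) ((e'.baseSet ∩ e.baseSet) ×ˢ univ) := by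
    refine ContinuousOn.mul ?_ ?_
    · exact (continuousOn_coordChange ℝ e' e).comp continuousOn_fst fun q hq => hq.1
    · exact (Units.continuous_val.comp (continuous_subtype_val.comp continuous_snd)).continuousOn
  refine h1.congr ?_
  rintro ⟨x, g⟩ ⟨⟨hx', hx⟩, -⟩
  change (((pretriv G E e) ((pretriv G E e').toPartialEquiv.symm (x, g))).2 :
    (F →L[ℝ] F)ˣ).val = _
  rw [pretriv_symm_mk e' hx', pretriv_mk e hx]
  exact coord_coord e' e hx' hx g

instance (x : M) : TopologicalSpace (AdmFrame G E x) :=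
  TopologicalSpace.induced
    (coord (trivializationAt F E x) (mem_baseSet_trivializationAt F E x)) inferInstance

variable (G E) in
/-- The local product structures of the frame bundle. -/
def prebundle [FiniteDimensional ℝ F] : FiberPrebundle G (AdmFrame G E) where
  pretrivializationAtlas := {e' | ∃ (e : Trivialization F (π F E)) (_ : MemTrivializationAtlas e),
    e' = pretriv G E e}
  pretrivializationAt x := pretriv G E (trivializationAt F E x)
  mem_base_pretrivializationAt x := mem_baseSet_trivializationAt F E x
  pretrivialization_mem_atlas x := ⟨_, inferInstance, rfl⟩
  continuous_trivChange := by
    rintro _ ⟨e, _, rfl⟩ _ ⟨e', _, rfl⟩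
    have hs : (pretriv G E e').target ∩ (pretriv G E e').toPartialEquiv.symm ⁻¹'
        (pretriv G E e).source = (e'.baseSet ∩ e.baseSet) ×ˢ univ := by
      ext ⟨x, g⟩
      constructor
      · rintro ⟨⟨h, -⟩, h'⟩
        exact ⟨⟨h, h'⟩, mem_univ _⟩
      · rintro ⟨⟨h, h'⟩, -⟩
        exact ⟨⟨h, mem_univ _⟩, h'⟩
    rw [hs]
    refine ContinuousOn.prodMk continuousOn_fst ?_
    rw [IsInducing.subtypeVal.continuousOn_iff, Units.isOpenEmbedding_val.isInducing.continuousOn_iff]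
    exact continuousOn_val_pretriv_change e e'
  totalSpaceMk_isInducing x := by
    have : (pretriv G E (trivializationAt F E x)) ∘ TotalSpace.mk x = fun u => (x, coord
        (trivializationAt F E x) (mem_baseSet_trivializationAt F E x) u) := by
      ext1 u
      exact pretriv_mk _ _ u
    rw [this]
    exact isInducing_const_prod.2 ⟨rfl⟩

end AdmFrame

namespace FrameBundle

variable [IsGVectorBundle G E] [FiniteDimensional ℝ F]

instance : TopologicalSpace (FrameBundle G E) := (AdmFrame.prebundle G E).totalSpaceTopology

instance : FiberBundle G (AdmFrame G E) := (AdmFrame.prebundle G E).toFiberBundle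

variable {EM : Type*} [NormedAddCommGroup EM] [NormedSpace ℝ EM] [ChartedSpace EM M]
  {EG : Type*} [NormedAddCommGroup EG] [NormedSpace ℝ EG] [ChartedSpace EG G]

instance : ChartedSpace (ModelProd EM EG) (FrameBundle G E) :=
  ChartedSpace.comp (ModelProd EM EG) (M × G) (FrameBundle G E)

/-- The smooth local self-maps of the product manifold `M × G`. -/
def smoothPregroupoid (EM EG : Type*) [NormedAddCommGroup EM] [NormedSpace ℝ EM]
    [NormedAddCommGroup EG] [NormedSpace ℝ EG] (M G : Type*) [TopologicalSpace M]
    [TopologicalSpace G] [ChartedSpace EM M] [ChartedSpace EG G] : Pregroupoid (M × G) where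
  property f s := ContMDiffOn (𝓘(ℝ, EM).prod 𝓘(ℝ, EG)) (𝓘(ℝ, EM).prod 𝓘(ℝ, EG)) ∞ f s
  comp hf hg _ _ _ := hg.comp' hf
  id_mem := contMDiffOn_id
  locality _ h := contMDiffOn_of_locally_contMDiffOn h
  congr _ h hf := hf.congr h

variable [ContMDiffVectorBundle ∞ F E 𝓘(ℝ, EM)] [IsEmbeddedLieSubgroup G (EG := EG)]

variable (EM EG) in
theorem contMDiffOn_pretriv_change (e e' : Trivialization F (π F E))
    [MemTrivializationAtlas e] [MemTrivializationAtlas e'] :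
    ContMDiffOn (𝓘(ℝ, EM).prod 𝓘(ℝ, EG)) (𝓘(ℝ, EM).prod 𝓘(ℝ, EG)) ∞
      (fun q : M × G => (AdmFrame.pretriv G E e)
        ((AdmFrame.pretriv G E e').toPartialEquiv.symm q))
      ((e'.baseSet ∩ e.baseSet) ×ˢ univ) := by
  have hopen : IsOpen ((e'.baseSet ∩ e.baseSet) ×ˢ (univ : Set G)) :=
    (e'.open_baseSet.inter e.open_baseSet).prod isOpen_univ
  have himm := (IsEmbeddedLieSubgroup.isSmoothEmbedding (G := G) (EG := EG)).isImmersion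
  have hι : ContMDiff 𝓘(ℝ, EG) 𝓘(ℝ, F →L[ℝ] F) ∞ (fun g : G => (g : (F →L[ℝ] F)ˣ).val) :=
    Units.contMDiff_val.comp himm.contMDiff
  have hval : ContMDiffOn (𝓘(ℝ, EM).prod 𝓘(ℝ, EG)) 𝓘(ℝ, F →L[ℝ] F) ∞ (fun q : M × G =>
      (((AdmFrame.pretriv G E e) ((AdmFrame.pretriv G E e').toPartialEquiv.symm q)).2 :
        (F →L[ℝ] F)ˣ).val) ((e'.baseSet ∩ e.baseSet) ×ˢ univ) := by
    have h1 : ContMDiffOn (𝓘(ℝ, EM).prod 𝓘(ℝ, EG)) 𝓘(ℝ, F →L[ℝ] F) ∞ (fun q : M × G =>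
        (e'.coordChangeL ℝ e q.1 : F →L[ℝ] F).comp ((q.2 : (F →L[ℝ] F)ˣ) : F →L[ℝ] F))
        ((e'.baseSet ∩ e.baseSet) ×ˢ univ) := by
      refine ContMDiffOn.clm_comp ?_ ?_
      · exact (contMDiffOn_coordChangeL e' e).comp contMDiffOn_fst fun q hq => hq.1
      · exact (hι.comp contMDiff_snd).contMDiffOn
    refine h1.congr ?_
    rintro ⟨x, g⟩ ⟨⟨hx', hx⟩, -⟩
    rw [AdmFrame.pretriv_symm_mk e' hx', AdmFrame.pretriv_mk e hx]
    exact AdmFrame.coord_coord e' e hx' hx g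
  refine ContMDiffOn.prodMk contMDiffOn_fst ?_
  intro q hq
  refine ContMDiffAt.contMDiffWithinAt ?_
  rw [ContMDiffAt.iff_comp_isImmersionAt (himm.isImmersionAt _)]
  have hc : ContMDiffAt (𝓘(ℝ, EM).prod 𝓘(ℝ, EG)) 𝓘(ℝ, F →L[ℝ] F) ∞ (Subtype.val ∘
      fun q : M × G => ((AdmFrame.pretriv G E e)
        ((AdmFrame.pretriv G E e').toPartialEquiv.symm q)).2) q := by
    refine contMDiffAt_iff_target.2 ⟨?_, hval.contMDiffAt (hopen.mem_nhds hq)⟩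
    exact Units.isOpenEmbedding_val.isInducing.continuousAt_iff.2
      (hval.contMDiffAt (hopen.mem_nhds hq)).continuousAt
  exact ⟨IsInducing.subtypeVal.continuousAt_iff.2 hc.continuousAt, hc⟩

theorem hasGroupoid_smoothPregroupoid :
    HasGroupoid (FrameBundle G E) (smoothPregroupoid EM EG M G).groupoid := by
  refine hasGroupoid_of_pregroupoid _ ?_
  rintro _ _ ⟨_, ⟨_, ⟨e, _, rfl⟩, rfl⟩, rfl⟩ ⟨_, ⟨_, ⟨e', _, rfl⟩, rfl⟩, rfl⟩
  refine (contMDiffOn_pretriv_change EM EG e' e).mono ?_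
  rintro ⟨x, g⟩ ⟨⟨h, -⟩, h'⟩
  exact ⟨⟨h, h'⟩, mem_univ _⟩

/-- The frame bundle is a smooth manifold. -/
instance [IsManifold 𝓘(ℝ, EM) ∞ M] [LieGroup 𝓘(ℝ, EG) ∞ G] : IsManifold (𝓘(ℝ, EM).prod 𝓘(ℝ, EG)) ∞ (FrameBundle G E) := by
  have := hasGroupoid_smoothPregroupoid (G := G) (E := E) (EM := EM) (EG := EG)
  refine { StructureGroupoid.HasGroupoid.comp (smoothPregroupoid EM EG M G).groupoid ?_ with }
  intro e he
  rw [isLocalStructomorphOn_contDiffGroupoid_iff]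
  exact mem_groupoid_of_pregroupoid.1 he

end FrameBundle

end FrameBundle

section Connections

variable {F : Type*} [NormedAddCommGroup F] [NormedSpace ℝ F]
  (G : Subgroup (F →L[ℝ] F)ˣ)
  {M : Type*} [TopologicalSpace M] (E : M → Type*) [TopologicalSpace (TotalSpace F E)]
  [∀ x, AddCommGroup (E x)] [∀ x, Module ℝ (E x)] [∀ x, TopologicalSpace (E x)]
  [∀ x, IsTopologicalAddGroup (E x)] [∀ x, ContinuousSMul ℝ (E x)]
  [FiberBundle F E] [VectorBundle ℝ F E]
  (EM : Type*) [NormedAddCommGroup EM] [NormedSpace ℝ EM] [ChartedSpace EM M]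

variable (F) in
/-- Smooth global sections of `E`. -/
abbrev SmoothSec : Type _ := Cₛ^∞⟮𝓘(ℝ, EM); F, E⟯

variable {E EM} in
/-- The product of a smooth function and a smooth section. -/
def SmoothSec.fsmul (f : C^∞⟮𝓘(ℝ, EM), M; ℝ⟯) (s : SmoothSec F E EM) :
    SmoothSec F E EM :=
  ⟨fun x => f x • s x, f.contMDiff.smul_section s.contMDiff⟩

variable [IsManifold 𝓘(ℝ, EM) ∞ M]

variable (F) in
/-- Smooth `E`-valued one-forms, i.e. smooth sections of `Hom(TM, E) = T*M ⊗ E`. -/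
abbrev OneForms : Type _ :=
  Cₛ^∞⟮𝓘(ℝ, EM); EM →L[ℝ] F, fun x : M => TangentSpace 𝓘(ℝ, EM) x →L[ℝ] E x⟯

variable (F) in
/-- A connection on the vector bundle `E`: a linear map `∇ : Γ(E) → Γ(T*M ⊗ E)` with
`∇(f s) = f ∇s + df ⊗ s`. -/
@[ext]
structure LinearConnection where
  toLin : SmoothSec F E EM →ₗ[ℝ] OneForms F E EM
  leibniz : ∀ (f : C^∞⟮𝓘(ℝ, EM), M; ℝ⟯) (s : SmoothSec F E EM) (x : M)
    (v : TangentSpace 𝓘(ℝ, EM) x),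
    toLin (SmoothSec.fsmul f s) x v =
      f x • toLin s x v + (show ℝ from mfderiv 𝓘(ℝ, EM) 𝓘(ℝ, ℝ) f x v) • s x

namespace LinearConnection

variable {E EM} (D : LinearConnection F E EM)

variable (EM) in
/-- The velocity of a curve defined on `[0, 1]`. -/
def velocity (σ : ℝ → M) (t : ℝ) : TangentSpace 𝓘(ℝ, EM) (σ t) :=
  mfderivWithin 𝓘(ℝ, ℝ) 𝓘(ℝ, EM) σ (Icc 0 1) t (1 : ℝ)

/-- `W` is the covariant derivative at time `t` of the section `V` of `E` along the curve
`σ : [0, 1] → M`: one has `V = ∑ cᵢ • (eᵢ ∘ σ)` near `t`, for smooth sections `eᵢ` of `E` and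
functions `cᵢ` differentiable at `t`, and `W = ∑ (cᵢ'(t) eᵢ(σ t) + cᵢ(t) ∇_{σ'(t)} eᵢ)`. -/
def HasCovDerivAlong (σ : ℝ → M) (V : ∀ t, E (σ t)) (t : ℝ) (W : E (σ t)) : Prop :=
  ∃ (n : ℕ) (e : Fin n → SmoothSec F E EM) (c : Fin n → ℝ → ℝ) (c' : Fin n → ℝ),
    (∀ᶠ τ in 𝓝[Icc 0 1] t, V τ = ∑ i, c i τ • e i (σ τ)) ∧
    (∀ i, HasDerivWithinAt (c i) (c' i) (Icc 0 1) t) ∧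
    W = ∑ i, (c' i • e i (σ t) + c i t • D.toLin (e i) (σ t) (velocity EM σ t))

/-- `w` is the parallel transport of `v` along `σ : [0, 1] → M`: there is a parallel section along
`σ` from `v` to `w`. -/
def IsParallelTransport (σ : ℝ → M) (v : E (σ 0)) (w : E (σ 1)) : Prop :=
  ∃ V : ∀ t, E (σ t), (∀ t ∈ Icc (0 : ℝ) 1, D.HasCovDerivAlong σ V t 0) ∧ V 0 = v ∧ V 1 = w

/-- A connection is admissible if its parallel transport along every smooth curve takes admissible
frames to admissible frames. -/
def IsAdmissible : Prop :=
  ∀ σ : ℝ → M, ContMDiffOn 𝓘(ℝ, ℝ) 𝓘(ℝ, EM) ∞ σ (Icc 0 1) →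
    ∀ u : AdmFrame G E (σ 0), ∃ u' : AdmFrame G E (σ 1),
      ∀ ξ : F, D.IsParallelTransport σ (u.1 ξ) (u'.1 ξ)

end LinearConnection

end Connections

section PrincipalConnections

variable {F : Type*} [NormedAddCommGroup F] [NormedSpace ℝ F] [FiniteDimensional ℝ F]
  {G : Subgroup (F →L[ℝ] F)ˣ}
  {M : Type*} [TopologicalSpace M] {E : M → Type*} [TopologicalSpace (TotalSpace F E)]
  [∀ x, AddCommGroup (E x)] [∀ x, Module ℝ (E x)] [∀ x, TopologicalSpace (E x)]
  [FiberBundle F E] [VectorBundle ℝ F E]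
  {EM : Type*} [NormedAddCommGroup EM] [NormedSpace ℝ EM]
  {EG : Type*} [NormedAddCommGroup EG] [NormedSpace ℝ EG]

/-- The frame `u ∘ g`. -/
def AdmFrame.rightMul {x : M} (u : AdmFrame G E x) (g : G) : AdmFrame G E x :=
  ⟨(ContinuousLinearEquiv.ofUnit g.1).trans u.1, by
    obtain ⟨u, e, he, hx, h, hh, hu⟩ := u
    exact ⟨e, he, hx, h * g, G.mul_mem hh g.2, fun ξ => hu _⟩⟩

namespace FrameBundle

/-- The principal right action of `G` on the frame bundle, `p ↦ p ∘ g`. -/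
def rightMul (g : G) (p : FrameBundle G E) : FrameBundle G E := ⟨p.1, p.2.rightMul g⟩

variable [IsGVectorBundle G E] [ChartedSpace EM M] [ChartedSpace EG G]

variable (EM EG) in
/-- The infinitesimal action `I_p : 𝔤 → T_p P`, the derivative of `g ↦ p ∘ g` at `1` (note
that `p ∘ 1` is `p` by definition); the Lie algebra `𝔤` is the tangent space of `G` at `1`. -/
def infAction (p : FrameBundle G E) (X : TangentSpace 𝓘(ℝ, EG) (1 : G)) :
    TangentSpace (𝓘(ℝ, EM).prod 𝓘(ℝ, EG)) p :=
  mfderiv 𝓘(ℝ, EG) (𝓘(ℝ, EM).prod 𝓘(ℝ, EG)) (fun g : G => rightMul g p) 1 X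

end FrameBundle

variable [ChartedSpace EG G]

/-- The endomorphism of `F` given by an element of the Lie algebra `𝔤` of `G ≤ GL(F)`. -/
def lieToEnd (X : TangentSpace 𝓘(ℝ, EG) (1 : G)) : F →L[ℝ] F :=
  mfderiv 𝓘(ℝ, EG) 𝓘(ℝ, F →L[ℝ] F) (fun g : G => ((g : (F →L[ℝ] F)ˣ) : F →L[ℝ] F)) 1 X

variable [IsGVectorBundle G E] [ChartedSpace EM M] [IsManifold 𝓘(ℝ, EM) ∞ M]
  [ContMDiffVectorBundle ∞ F E 𝓘(ℝ, EM)] [LieGroup 𝓘(ℝ, EG) ∞ G]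
  [IsEmbeddedLieSubgroup G (EG := EG)]

variable (G E EM EG) in
/-- A connection on the principal bundle `P(E)`: a smooth distribution `H` (of rank `dim M`),
complementary to the vertical distribution `ker dπ` and invariant under the action of `G`. -/
@[ext]
structure PrincipalConnection where
  H : ∀ p : FrameBundle G E, Submodule ℝ (TangentSpace (𝓘(ℝ, EM).prod 𝓘(ℝ, EG)) p)
  smooth : ∀ p, ∃ U : Set (FrameBundle G E), IsOpen U ∧ p ∈ U ∧
    ∃ Y : Fin (Module.finrank ℝ EM) →
        ∀ q : FrameBundle G E, TangentSpace (𝓘(ℝ, EM).prod 𝓘(ℝ, EG)) q,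
      (∀ i, ContMDiffOn (𝓘(ℝ, EM).prod 𝓘(ℝ, EG)) (𝓘(ℝ, EM).prod 𝓘(ℝ, EG)).tangent ∞
        (fun q => (⟨q, Y i q⟩ : TangentBundle (𝓘(ℝ, EM).prod 𝓘(ℝ, EG)) (FrameBundle G E))) U) ∧
      ∀ q ∈ U, LinearIndependent ℝ (fun i => Y i q) ∧
        Submodule.span ℝ (range fun i => Y i q) = H q
  isCompl : ∀ p, IsCompl (H p)
    (mfderiv (𝓘(ℝ, EM).prod 𝓘(ℝ, EG)) 𝓘(ℝ, EM) (π G (AdmFrame G E)) p).ker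
  invariant : ∀ (g : G) (p : FrameBundle G E),
    (H p).map (mfderiv (𝓘(ℝ, EM).prod 𝓘(ℝ, EG)) (𝓘(ℝ, EM).prod 𝓘(ℝ, EG))
      (FrameBundle.rightMul g) p).toLinearMap = H (FrameBundle.rightMul g p)

/-- `X = ω_p(w)`, where `ω` is the connection form of `H`: the vertical component of `w`, along
`H p`, is `I_p X`. -/
def PrincipalConnection.HasFormValue (C : PrincipalConnection G E EM EG) (p : FrameBundle G E)
    (w : TangentSpace (𝓘(ℝ, EM).prod 𝓘(ℝ, EG)) p) (X : TangentSpace 𝓘(ℝ, EG) (1 : G)) : Prop :=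
  w - FrameBundle.infAction EM EG p X ∈ C.H p

variable [∀ x, IsTopologicalAddGroup (E x)] [∀ x, ContinuousSMul ℝ (E x)]

/-- `X = ω^s_x(v)`, where `ω^s` is the local connection form of `∇` in the moving frame `s` near
`x`: one has `∇_v (s ξ) = s (X ξ)` at `x` for all constant `ξ : F`, i.e. `∇_v sᵢ = ∑ⱼ Xʲᵢ sⱼ`. The
local section `s ξ` is represented by any global section which agrees with it near `x`. -/
def LinearConnection.HasLocalFormValue (D : LinearConnection F E EM) (s : ∀ y, AdmFrame G E y)
    (x : M) (v : TangentSpace 𝓘(ℝ, EM) x) (X : TangentSpace 𝓘(ℝ, EG) (1 : G)) : Prop :=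
  ∀ (ξ : F) (t : SmoothSec F E EM), (∀ᶠ y in 𝓝 x, t y = (s y).1 ξ) →
    D.toLin t x v = (s x).1 (lieToEnd X ξ)

/-- The connection `∇` on `E` and the connection `H` on `P(E)` correspond to each other: for each
smooth local section `s` of `P(E)`, the local connection form `ω^s` of `∇` is the pull-back `s^*ω`
of the connection form `ω` of `H`. -/
def Corresponds (D : LinearConnection F E EM) (C : PrincipalConnection G E EM EG) : Prop :=
  ∀ (U : Set M) (s : ∀ y, AdmFrame G E y), IsOpen U →
    ContMDiffOn 𝓘(ℝ, EM) (𝓘(ℝ, EM).prod 𝓘(ℝ, EG)) ∞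
      (fun y => (⟨y, s y⟩ : FrameBundle G E)) U →
    ∀ x ∈ U, ∀ (v : TangentSpace 𝓘(ℝ, EM) x) (X : TangentSpace 𝓘(ℝ, EG) (1 : G)),
      C.HasFormValue ⟨x, s x⟩ (mfderiv 𝓘(ℝ, EM) (𝓘(ℝ, EM).prod 𝓘(ℝ, EG))
        (fun y => (⟨y, s y⟩ : FrameBundle G E)) x v) X ↔ D.HasLocalFormValue s x v X

end PrincipalConnections

end

/-! A section `t` of `E` is encoded by the function `secFun t : p ↦ p⁻¹ (t (π p))` on the frame
bundle, which is equivariant: `secFun t (p ∘ g) = g⁻¹ (secFun t p)`. A linear connection `D` singles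
out at each frame `p` the space `D.horizontal` of all `w` with `d(secFun t)(w) = p⁻¹ (∇_{dπ w} t)`
for every `t`. Equivariance makes these spaces invariant under `G`. Since `d(secFun t)(I_p X) = -X
(secFun t p)` and `𝔤 → End F` is injective, they contain no nonzero vertical vector. By
`corresponds_iff`, a principal connection `C` corresponds to `D` exactly when `C.H` is the family of
horizontal spaces of `D`.

For a general `D` only one thing can go wrong: the horizontal spaces may be too small to project
onto the tangent spaces of `M`. They do project onto them (`HasLifts`) exactly when the connection
matrices of `D` in trivializations lie in `𝔤`, and the heart of the proof is that this is equivalent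
to admissibility. If `D` is admissible, parallel transport along the initial pieces of a short curve
is a curve in `G` whose velocity at `0` is minus the connection matrix; as `G` is embedded, this
velocity is in `𝔤` (`IsAdmissible.exists_lieToEndL_eq`, `IsAdmissible.hasLifts`). Conversely, if the
matrices lie in `𝔤`, the equation of parallel frames is the flow of a time-dependent right-invariant
vector field on `G`, so it has local solutions in `G` (`exists_local_solution`), and these are glued
along the curve (`HasLifts.isAdmissible`).

The inverse map sends `C` to `∇_v t = p (d(secFun t)(v^h))`, where `v^h` is the lift of `v` to `C.H
p`; invariance of `C` makes this independent of `p` (`PrincipalConnection.toLinear`). Its horizontal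
spaces are those of `C` (`horizontal_toLinear`), and a connection with lifts is recovered from its
horizontal spaces (`LinearConnection.eq_of_horizontal_eq`), so the correspondence is bijective. -/

noncomputable section

set_option linter.unusedSectionVars false

/-! ### Smoothness of the local product structures of the frame bundle -/

section FrameBundleSmooth

variable {F : Type*} [NormedAddCommGroup F] [NormedSpace ℝ F] [FiniteDimensional ℝ F]
  {G : Subgroup (F →L[ℝ] F)ˣ}
  {M : Type*} [TopologicalSpace M] {E : M → Type*} [TopologicalSpace (TotalSpace F E)]
  [∀ x, AddCommGroup (E x)] [∀ x, Module ℝ (E x)] [∀ x, TopologicalSpace (E x)]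
  [FiberBundle F E] [VectorBundle ℝ F E]
  {EM : Type*} [NormedAddCommGroup EM] [NormedSpace ℝ EM]
  {EG : Type*} [NormedAddCommGroup EG] [NormedSpace ℝ EG]
  [IsGVectorBundle G E] [ChartedSpace EM M] [ChartedSpace EG G]

namespace FrameBundle

theorem extChartAt_apply (p q : FrameBundle G E) :
    extChartAt (𝓘(ℝ, EM).prod 𝓘(ℝ, EG)) p q =
      extChartAt (𝓘(ℝ, EM).prod 𝓘(ℝ, EG)) (trivializationAt G (AdmFrame G E) p.1 p)
        (trivializationAt G (AdmFrame G E) p.1 q) := rfl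

variable (EM EG) in
-- The charts of the frame bundle are by construction the charts of `M × G` composed with these
-- trivializations, so the map is the identity in charts.
theorem contMDiffAt_trivializationAt (p : FrameBundle G E) :
    ContMDiffAt (𝓘(ℝ, EM).prod 𝓘(ℝ, EG)) (𝓘(ℝ, EM).prod 𝓘(ℝ, EG)) ∞
      (trivializationAt G (AdmFrame G E) p.1) p := by
  set e := trivializationAt G (AdmFrame G E) p.1 with he
  have hp : p ∈ e.source := by
    rw [e.mem_source]; exact mem_baseSet_trivializationAt _ _ _
  rw [contMDiffAt_iff]
  refine ⟨e.toOpenPartialHomeomorph.continuousAt hp, ?_⟩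
  refine contDiffWithinAt_id.congr_of_eventuallyEq_of_mem ?_ (by simp)
  filter_upwards [extChartAt_target_mem_nhdsWithin (I := 𝓘(ℝ, EM).prod 𝓘(ℝ, EG)) p] with y hy
  exact (extChartAt (𝓘(ℝ, EM).prod 𝓘(ℝ, EG)) p).right_inv hy

variable (EM EG) in
theorem contMDiffAt_trivializationAt_symm (p : FrameBundle G E) :
    ContMDiffAt (𝓘(ℝ, EM).prod 𝓘(ℝ, EG)) (𝓘(ℝ, EM).prod 𝓘(ℝ, EG)) ∞
      (trivializationAt G (AdmFrame G E) p.1).toOpenPartialHomeomorph.symm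
      (trivializationAt G (AdmFrame G E) p.1 p) := by
  set e := trivializationAt G (AdmFrame G E) p.1 with he
  have hp : p ∈ e.source := by
    rw [e.mem_source]; exact mem_baseSet_trivializationAt _ _ _
  have hq : e p ∈ e.target := e.map_source hp
  have hs : e.toOpenPartialHomeomorph.symm (e p) = p :=
    e.toOpenPartialHomeomorph.left_inv hp
  rw [contMDiffAt_iff]
  refine ⟨e.toOpenPartialHomeomorph.symm.continuousAt hq, ?_⟩
  rw [hs]
  refine contDiffWithinAt_id.congr_of_eventuallyEq_of_mem ?_ (by simp)
  have h1 : e.target ∈ 𝓝 (e p) := e.open_target.mem_nhds hq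
  have h2 := (continuousAt_extChartAt_symm (I := 𝓘(ℝ, EM).prod 𝓘(ℝ, EG)) (e p)).preimage_mem_nhds
    (by rw [extChartAt_to_inv]; exact h1)
  filter_upwards [extChartAt_target_mem_nhdsWithin (I := 𝓘(ℝ, EM).prod 𝓘(ℝ, EG)) (e p),
    mem_nhdsWithin_of_mem_nhds h2] with y hy hy2
  rw [Function.comp_apply, Function.comp_apply, extChartAt_apply, ← he,
    show e (e.toOpenPartialHomeomorph.symm ((extChartAt (𝓘(ℝ, EM).prod 𝓘(ℝ, EG)) (e p)).symm y))
      = _ from e.toOpenPartialHomeomorph.right_inv hy2]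
  exact (extChartAt (𝓘(ℝ, EM).prod 𝓘(ℝ, EG)) (e p)).right_inv hy

theorem continuous_proj : Continuous (π G (AdmFrame G E)) :=
  FiberBundle.continuous_proj G (AdmFrame G E)

variable [ContMDiffVectorBundle ∞ F E 𝓘(ℝ, EM)] [IsEmbeddedLieSubgroup G (EG := EG)]

variable (EM EG) in
-- The manifold structure refers only to the preferred trivialization at each point; an arbitrary
-- `e` differs from it by a transition map, smooth by `contMDiffOn_pretriv_change`.
theorem contMDiffAt_pretriv (e : Trivialization F (π F E)) [MemTrivializationAtlas e]
    {p : FrameBundle G E} (hp : p.1 ∈ e.baseSet) :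
    ContMDiffAt (𝓘(ℝ, EM).prod 𝓘(ℝ, EG)) (𝓘(ℝ, EM).prod 𝓘(ℝ, EG)) ∞
      (AdmFrame.pretriv G E e) p := by
  have h0 : p.1 ∈ (trivializationAt F E p.1).baseSet := mem_baseSet_trivializationAt _ _ _
  have h := (contMDiffOn_pretriv_change (G := G) EM EG e (trivializationAt F E p.1)).contMDiffAt
    (x := AdmFrame.pretriv G E (trivializationAt F E p.1) p)
    (((((trivializationAt F E p.1).open_baseSet.inter e.open_baseSet).prod isOpen_univ)).mem_nhds
      ⟨⟨h0, hp⟩, mem_univ _⟩)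
  have h2 := h.comp p (contMDiffAt_trivializationAt EM EG p)
  refine h2.congr_of_eventuallyEq ?_
  filter_upwards [((trivializationAt F E p.1).open_baseSet.preimage continuous_proj).mem_nhds h0]
    with q hq
  exact congrArg (AdmFrame.pretriv G E e)
    ((AdmFrame.pretriv G E (trivializationAt F E p.1)).left_inv hq).symm

variable (EM EG) in
theorem contMDiffAt_pretriv_symm (e : Trivialization F (π F E)) [MemTrivializationAtlas e]
    {q : M × G} (hq : q.1 ∈ e.baseSet) :
    ContMDiffAt (𝓘(ℝ, EM).prod 𝓘(ℝ, EG)) (𝓘(ℝ, EM).prod 𝓘(ℝ, EG)) ∞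
      (AdmFrame.pretriv G E e).toPartialEquiv.symm q := by
  set e₀ := trivializationAt F E q.1
  have h0 : q.1 ∈ e₀.baseSet := mem_baseSet_trivializationAt _ _ _
  have h := (contMDiffOn_pretriv_change (G := G) EM EG e₀ e).contMDiffAt
    (x := q) (((e.open_baseSet.inter e₀.open_baseSet).prod isOpen_univ).mem_nhds
      ⟨⟨hq, h0⟩, mem_univ _⟩)
  set p : FrameBundle G E := (AdmFrame.pretriv G E e).toPartialEquiv.symm q
  have h3 : ContMDiffAt (𝓘(ℝ, EM).prod 𝓘(ℝ, EG)) (𝓘(ℝ, EM).prod 𝓘(ℝ, EG)) ∞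
      (AdmFrame.pretriv G E e₀).toPartialEquiv.symm (AdmFrame.pretriv G E e₀ p) :=
    contMDiffAt_trivializationAt_symm EM EG p
  have h2 := h3.comp q h
  refine h2.congr_of_eventuallyEq ?_
  filter_upwards [((e.open_baseSet.inter e₀.open_baseSet).preimage continuous_fst).mem_nhds
    (⟨hq, h0⟩ : q.1 ∈ e.baseSet ∩ e₀.baseSet)] with r hr
  exact ((AdmFrame.pretriv G E e₀).left_inv
    (x := (AdmFrame.pretriv G E e).toPartialEquiv.symm r) hr.2).symm

end FrameBundle
end FrameBundleSmooth

/-! ### The embedding of `G` in `End F` and its differential at the identity -/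

section FrameBundleCalculus

variable {F : Type*} [NormedAddCommGroup F] [NormedSpace ℝ F] [FiniteDimensional ℝ F]
  {G : Subgroup (F →L[ℝ] F)ˣ}
  {M : Type*} [TopologicalSpace M] {E : M → Type*} [TopologicalSpace (TotalSpace F E)]
  [∀ x, AddCommGroup (E x)] [∀ x, Module ℝ (E x)] [∀ x, TopologicalSpace (E x)]
  [FiberBundle F E] [VectorBundle ℝ F E]
  {EM : Type*} [NormedAddCommGroup EM] [NormedSpace ℝ EM]
  {EG : Type*} [NormedAddCommGroup EG] [NormedSpace ℝ EG]
  [ChartedSpace EM M] [ChartedSpace EG G]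

section Group

variable [IsEmbeddedLieSubgroup G (EG := EG)]

variable (G) in
/-- The inclusion of `G ≤ GL(F)` into the endomorphisms of `F`. -/
def toEnd (g : G) : F →L[ℝ] F := ((g : (F →L[ℝ] F)ˣ) : F →L[ℝ] F)

theorem toEnd_mul (g h : G) : toEnd G (g * h) = (toEnd G g).comp (toEnd G h) := rfl

theorem toEnd_inv_apply_toEnd (g : G) (ξ : F) : toEnd G g⁻¹ (toEnd G g ξ) = ξ := by
  rw [← ContinuousLinearMap.comp_apply, ← toEnd_mul, inv_mul_cancel]; rfl

theorem toEnd_apply_toEnd_inv (g : G) (ξ : F) : toEnd G g (toEnd G g⁻¹ ξ) = ξ := by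
  rw [← ContinuousLinearMap.comp_apply, ← toEnd_mul, mul_inv_cancel]; rfl

theorem contMDiff_toEnd : ContMDiff 𝓘(ℝ, EG) 𝓘(ℝ, F →L[ℝ] F) ∞ (toEnd G) :=
  Units.contMDiff_val.comp
    (IsEmbeddedLieSubgroup.isSmoothEmbedding (G := G) (EG := EG)).isImmersion.contMDiff

theorem toEnd_inv_eq_inverse (g : G) : toEnd G g⁻¹ = Ring.inverse (toEnd G g) :=
  (Ring.inverse_unit (g : (F →L[ℝ] F)ˣ)).symm

theorem contMDiff_toEnd_inv :
    ContMDiff 𝓘(ℝ, EG) 𝓘(ℝ, F →L[ℝ] F) ∞ (fun g : G => toEnd G g⁻¹) := by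
  intro g
  have h := (contDiffAt_ringInverse ℝ (n := ∞) (g : (F →L[ℝ] F)ˣ)).contMDiffAt
  exact (h.comp g (contMDiff_toEnd (EG := EG) g)).congr_of_eventuallyEq
    (Filter.Eventually.of_forall toEnd_inv_eq_inverse)

/-- In suitable charts an immersion is `y ↦ (y, 0)`, and projecting to the first factor undoes it.
This is the form in which the embedding hypothesis is used afterwards: smooth maps and velocities in
`End F` are pulled back to `G` along `r`. -/
theorem exists_contMDiffAt_leftInverse (g₀ : G) : ∃ r : (F →L[ℝ] F) → G,
    ContMDiffAt 𝓘(ℝ, F →L[ℝ] F) 𝓘(ℝ, EG) ∞ r (toEnd G g₀) ∧ ∀ᶠ g in 𝓝 g₀, r (toEnd G g) = g := by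
  have h := (IsEmbeddedLieSubgroup.isSmoothEmbedding (G := G) (EG := EG)).isImmersion.isImmersionAt g₀
  let c := chartAt (F →L[ℝ] F) (g₀ : (F →L[ℝ] F)ˣ)
  -- The chart of `GL(F)` is the inclusion into `End F`; its inverse turns endomorphisms near `g₀`
  -- back into units.
  have hc : ∀ a : (F →L[ℝ] F)ˣ, c.symm a = a := fun a => c.left_inv (mem_univ a)
  have heq : ∀ g ∈ h.domChart.source,
      h.equiv.symm (h.codChart (g : (F →L[ℝ] F)ˣ)) = (h.domChart g, 0) := fun g hg => by
    have hm : h.domChart g ∈ (h.domChart.extend 𝓘(ℝ, EG)).target := by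
      simpa using h.domChart.map_source hg
    have hw := h.writtenInCharts hm
    simp only [Function.comp_apply, OpenPartialHomeomorph.extend_coe, modelWithCornersSelf_coe,
      OpenPartialHomeomorph.extend_coe_symm, modelWithCornersSelf_coe_symm, id_eq,
      h.domChart.left_inv hg] at hw
    rw [hw, ContinuousLinearEquiv.symm_apply_apply]
  refine ⟨fun u => h.domChart.symm (h.equiv.symm (h.codChart (c.symm u))).1, ?_, ?_⟩
  · have h1 : ContMDiffAt 𝓘(ℝ, F →L[ℝ] F) 𝓘(ℝ, F →L[ℝ] F) ∞ c.symm (toEnd G g₀) :=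
      (contMDiffOn_chart_symm (x := (g₀ : (F →L[ℝ] F)ˣ))).contMDiffAt
        (c.open_target.mem_nhds (c.map_source (mem_univ _)))
    have h2 : ContMDiffAt 𝓘(ℝ, F →L[ℝ] F) 𝓘(ℝ, F →L[ℝ] F) ∞ h.codChart
        (c.symm (toEnd G g₀)) := by
      rw [show c.symm (toEnd G g₀) = g₀ from hc _]
      exact contMDiffAt_of_mem_maximalAtlas h.codChart_mem_maximalAtlas h.mem_codChart_source
    have h3 : ContMDiffAt 𝓘(ℝ, F →L[ℝ] F) 𝓘(ℝ, EG) ∞ (fun u => (h.equiv.symm u).1)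
        (h.codChart (c.symm (toEnd G g₀))) := by
      refine ContDiffAt.contMDiffAt ?_
      exact contDiff_fst.contDiffAt.comp _ h.equiv.symm.contDiff.contDiffAt
    have h4 : ContMDiffAt 𝓘(ℝ, EG) 𝓘(ℝ, EG) ∞ h.domChart.symm
        (h.equiv.symm (h.codChart (c.symm (toEnd G g₀)))).1 := by
      rw [show c.symm (toEnd G g₀) = g₀ from hc _, heq g₀ h.mem_domChart_source]
      exact contMDiffAt_symm_of_mem_maximalAtlas h.domChart_mem_maximalAtlas
        (h.domChart.map_source h.mem_domChart_source)
    exact h4.comp (f := fun u => (h.equiv.symm (h.codChart (c.symm u))).1) _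
      (h3.comp (f := fun u => h.codChart (c.symm u)) _ (h2.comp _ h1))
  · filter_upwards [h.domChart.open_source.mem_nhds h.mem_domChart_source] with g hg
    rw [show c.symm (toEnd G g) = g from hc _, heq g hg]
    exact h.domChart.left_inv hg

theorem hasMFDerivAt_toEnd :
    HasMFDerivAt 𝓘(ℝ, EG) 𝓘(ℝ, F →L[ℝ] F) (toEnd G) 1
      (mfderiv 𝓘(ℝ, EG) 𝓘(ℝ, F →L[ℝ] F) (toEnd G) 1) :=
  ((contMDiff_toEnd (EG := EG) 1).mdifferentiableAt (by simp)).hasMFDerivAt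

variable (G EG) in
/-- `lieToEnd` as a linear map. -/
def lieToEndL : EG →ₗ[ℝ] (F →L[ℝ] F) :=
  (mfderiv 𝓘(ℝ, EG) 𝓘(ℝ, F →L[ℝ] F) (toEnd G) 1).toLinearMap

theorem lieToEndL_injective : Function.Injective (lieToEndL G EG) := by
  obtain ⟨r, hr, hr'⟩ := exists_contMDiffAt_leftInverse (EG := EG) (1 : G)
  have h1 := (hr.mdifferentiableAt (by simp)).hasMFDerivAt.comp (1 : G)
    (hasMFDerivAt_toEnd (G := G) (EG := EG))
  have h2 : HasMFDerivAt 𝓘(ℝ, EG) 𝓘(ℝ, EG) (r ∘ toEnd G) (1 : G)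
      (ContinuousLinearMap.id ℝ (TangentSpace 𝓘(ℝ, EG) (1 : G))) :=
    (hasMFDerivAt_id (1 : G)).congr_of_eventuallyEq hr'
  have h3 := hasMFDerivAt_unique h1 h2
  intro X Y hXY
  have hX := congrArg (fun L : EG →L[ℝ] EG => L X) h3
  have hY := congrArg (fun L : EG →L[ℝ] EG => L Y) h3
  have hX' : X = mfderiv 𝓘(ℝ, F →L[ℝ] F) 𝓘(ℝ, EG) r (toEnd G 1) (lieToEndL G EG X) := hX.symm
  have hY' : Y = mfderiv 𝓘(ℝ, F →L[ℝ] F) 𝓘(ℝ, EG) r (toEnd G 1) (lieToEndL G EG Y) := hY.symm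
  rw [hX', hXY, ← hY']

theorem hasMFDerivAt_toEnd_inv :
    HasMFDerivAt 𝓘(ℝ, EG) 𝓘(ℝ, F →L[ℝ] F) (fun g : G => toEnd G g⁻¹) 1
      (-(mfderiv 𝓘(ℝ, EG) 𝓘(ℝ, F →L[ℝ] F) (toEnd G) 1 : EG →L[ℝ] (F →L[ℝ] F))) := by
  have h := (hasFDerivAt_ringInverse (𝕜 := ℝ) (1 : (F →L[ℝ] F)ˣ)).hasMFDerivAt
  have h2 := HasMFDerivAt.comp (1 : G) (I' := 𝓘(ℝ, F →L[ℝ] F)) (g := Ring.inverse) h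
    (hasMFDerivAt_toEnd (G := G) (EG := EG))
  have h3 := h2.congr_of_eventuallyEq
    (Filter.Eventually.of_forall (toEnd_inv_eq_inverse (G := G)))
  refine h3.congr_mfderiv ?_
  refine ContinuousLinearMap.ext fun X => ?_
  change -((((1 : (F →L[ℝ] F)ˣ)⁻¹ : (F →L[ℝ] F)ˣ) : F →L[ℝ] F) *
    lieToEndL G EG X * (((1 : (F →L[ℝ] F)ˣ)⁻¹ : (F →L[ℝ] F)ˣ) : F →L[ℝ] F)) = -(lieToEndL G EG X)
  rw [inv_one, Units.val_one, one_mul, mul_one]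

end Group
end FrameBundleCalculus

/-! ### Sections of `E` as equivariant functions on the frame bundle -/

section FrameBundleFunctions

variable {F : Type*} [NormedAddCommGroup F] [NormedSpace ℝ F] [FiniteDimensional ℝ F]
  {G : Subgroup (F →L[ℝ] F)ˣ}
  {M : Type*} [TopologicalSpace M] {E : M → Type*} [TopologicalSpace (TotalSpace F E)]
  [∀ x, AddCommGroup (E x)] [∀ x, Module ℝ (E x)] [∀ x, TopologicalSpace (E x)]
  [FiberBundle F E] [VectorBundle ℝ F E]
  {EM : Type*} [NormedAddCommGroup EM] [NormedSpace ℝ EM]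
  {EG : Type*} [NormedAddCommGroup EG] [NormedSpace ℝ EG]
  [ChartedSpace EM M] [ChartedSpace EG G]

namespace FrameBundle

/-- The `F`-valued function on the frame bundle given by a section `t` of `E`: the coordinates
`p⁻¹ (t x)` of `t x` in the frame `p` at `x`. -/
def secFun (t : ∀ x, E x) (p : FrameBundle G E) : F := p.2.1.symm (t p.1)

theorem frame_secFun (t : ∀ x, E x) (p : FrameBundle G E) : p.2.1 (secFun t p) = t p.1 :=
  p.2.1.apply_symm_apply _

theorem rightMul_rightMul (g h : G) (p : FrameBundle G E) :
    rightMul h (rightMul g p) = rightMul (g * h) p := rfl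

variable (G) in
/-- The local section of the frame bundle which is constantly equal to `g` in the trivialization
`e` (with junk values outside the base set of `e`). -/
def localSec [IsGVectorBundle G E] (e : Trivialization F (π F E)) [MemTrivializationAtlas e]
    (g : G) (x : M) : AdmFrame G E x :=
  ((AdmFrame.pretriv G E e).toPartialEquiv.symm (x, g)).2

variable [IsGVectorBundle G E]

section

variable (e : Trivialization F (π F E)) [MemTrivializationAtlas e]

/-- The group coordinate of a frame in a trivialization of `E`. -/
def coordMap (p : FrameBundle G E) : G := (AdmFrame.pretriv G E e p).2

theorem coordMap_eq {p : FrameBundle G E} (hp : p.1 ∈ e.baseSet) :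
    coordMap e p = p.2.coord e hp := by
  rw [coordMap, AdmFrame.pretriv_mk e hp]

theorem toEnd_coordMap {p : FrameBundle G E} (hp : p.1 ∈ e.baseSet) (ξ : F) :
    toEnd G (coordMap e p) ξ = (e ⟨p.1, p.2.1 ξ⟩).2 := by
  rw [coordMap_eq e hp]; rfl

theorem coordMap_rightMul {p : FrameBundle G E} (hp : p.1 ∈ e.baseSet) (g : G) :
    coordMap e (rightMul g p) = coordMap e p * g := by
  have hp' : (rightMul g p).1 ∈ e.baseSet := hp
  rw [coordMap_eq e hp, coordMap_eq e hp']
  rfl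

theorem pretriv_symm_coordMap {p : FrameBundle G E} (hp : p.1 ∈ e.baseSet) :
    (AdmFrame.pretriv G E e).toPartialEquiv.symm (p.1, coordMap e p) = p :=
  (AdmFrame.pretriv G E e).left_inv (x := p) hp

theorem coordMap_pretriv_symm {x : M} (hx : x ∈ e.baseSet) (g : G) :
    coordMap e ((AdmFrame.pretriv G E e).toPartialEquiv.symm (x, g)) = g :=
  congrArg Prod.snd ((AdmFrame.pretriv G E e).right_inv (x := (x, g)) ⟨hx, mem_univ _⟩)

theorem coordMap_localSec {x : M} (hx : x ∈ e.baseSet) (g : G) :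
    coordMap e ⟨x, localSec G e g x⟩ = g := coordMap_pretriv_symm e hx g

theorem localSec_apply {x : M} (hx : x ∈ e.baseSet) (g : G) (ξ : F) :
    (e ⟨x, (localSec G e g x).1 ξ⟩).2 = toEnd G g ξ := by
  rw [← toEnd_coordMap e (p := ⟨x, localSec G e g x⟩) hx, coordMap_localSec e hx]

theorem localSec_eq_symm {x : M} (hx : x ∈ e.baseSet) (g : G) (ξ : F) :
    (localSec G e g x).1 ξ = e.symm x (toEnd G g ξ) := by
  rw [← localSec_apply e hx, e.symm_apply_apply_mk hx]

theorem rightMul_localSec {x : M} (hx : x ∈ e.baseSet) (g h : G) :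
    rightMul h (⟨x, localSec G e g x⟩ : FrameBundle G E) = ⟨x, localSec G e (g * h) x⟩ := by
  refine congrArg (TotalSpace.mk x) (Subtype.ext (ContinuousLinearEquiv.ext (funext fun ξ => ?_)))
  change (localSec G e g x).1 (toEnd G h ξ) = _
  erw [localSec_eq_symm e hx, localSec_eq_symm e hx]
  rfl

theorem secFun_eq (t : ∀ x, E x) {p : FrameBundle G E} (hp : p.1 ∈ e.baseSet) :
    secFun t p = toEnd G (coordMap e p)⁻¹ (e ⟨p.1, t p.1⟩).2 := by
  rw [← frame_secFun t p, ← toEnd_coordMap e hp, toEnd_inv_apply_toEnd]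

end

section

variable [ContMDiffVectorBundle ∞ F E 𝓘(ℝ, EM)] [IsEmbeddedLieSubgroup G (EG := EG)]

section

variable (e : Trivialization F (π F E)) [MemTrivializationAtlas e]

variable (EM EG) in
theorem contMDiffAt_coordMap {p : FrameBundle G E} (hp : p.1 ∈ e.baseSet) :
    ContMDiffAt (𝓘(ℝ, EM).prod 𝓘(ℝ, EG)) 𝓘(ℝ, EG) ∞ (coordMap e) p :=
  contMDiffAt_snd.comp p (contMDiffAt_pretriv EM EG e hp)

variable (EM EG) in
theorem contMDiffAt_localSec {x : M} (hx : x ∈ e.baseSet) (g : G) :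
    ContMDiffAt 𝓘(ℝ, EM) (𝓘(ℝ, EM).prod 𝓘(ℝ, EG)) ∞
      (fun y => (⟨y, localSec G e g y⟩ : FrameBundle G E)) x :=
  (contMDiffAt_pretriv_symm EM EG e (q := (x, g)) hx).comp x
    (contMDiffAt_id.prodMk contMDiffAt_const)

end

variable (EM EG) in
theorem contMDiff_proj' : ContMDiff (𝓘(ℝ, EM).prod 𝓘(ℝ, EG)) 𝓘(ℝ, EM) ∞
    (π G (AdmFrame G E)) := fun p =>
  contMDiffAt_fst.comp p
    (contMDiffAt_pretriv EM EG (trivializationAt F E p.1) (mem_baseSet_trivializationAt _ _ _))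

variable (EM EG) in
theorem contMDiffAt_secFun {t : ∀ x, E x} {p : FrameBundle G E}
    (ht : ContMDiffAt 𝓘(ℝ, EM) (𝓘(ℝ, EM).prod 𝓘(ℝ, F)) ∞ (fun x => TotalSpace.mk' F x (t x)) p.1) :
    ContMDiffAt (𝓘(ℝ, EM).prod 𝓘(ℝ, EG)) 𝓘(ℝ, F) ∞ (secFun t) p := by
  set e := trivializationAt F E p.1
  have h0 : p.1 ∈ e.baseSet := mem_baseSet_trivializationAt _ _ _
  have h1 : ContMDiffAt (𝓘(ℝ, EM).prod 𝓘(ℝ, EG)) 𝓘(ℝ, F →L[ℝ] F) ∞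
      (fun q : FrameBundle G E => toEnd G (coordMap e q)⁻¹) p :=
    (contMDiff_toEnd_inv (EG := EG) _).comp p (contMDiffAt_coordMap EM EG e h0)
  have h2 : ContMDiffAt (𝓘(ℝ, EM).prod 𝓘(ℝ, EG)) 𝓘(ℝ, F) ∞
      (fun q : FrameBundle G E => (e ⟨q.1, t q.1⟩).2) p :=
    ((e.contMDiffAt_section_iff h0).1 ht).comp p (contMDiff_proj' EM EG p)
  refine (h1.clm_apply h2).congr_of_eventuallyEq ?_
  filter_upwards [(e.open_baseSet.preimage continuous_proj).mem_nhds h0] with q hq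
  exact secFun_eq e t hq

section

variable [LieGroup 𝓘(ℝ, EG) ∞ G]

variable (EM EG) in
theorem contMDiff_rightMul (g : G) : ContMDiff (𝓘(ℝ, EM).prod 𝓘(ℝ, EG))
    (𝓘(ℝ, EM).prod 𝓘(ℝ, EG)) ∞ (rightMul g : FrameBundle G E → FrameBundle G E) := by
  intro p
  set e := trivializationAt F E p.1
  have h0 : p.1 ∈ e.baseSet := mem_baseSet_trivializationAt _ _ _
  have h1 : ContMDiffAt (𝓘(ℝ, EM).prod 𝓘(ℝ, EG)) (𝓘(ℝ, EM).prod 𝓘(ℝ, EG)) ∞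
      (fun q : FrameBundle G E => (q.1, coordMap e q * g)) p :=
    (contMDiff_proj' EM EG p).prodMk ((contMDiffAt_coordMap EM EG e h0).mul contMDiffAt_const)
  refine ((contMDiffAt_pretriv_symm EM EG e (q := (p.1, coordMap e p * g)) h0).comp p
    h1).congr_of_eventuallyEq ?_
  filter_upwards [(e.open_baseSet.preimage continuous_proj).mem_nhds h0] with q hq
  have hq' : (rightMul g q).1 ∈ e.baseSet := hq
  rw [← pretriv_symm_coordMap e hq', coordMap_rightMul e hq]
  rfl

variable (EM EG) in
theorem contMDiff_orbit (p : FrameBundle G E) : ContMDiff 𝓘(ℝ, EG)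
    (𝓘(ℝ, EM).prod 𝓘(ℝ, EG)) ∞ (fun g : G => rightMul g p) := by
  intro g
  set e := trivializationAt F E p.1
  have h0 : p.1 ∈ e.baseSet := mem_baseSet_trivializationAt _ _ _
  have h1 : ContMDiffAt 𝓘(ℝ, EG) (𝓘(ℝ, EM).prod 𝓘(ℝ, EG)) ∞
      (fun h : G => (p.1, coordMap e p * h)) g :=
    contMDiffAt_const.prodMk (contMDiffAt_const.mul contMDiffAt_id)
  refine ((contMDiffAt_pretriv_symm EM EG e (q := (p.1, coordMap e p * g)) h0).comp g
    h1).congr_of_eventuallyEq (Filter.Eventually.of_forall fun h => ?_)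
  have hq' : (rightMul h p).1 ∈ e.baseSet := h0
  change rightMul h p = _
  rw [← pretriv_symm_coordMap e hq', coordMap_rightMul e h0]
  rfl

end
end
end FrameBundle
end FrameBundleFunctions

/-! ### Vertical vectors and the infinitesimal action -/

section FrameBundleFunctions

variable {F : Type*} [NormedAddCommGroup F] [NormedSpace ℝ F] [FiniteDimensional ℝ F]
  {G : Subgroup (F →L[ℝ] F)ˣ}
  {M : Type*} [TopologicalSpace M] {E : M → Type*} [TopologicalSpace (TotalSpace F E)]
  [∀ x, AddCommGroup (E x)] [∀ x, Module ℝ (E x)] [∀ x, TopologicalSpace (E x)]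
  [FiberBundle F E] [VectorBundle ℝ F E]
  {EM : Type*} [NormedAddCommGroup EM] [NormedSpace ℝ EM]
  {EG : Type*} [NormedAddCommGroup EG] [NormedSpace ℝ EG]
  [ChartedSpace EM M] [ChartedSpace EG G]
  [IsGVectorBundle G E] [ContMDiffVectorBundle ∞ F E 𝓘(ℝ, EM)]
  [LieGroup 𝓘(ℝ, EG) ∞ G] [IsEmbeddedLieSubgroup G (EG := EG)]

namespace FrameBundle

variable (EM EG) in
theorem hasMFDerivAt_orbit (p : FrameBundle G E) :
    HasMFDerivAt 𝓘(ℝ, EG) (𝓘(ℝ, EM).prod 𝓘(ℝ, EG)) (fun g : G => rightMul g p) 1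
      (mfderiv 𝓘(ℝ, EG) (𝓘(ℝ, EM).prod 𝓘(ℝ, EG)) (fun g : G => rightMul g p) 1) :=
  ((contMDiff_orbit EM EG p 1).mdifferentiableAt (by simp)).hasMFDerivAt

variable (EM EG) in
/-- The infinitesimal action as a linear map. -/
def infActionL (p : FrameBundle G E) :
    EG →ₗ[ℝ] TangentSpace (𝓘(ℝ, EM).prod 𝓘(ℝ, EG)) p :=
  (mfderiv 𝓘(ℝ, EG) (𝓘(ℝ, EM).prod 𝓘(ℝ, EG)) (fun g : G => rightMul g p) 1).toLinearMap

variable (EM EG) in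
theorem hasMFDerivAt_proj (p : FrameBundle G E) :
    HasMFDerivAt (𝓘(ℝ, EM).prod 𝓘(ℝ, EG)) 𝓘(ℝ, EM) (π G (AdmFrame G E)) p
      (mfderiv (𝓘(ℝ, EM).prod 𝓘(ℝ, EG)) 𝓘(ℝ, EM) (π G (AdmFrame G E)) p) :=
  ((contMDiff_proj' EM EG p).mdifferentiableAt (by simp)).hasMFDerivAt

/-- The derivative of a function along the infinitesimal action is determined by its values along
the orbit. -/
theorem mfderiv_infActionL {V : Type*} [NormedAddCommGroup V] [NormedSpace ℝ V]
    {f : FrameBundle G E → V} {p : FrameBundle G E}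
    (hf : MDifferentiableAt (𝓘(ℝ, EM).prod 𝓘(ℝ, EG)) 𝓘(ℝ, V) f p) {f' : EG →L[ℝ] V}
    (h : HasMFDerivAt 𝓘(ℝ, EG) 𝓘(ℝ, V) (fun g : G => f (rightMul g p)) 1 f') (X : EG) :
    mfderiv (𝓘(ℝ, EM).prod 𝓘(ℝ, EG)) 𝓘(ℝ, V) f p (infActionL EM EG p X) = f' X := by
  have h1 := HasMFDerivAt.comp (1 : G) (g := f) (f := fun g : G => rightMul g p)
    hf.hasMFDerivAt (hasMFDerivAt_orbit EM EG p)
  have h2 := hasMFDerivAt_unique h1 h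
  exact congrArg (fun L : EG →L[ℝ] V => L X) h2

theorem mfderiv_proj_infActionL (p : FrameBundle G E) (X : EG) :
    mfderiv (𝓘(ℝ, EM).prod 𝓘(ℝ, EG)) 𝓘(ℝ, EM) (π G (AdmFrame G E)) p
      (infActionL EM EG p X) = 0 := by
  have h1 := HasMFDerivAt.comp (1 : G) (g := π G (AdmFrame G E)) (f := fun g : G => rightMul g p)
    (hasMFDerivAt_proj EM EG p) (hasMFDerivAt_orbit EM EG p)
  have h2 := hasMFDerivAt_unique h1 (hasMFDerivAt_const p.1 (1 : G))
  exact congrArg (fun L : EG →L[ℝ] EM => L X) h2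

theorem mfderiv_coordMap_infActionL (e : Trivialization F (π F E)) [MemTrivializationAtlas e]
    {p : FrameBundle G E} (hp : p.1 ∈ e.baseSet) (X : EG) :
    mfderiv (𝓘(ℝ, EM).prod 𝓘(ℝ, EG)) 𝓘(ℝ, F →L[ℝ] F) (fun q => toEnd G (coordMap e q)) p
      (infActionL EM EG p X) = (toEnd G (coordMap e p)).comp (lieToEndL G EG X) := by
  have hd : ContMDiffAt (𝓘(ℝ, EM).prod 𝓘(ℝ, EG)) 𝓘(ℝ, F →L[ℝ] F) ∞
      (fun q : FrameBundle G E => toEnd G (coordMap e q)) p :=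
    (contMDiff_toEnd (EG := EG) _).comp p (contMDiffAt_coordMap EM EG e hp)
  have h1 := HasMFDerivAt.comp (1 : G) (f := toEnd G)
    (g := fun u : F →L[ℝ] F => (toEnd G (coordMap e p)).comp u)
    (ContinuousLinearMap.hasMFDerivAt
      (ContinuousLinearMap.compL ℝ F F F (toEnd G (coordMap e p))))
    (hasMFDerivAt_toEnd (G := G) (EG := EG))
  refine mfderiv_infActionL (f := fun q => toEnd G (coordMap e q))
    (hd.mdifferentiableAt (by simp)) (h1.congr_of_eventuallyEq
      (Filter.Eventually.of_forall fun g => ?_)) X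
  change toEnd G (coordMap e (rightMul g p)) = _
  rw [coordMap_rightMul e hp]
  rfl

/-- On the orbit of `p` the function is `g ↦ g⁻¹ (secFun t p)`, by definition; the sign is that of
the derivative of inversion at `1`. -/
theorem mfderiv_secFun_infActionL {t : ∀ x, E x} {p : FrameBundle G E}
    (ht : MDifferentiableAt (𝓘(ℝ, EM).prod 𝓘(ℝ, EG)) 𝓘(ℝ, F) (secFun t) p) (X : EG) :
    mfderiv (𝓘(ℝ, EM).prod 𝓘(ℝ, EG)) 𝓘(ℝ, F) (secFun t) p (infActionL EM EG p X) =
      -(lieToEndL G EG X (secFun t p)) := by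
  have h1 := HasMFDerivAt.comp (1 : G) (f := fun g : G => toEnd G g⁻¹)
    (g := fun u : F →L[ℝ] F => u (secFun t p))
    (ContinuousLinearMap.hasMFDerivAt (ContinuousLinearMap.apply ℝ F (secFun t p)))
    (hasMFDerivAt_toEnd_inv (G := G) (EG := EG))
  exact mfderiv_infActionL ht h1 X

theorem infActionL_injective (p : FrameBundle G E) : Function.Injective (infActionL EM EG p) := by
  rw [injective_iff_map_eq_zero]
  intro X hX
  have h0 : p.1 ∈ (trivializationAt F E p.1).baseSet := mem_baseSet_trivializationAt _ _ _
  have h : (toEnd G (coordMap (trivializationAt F E p.1) p)).comp (lieToEndL G EG X) = 0 :=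
    (mfderiv_coordMap_infActionL (EM := EM) (trivializationAt F E p.1) h0 X).symm.trans
      ((congrArg _ hX).trans (ContinuousLinearMap.map_zero _))
  apply lieToEndL_injective (G := G) (EG := EG)
  rw [map_zero]
  ext ξ
  have h' := congrArg (toEnd G (coordMap (trivializationAt F E p.1) p)⁻¹)
    (congrArg (fun L : F →L[ℝ] F => L ξ) h)
  rw [ContinuousLinearMap.comp_apply, toEnd_inv_apply_toEnd] at h'
  exact h'.trans (map_zero _)

theorem mfderiv_proj_section {s : ∀ y, AdmFrame G E y} {x : M}
    (hs : ContMDiffAt 𝓘(ℝ, EM) (𝓘(ℝ, EM).prod 𝓘(ℝ, EG)) ∞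
      (fun y => (⟨y, s y⟩ : FrameBundle G E)) x) (v : TangentSpace 𝓘(ℝ, EM) x) :
    mfderiv (𝓘(ℝ, EM).prod 𝓘(ℝ, EG)) 𝓘(ℝ, EM) (π G (AdmFrame G E)) ⟨x, s x⟩
      (mfderiv 𝓘(ℝ, EM) (𝓘(ℝ, EM).prod 𝓘(ℝ, EG))
        (fun y => (⟨y, s y⟩ : FrameBundle G E)) x v) = v := by
  have h1 := HasMFDerivAt.comp x (g := π G (AdmFrame G E))
    (f := fun y => (⟨y, s y⟩ : FrameBundle G E))
    (hasMFDerivAt_proj EM EG _) (hs.mdifferentiableAt (by simp)).hasMFDerivAt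
  have h2 := hasMFDerivAt_unique h1 (hasMFDerivAt_id x)
  exact congrArg (fun L : EM →L[ℝ] EM => L v) h2

theorem exists_localSec_eq (p : FrameBundle G E) :
    ∃ g : G, p = ⟨p.1, localSec G (trivializationAt F E p.1) g p.1⟩ :=
  ⟨_, (pretriv_symm_coordMap (trivializationAt F E p.1)
    (mem_baseSet_trivializationAt _ _ _)).symm⟩

theorem mfderiv_proj_surjective (p : FrameBundle G E) : Function.Surjective
    (mfderiv (𝓘(ℝ, EM).prod 𝓘(ℝ, EG)) 𝓘(ℝ, EM) (π G (AdmFrame G E)) p) := by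
  obtain ⟨g, hg⟩ := exists_localSec_eq p
  rw [hg]
  intro v
  exact ⟨_, mfderiv_proj_section (contMDiffAt_localSec EM EG _
    (mem_baseSet_trivializationAt _ _ _) g) v⟩

/-- Orbits lie in fibres, which gives one inclusion. Equality is a dimension count: `I_p` is
injective and `dπ` is onto, so both sides have the dimension of `𝔤`. -/
theorem range_infActionL [FiniteDimensional ℝ EM] [FiniteDimensional ℝ EG] (p : FrameBundle G E) :
    LinearMap.range (infActionL EM EG p) =
      (mfderiv (𝓘(ℝ, EM).prod 𝓘(ℝ, EG)) 𝓘(ℝ, EM) (π G (AdmFrame G E)) p).ker := by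
  have : FiniteDimensional ℝ (TangentSpace (𝓘(ℝ, EM).prod 𝓘(ℝ, EG)) p) :=
    inferInstanceAs (FiniteDimensional ℝ (EM × EG))
  refine Submodule.eq_of_le_of_finrank_eq ?_ ?_
  · rintro _ ⟨X, rfl⟩
    exact mfderiv_proj_infActionL p X
  · rw [LinearMap.finrank_range_of_inj (infActionL_injective p)]
    have h := LinearMap.finrank_range_add_finrank_ker
      (mfderiv (𝓘(ℝ, EM).prod 𝓘(ℝ, EG)) 𝓘(ℝ, EM) (π G (AdmFrame G E)) p).toLinearMap
    rw [LinearMap.range_eq_top.2 (mfderiv_proj_surjective p), finrank_top] at h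
    have h1 : Module.finrank ℝ (TangentSpace (𝓘(ℝ, EM).prod 𝓘(ℝ, EG)) p) =
      Module.finrank ℝ EM + Module.finrank ℝ EG := Module.finrank_prod (R := ℝ) (M := EM) (M' := EG)
    have h2 : Module.finrank ℝ (TangentSpace 𝓘(ℝ, EM) p.1) = Module.finrank ℝ EM := rfl
    have h3 : Module.finrank ℝ (TangentSpace 𝓘(ℝ, EM) ((π G (AdmFrame G E)) p)) =
      Module.finrank ℝ EM := rfl
    rw [h1, h3] at h
    exact (Nat.add_left_cancel h).symm

end FrameBundle
end FrameBundleFunctions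

/-! ### Smooth dependence of solutions of linear equations -/

section SmoothSolutions

variable {EN : Type*} [NormedAddCommGroup EN] [NormedSpace ℝ EN] {HN : Type*} [TopologicalSpace HN]
  {I : ModelWithCorners ℝ EN HN} {N : Type*} [TopologicalSpace N] [ChartedSpace HN N]

/-- The solution of a linear equation with smooth coefficients and injective left-hand side is
smooth. -/
theorem contMDiffAt_of_clm_apply_eventuallyEq {W V : Type*} [NormedAddCommGroup W]
    [NormedSpace ℝ W] [FiniteDimensional ℝ W] [NormedAddCommGroup V] [NormedSpace ℝ V]
    [FiniteDimensional ℝ V] {L : N → W →L[ℝ] V} {y : N → W} {b : N → V} {q₀ : N}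
    (hL : ContMDiffAt I 𝓘(ℝ, W →L[ℝ] V) ∞ L q₀) (hb : ContMDiffAt I 𝓘(ℝ, V) ∞ b q₀)
    (hinj : Function.Injective (L q₀)) (h : ∀ᶠ q in 𝓝 q₀, L q (y q) = b q) :
    ContMDiffAt I 𝓘(ℝ, W) ∞ y q₀ := by
  have : CompleteSpace W := FiniteDimensional.complete ℝ W
  -- A fixed left inverse `Λ` of `L q₀` makes the system square: `Λ ∘ L q` is the identity at `q₀`,
  -- hence invertible nearby, and `y = (Λ ∘ L)⁻¹ (Λ b)` is smooth.
  obtain ⟨Λ', hΛ'⟩ := (L q₀).toLinearMap.exists_leftInverse_of_injective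
    (LinearMap.ker_eq_bot.2 hinj)
  let Λ : V →L[ℝ] W := LinearMap.toContinuousLinearMap Λ'
  have hA0 : Λ.comp (L q₀) = ContinuousLinearMap.id ℝ W := by
    ext w
    exact congrArg (fun f : W →ₗ[ℝ] W => f w) hΛ'
  have hA : ContMDiffAt I 𝓘(ℝ, W →L[ℝ] W) ∞ (fun q => Λ.comp (L q)) q₀ :=
    contMDiffAt_const.clm_comp hL
  have h1 : ContDiffAt ℝ ∞ (Ring.inverse : (W →L[ℝ] W) → (W →L[ℝ] W)) (Λ.comp (L q₀)) := by
    rw [hA0]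
    exact contDiffAt_ringInverse ℝ (1 : (W →L[ℝ] W)ˣ)
  have h2 : ContMDiffAt I 𝓘(ℝ, W →L[ℝ] W) ∞ (fun q => Ring.inverse (Λ.comp (L q))) q₀ :=
    h1.contMDiffAt.comp q₀ hA
  have hu : ∀ᶠ q in 𝓝 q₀, IsUnit (Λ.comp (L q)) := by
    refine hA.continuousAt.eventually (p := fun u : W →L[ℝ] W => IsUnit u)
      (Units.isOpen.mem_nhds ?_)
    change IsUnit (Λ.comp (L q₀))
    rw [hA0]
    exact isUnit_one
  refine (h2.clm_apply (contMDiffAt_const (c := Λ) |>.clm_apply hb)).congr_of_eventuallyEq ?_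
  filter_upwards [h, hu] with q hq hq'
  rw [← hq]
  exact congrArg (fun u : W →L[ℝ] W => u (y q)) (Ring.inverse_mul_cancel _ hq').symm

variable [IsManifold I ∞ N]

/-- A vector field which is determined by the differential of a smooth map is smooth. -/
theorem contMDiffAt_vectorField_of_mfderiv [FiniteDimensional ℝ EN] {V : Type*}
    [NormedAddCommGroup V] [NormedSpace ℝ V] [FiniteDimensional ℝ V] {J b : N → V}
    {Y : ∀ q : N, TangentSpace I q} {q₀ : N} (hJ : ContMDiffAt I 𝓘(ℝ, V) ∞ J q₀)
    (hb : ContMDiffAt I 𝓘(ℝ, V) ∞ b q₀)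
    (hinj : Function.Injective (mfderiv I 𝓘(ℝ, V) J q₀))
    (h : ∀ᶠ q in 𝓝 q₀, mfderiv I 𝓘(ℝ, V) J q (Y q) = b q) :
    ContMDiffAt I I.tangent ∞ (fun q => (⟨q, Y q⟩ : TangentBundle I N)) q₀ := by
  have h0 : q₀ ∈ (trivializationAt EN (TangentSpace I) q₀).baseSet :=
    mem_baseSet_trivializationAt _ _ _
  -- In the trivialization of the tangent bundle at `q₀`, the condition on `Y` is a linear equation
  -- whose coefficients are `dJ` in coordinates, which is smooth in `q`.
  have hc : ∀ q ∈ (trivializationAt EN (TangentSpace I : N → Type _) q₀).baseSet, ∀ w : TangentSpace I q,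
      inTangentCoordinates I 𝓘(ℝ, V) id J (mfderiv I 𝓘(ℝ, V) J) q₀ q
        (trivializationAt EN (TangentSpace I) q₀ ⟨q, w⟩).2 = mfderiv I 𝓘(ℝ, V) J q w := by
    intro q hq w
    change (trivializationAt V (TangentSpace 𝓘(ℝ, V)) (J q₀)).continuousLinearMapAt ℝ (J q)
      (mfderiv I 𝓘(ℝ, V) J q ((trivializationAt EN (TangentSpace I) q₀).symmL ℝ q
        (trivializationAt EN (TangentSpace I) q₀ ⟨q, w⟩).2)) = _
    rw [TangentBundle.continuousLinearMapAt_model_space]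
    refine congrArg (mfderiv I 𝓘(ℝ, V) J q) ?_
    have := (trivializationAt EN (TangentSpace I : N → Type _) q₀).symmL_continuousLinearMapAt
      (R := ℝ) hq w
    rwa [Trivialization.continuousLinearMapAt_apply, Trivialization.linearMapAt_apply,
      if_pos hq] at this
  have hsec := (trivializationAt EN (TangentSpace I : N → Type _) q₀).contMDiffAt_section_iff
    (IB := I) (n := ∞) (s := Y) h0
  refine hsec.2 (contMDiffAt_of_clm_apply_eventuallyEq (hJ.mfderiv_const (m := ∞) (by simp)) hb ?_ ?_)
  · intro u w huw
    have hs : ∀ u : EN, (trivializationAt EN (TangentSpace I : N → Type _) q₀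
        ⟨q₀, (trivializationAt EN (TangentSpace I : N → Type _) q₀).symm q₀ u⟩).2 = u := fun u => by
      rw [Trivialization.apply_mk_symm _ h0]
    rw [← hs u, ← hs w] at huw ⊢
    rw [hc q₀ h0, hc q₀ h0] at huw
    rw [hinj huw]
  · filter_upwards [h, (trivializationAt EN (TangentSpace I : N → Type _) q₀).open_baseSet.mem_nhds h0]
      with q hq hq'
    rw [hc q hq', hq]

/-- A section of `Hom(TN, E)` is smooth if it has smooth values on a frame of smooth vector
fields. -/
theorem contMDiffAt_hom_of_apply [FiniteDimensional ℝ EN] {F : Type*} [NormedAddCommGroup F]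
    [NormedSpace ℝ F] [FiniteDimensional ℝ F]
    {E : N → Type*} [TopologicalSpace (TotalSpace F E)]
    [∀ x, AddCommGroup (E x)] [∀ x, Module ℝ (E x)] [∀ x, TopologicalSpace (E x)]
    [∀ x, IsTopologicalAddGroup (E x)] [∀ x, ContinuousSMul ℝ (E x)]
    [FiberBundle F E] [VectorBundle ℝ F E] [ContMDiffVectorBundle ∞ F E I]
    {T : ∀ x : N, TangentSpace I x →L[ℝ] E x} {ι : Type*} [Fintype ι]
    {v : ι → ∀ x : N, TangentSpace I x} {x₀ : N}
    (hv : ∀ i, ContMDiffAt I I.tangent ∞ (fun x => (⟨x, v i x⟩ : TangentBundle I N)) x₀)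
    (hspan : Submodule.span ℝ (range fun i => v i x₀) = ⊤)
    (hT : ∀ i, ContMDiffAt I (I.prod 𝓘(ℝ, F)) ∞ (fun x => TotalSpace.mk' F x (T x (v i x))) x₀) :
    ContMDiffAt I (I.prod 𝓘(ℝ, EN →L[ℝ] F)) ∞ (fun x => TotalSpace.mk' (EN →L[ℝ] F)
      (E := fun x : N => TangentSpace I x →L[ℝ] E x) x (T x)) x₀ := by
  classical
  set e := trivializationAt EN (TangentSpace I : N → Type _) x₀
  set e' := trivializationAt F E x₀
  have h0 : x₀ ∈ e.baseSet := mem_baseSet_trivializationAt _ _ _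
  have h0' : x₀ ∈ e'.baseSet := mem_baseSet_trivializationAt _ _ _
  have hv' : ∀ i, ContMDiffAt I 𝓘(ℝ, EN) ∞ (fun x => (e ⟨x, v i x⟩).2) x₀ := fun i =>
    (e.contMDiffAt_section_iff (IB := I) (n := ∞) (s := v i) h0).1 (hv i)
  have hT' : ∀ i, ContMDiffAt I 𝓘(ℝ, F) ∞ (fun x => (e' ⟨x, T x (v i x)⟩).2) x₀ := fun i =>
    (e'.contMDiffAt_section_iff h0').1 (hT i)
  rw [contMDiffAt_hom_bundle]
  refine ⟨contMDiffAt_id, ?_⟩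
  have hc : ∀ x ∈ e.baseSet, x ∈ e'.baseSet → ∀ w : TangentSpace I x,
      ContinuousLinearMap.inCoordinates EN (TangentSpace I) F E x₀ x x₀ x (T x) (e ⟨x, w⟩).2 =
        (e' ⟨x, T x w⟩).2 := by
    intro x hx hx' w
    rw [ContinuousLinearMap.inCoordinates_eq hx hx']
    have : ((e.continuousLinearEquivAt ℝ x hx).symm : EN →L[ℝ] TangentSpace I x) (e ⟨x, w⟩).2 = w :=
      (e.continuousLinearEquivAt ℝ x hx).symm_apply_apply w
    exact congrArg (fun z => (e' ⟨x, T x z⟩).2) this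
  -- The unknown of the linear system is the matrix of `T x`, the equations are its values on the
  -- fields `v i`. The system is injective at `x₀` because these fields span there.
  let L : N → (EN →L[ℝ] F) →L[ℝ] (ι → F) := fun x =>
    ∑ i, (ContinuousLinearMap.single ℝ (fun _ => F) i).comp
      (ContinuousLinearMap.apply ℝ F (e ⟨x, v i x⟩).2)
  have hLapp : ∀ x A i, L x A i = A (e ⟨x, v i x⟩).2 := by
    intro x A i
    simp [L, Pi.single_apply]
  refine contMDiffAt_of_clm_apply_eventuallyEq (L := L)
    (b := fun x i => (e' ⟨x, T x (v i x)⟩).2) ?_ ?_ ?_ ?_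
  · refine ContMDiffAt.sum fun i _ => contMDiffAt_const.clm_comp ?_
    have happ : ContDiff ℝ ∞ (ContinuousLinearMap.apply ℝ F : EN → (EN →L[ℝ] F) →L[ℝ] F) :=
      ContinuousLinearMap.contDiff _
    exact happ.contMDiff.contMDiffAt.comp x₀ (hv' i)
  · exact contMDiffAt_pi_space.2 hT'
  · intro A B hAB
    have hAB' : ∀ i, A (e ⟨x₀, v i x₀⟩).2 = B (e ⟨x₀, v i x₀⟩).2 := fun i => by
      rw [← hLapp, ← hLapp, hAB]
    have : A.comp (e.continuousLinearEquivAt ℝ x₀ h0 : TangentSpace I x₀ →L[ℝ] EN) =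
        B.comp (e.continuousLinearEquivAt ℝ x₀ h0 : TangentSpace I x₀ →L[ℝ] EN) := by
      refine ContinuousLinearMap.coe_injective (LinearMap.ext_on hspan ?_)
      rintro _ ⟨i, rfl⟩
      exact hAB' i
    ext u
    have hu := congrArg (fun f : TangentSpace I x₀ →L[ℝ] F =>
      f ((e.continuousLinearEquivAt ℝ x₀ h0).symm u)) this
    have hu' : (e ⟨x₀, e.symm x₀ u⟩).2 = u := by rw [e.apply_mk_symm h0]
    change A (e ⟨x₀, e.symm x₀ u⟩).2 = B (e ⟨x₀, e.symm x₀ u⟩).2 at hu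
    rwa [hu'] at hu
  · filter_upwards [e.open_baseSet.mem_nhds h0, e'.open_baseSet.mem_nhds h0'] with x hx hx'
    ext i
    rw [hLapp]
    exact hc x hx hx' (v i x)

end SmoothSolutions

/-! ### Locality and local expression of a linear connection -/

section LinearConnectionCalculus

variable {F : Type*} [NormedAddCommGroup F] [NormedSpace ℝ F] [FiniteDimensional ℝ F]
  {M : Type*} [TopologicalSpace M] {E : M → Type*} [TopologicalSpace (TotalSpace F E)]
  [∀ x, AddCommGroup (E x)] [∀ x, Module ℝ (E x)] [∀ x, TopologicalSpace (E x)]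
  [∀ x, IsTopologicalAddGroup (E x)] [∀ x, ContinuousSMul ℝ (E x)]
  [FiberBundle F E] [VectorBundle ℝ F E]
  {EM : Type*} [NormedAddCommGroup EM] [NormedSpace ℝ EM] [FiniteDimensional ℝ EM]
  [ChartedSpace EM M] [IsManifold 𝓘(ℝ, EM) ∞ M] [T2Space M]
  [ContMDiffVectorBundle ∞ F E 𝓘(ℝ, EM)]

theorem SmoothSec.sum_apply {ι : Type*} (S : Finset ι) (s : ι → SmoothSec F E EM) (x : M) :
    (∑ j ∈ S, s j) x = ∑ j ∈ S, s j x := by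
  rw [← ContMDiffSection.coeAddHom_apply, map_sum, Finset.sum_apply]
  rfl

theorem OneForms.sum_apply {ι : Type*} (S : Finset ι) (s : ι → OneForms F E EM) (x : M)
    (v : TangentSpace 𝓘(ℝ, EM) x) : (∑ j ∈ S, s j) x v = ∑ j ∈ S, s j x v := by
  rw [← ContMDiffSection.coeAddHom_apply, map_sum, Finset.sum_apply, _root_.sum_apply]
  rfl

variable (EM) in
theorem exists_bump {x : M} {U : Set M} (hU : U ∈ 𝓝 x) :
    ∃ ψ : C^∞⟮𝓘(ℝ, EM), M; ℝ⟯, (∀ᶠ y in 𝓝 x, ψ y = 1) ∧ tsupport ψ ⊆ U := by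
  obtain ⟨f, -, hf⟩ := (SmoothBumpFunction.nhds_basis_tsupport (I := 𝓘(ℝ, EM)) x).mem_iff.1 hU
  exact ⟨⟨f, f.contMDiff⟩, f.eventuallyEq_one, hf⟩

section

variable (e : Trivialization F (π F E)) [MemTrivializationAtlas e]
  (ψ : C^∞⟮𝓘(ℝ, EM), M; ℝ⟯) (hψ : tsupport ψ ⊆ e.baseSet)

/-- The global sections of `E` which are constant in the trivialization `e`, up to the cutoff
function `ψ`. -/
def extSec : F →ₗ[ℝ] SmoothSec F E EM where
  toFun ξ := ⟨fun y => ψ y • e.symmL ℝ y ξ, by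
    refine ContMDiffOn.smul_section_of_tsupport (s := fun y => e.symmL ℝ y ξ) (ψ := ψ)
      ψ.contMDiff.contMDiffOn e.open_baseSet hψ ?_
    rw [e.contMDiffOn_section_baseSet_iff]
    refine (contMDiffOn_const (c := ξ)).congr fun y hy => ?_
    rw [e.symmL_apply hy, e.apply_mk_symm hy]⟩
  map_add' ξ η := by
    refine ContMDiffSection.ext fun y => ?_
    change ψ y • e.symmL ℝ y (ξ + η) = ψ y • e.symmL ℝ y ξ + ψ y • e.symmL ℝ y η
    rw [← smul_add]
    rw [map_add]
  map_smul' c ξ := by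
    refine ContMDiffSection.ext fun y => ?_
    change ψ y • e.symmL ℝ y (c • ξ) = c • ψ y • e.symmL ℝ y ξ
    rw [smul_comm]
    rw [map_smul]

theorem extSec_apply (ξ : F) (y : M) : extSec e ψ hψ ξ y = ψ y • e.symmL ℝ y ξ := rfl

theorem extSec_eventuallyEq {x : M} (h1 : ∀ᶠ y in 𝓝 x, ψ y = 1) (ξ : F) :
    ∀ᶠ y in 𝓝 x, extSec e ψ hψ ξ y = e.symmL ℝ y ξ := by
  filter_upwards [h1] with y hy
  rw [extSec_apply, hy, one_smul]

end

namespace LinearConnection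

variable (D : LinearConnection F E EM)

/-- With a cutoff `ψ` supported where `t` vanishes and equal to `1` near `x`, one has `ψ t = 0`, and
the Leibniz rule at `x` reads `0 = ∇t + dψ ⊗ t` with `t x = 0`. -/
theorem toLin_eq_zero_of_eventuallyEq {t : SmoothSec F E EM} {x : M}
    (h : ∀ᶠ y in 𝓝 x, t y = 0) : D.toLin t x = 0 := by
  obtain ⟨ψ, h1, hs⟩ := exists_bump EM h
  have h0 : SmoothSec.fsmul ψ t = 0 := by
    refine ContMDiffSection.ext fun y => ?_
    change ψ y • t y = 0
    by_cases hy : y ∈ tsupport ψ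
    · rw [show t y = 0 from hs hy, smul_zero]
    · rw [image_eq_zero_of_notMem_tsupport hy, zero_smul]
  refine ContinuousLinearMap.ext fun v => ?_
  have h2 := D.leibniz ψ t x v
  rw [h0, map_zero, h1.self_of_nhds, h.self_of_nhds, one_smul, smul_zero, add_zero] at h2
  exact h2.symm

theorem toLin_congr {t t' : SmoothSec F E EM} {x : M} (h : ∀ᶠ y in 𝓝 x, t y = t' y) :
    D.toLin t x = D.toLin t' x := by
  have h0 : D.toLin (t - t') x = 0 := D.toLin_eq_zero_of_eventuallyEq <| by
    filter_upwards [h] with y hy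
    rw [ContMDiffSection.coe_sub, Pi.sub_apply, hy, sub_self]
  rw [map_sub, ContMDiffSection.coe_sub, Pi.sub_apply, sub_eq_zero] at h0
  exact h0

/-- The local expression `d + A` of a connection in a trivialization. -/
theorem toLin_localExpr (e : Trivialization F (π F E)) [MemTrivializationAtlas e]
    {ψ : C^∞⟮𝓘(ℝ, EM), M; ℝ⟯} (hψ : tsupport ψ ⊆ e.baseSet) {x : M}
    (h1 : ∀ᶠ y in 𝓝 x, ψ y = 1) (hx : x ∈ e.baseSet) (t : SmoothSec F E EM)
    (v : TangentSpace 𝓘(ℝ, EM) x) :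
    (e ⟨x, D.toLin t x v⟩).2 =
      (show F from mfderiv 𝓘(ℝ, EM) 𝓘(ℝ, F) (fun y => (e ⟨y, t y⟩).2) x v) +
        (e ⟨x, D.toLin (extSec e ψ hψ (e ⟨x, t x⟩).2) x v⟩).2 := by
  let b := Module.finBasis ℝ F
  let β : Fin (Module.finrank ℝ F) → F →L[ℝ] ℝ := fun j => LinearMap.toContinuousLinearMap (b.coord j)
  have hb : ∀ u : F, ∑ j, β j u • b j = u := b.sum_repr
  have hτ : ∀ y ∈ e.baseSet, ContMDiffAt 𝓘(ℝ, EM) 𝓘(ℝ, F) ∞ (fun y => (e ⟨y, t y⟩).2) y :=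
    fun y hy => (e.contMDiffAt_section_iff hy).1 (t.contMDiff y)
  have hβτ : ∀ j, ∀ y ∈ e.baseSet,
      ContMDiffAt 𝓘(ℝ, EM) 𝓘(ℝ, ℝ) ∞ (fun y => β j (e ⟨y, t y⟩).2) y := fun j y hy =>
    (ContinuousLinearMap.contMDiff (β j)).contMDiffAt.comp y (hτ y hy)
  -- The Leibniz rule is available only for global functions and sections, so the coordinates of `t`
  -- are cut off by `ψ`, like the constant sections. Near `x` nothing changes, and `t = ∑ c j •
  -- extSec (b j)` there.
  let c : Fin (Module.finrank ℝ F) → C^∞⟮𝓘(ℝ, EM), M; ℝ⟯ := fun j =>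
    ⟨fun y => ψ y * β j (e ⟨y, t y⟩).2, contMDiff_of_tsupport fun y hy =>
      ψ.contMDiff.contMDiffAt.mul (hβτ j y (hψ (tsupport_mul_subset_left hy)))⟩
  have hc : ∀ j, ∀ᶠ y in 𝓝 x, c j y = β j (e ⟨y, t y⟩).2 := fun j => by
    filter_upwards [h1] with y hy
    change ψ y * _ = _
    rw [hy, one_mul]
  have ht : D.toLin t x = D.toLin (∑ j, SmoothSec.fsmul (c j) (extSec e ψ hψ (b j))) x := by
    refine D.toLin_congr ?_
    filter_upwards [Filter.eventually_all.2 hc, h1, e.open_baseSet.mem_nhds hx] with y hy hy1 hye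
    have : (∑ j, SmoothSec.fsmul (c j) (extSec e ψ hψ (b j))) y =
        ∑ j, c j y • ψ y • e.symmL ℝ y (b j) := by
      rw [SmoothSec.sum_apply]; rfl
    rw [this]
    simp_rw [hy, hy1, one_smul]
    simp_rw [← map_smul]
    rw [← map_sum, hb, e.symmL_apply hye]
    exact (e.symm_apply_apply_mk hye (t y)).symm
  let dc : Fin (Module.finrank ℝ F) → ℝ := fun j => mfderiv 𝓘(ℝ, EM) 𝓘(ℝ, ℝ) (c j) x v
  let τ' : F := mfderiv 𝓘(ℝ, EM) 𝓘(ℝ, F) (fun y => (e ⟨y, t y⟩).2) x v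
  have hdc : ∀ j, dc j = β j τ' := fun j => by
    have h4 := HasMFDerivAt.comp x (g := β j) (f := fun y => (e ⟨y, t y⟩).2)
      (ContinuousLinearMap.hasMFDerivAt (β j))
      ((hτ x hx).mdifferentiableAt (by simp)).hasMFDerivAt
    have h5 := (h4.congr_of_eventuallyEq (hc j)).mfderiv
    exact congrArg (fun L : EM →L[ℝ] ℝ => L v) h5
  let ε : E x →L[ℝ] F := (e.continuousLinearEquivAt ℝ x hx : E x →L[ℝ] F)
  have hε : ∀ u : E x, (e ⟨x, u⟩).2 = ε u := fun _ => rfl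
  have hsum : D.toLin t x v = ∑ j, (c j x • D.toLin (extSec e ψ hψ (b j)) x v +
      dc j • extSec e ψ hψ (b j) x) := by
    rw [ht, map_sum, OneForms.sum_apply]
    exact Finset.sum_congr rfl fun j _ => D.leibniz _ _ _ _
  have hεb : ∀ j, ε (extSec e ψ hψ (b j) x) = b j := fun j => by
    rw [extSec_apply, h1.self_of_nhds, one_smul, e.symmL_apply hx]
    exact congrArg Prod.snd (e.apply_mk_symm hx (b j))
  have hA : ∑ j, c j x • ε (D.toLin (extSec e ψ hψ (b j)) x v) =
      ε (D.toLin (extSec e ψ hψ (e ⟨x, t x⟩).2) x v) := by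
    conv_rhs => rw [← hb (e ⟨x, t x⟩).2, map_sum, map_sum, OneForms.sum_apply,
      map_sum]
    refine Finset.sum_congr rfl fun j _ => ?_
    rw [(hc j).self_of_nhds, map_smul, map_smul]
    exact (map_smul ε _ _).symm
  change ε _ = τ' + ε _
  rw [hsum, map_sum, ← hA]
  simp_rw [map_add, map_smul, hεb, hdc]
  rw [Finset.sum_add_distrib, hb, add_comm]

end LinearConnection

end LinearConnectionCalculus

/-! ### Differentials on the frame bundle and the horizontal spaces of a linear connection -/

section HorizontalSpaces

variable {F : Type*} [NormedAddCommGroup F] [NormedSpace ℝ F] [FiniteDimensional ℝ F]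
  {G : Subgroup (F →L[ℝ] F)ˣ}
  {M : Type*} [TopologicalSpace M] {E : M → Type*} [TopologicalSpace (TotalSpace F E)]
  [∀ x, AddCommGroup (E x)] [∀ x, Module ℝ (E x)] [∀ x, TopologicalSpace (E x)]
  [∀ x, IsTopologicalAddGroup (E x)] [∀ x, ContinuousSMul ℝ (E x)]
  [FiberBundle F E] [VectorBundle ℝ F E]
  {EM : Type*} [NormedAddCommGroup EM] [NormedSpace ℝ EM] [FiniteDimensional ℝ EM]
  [ChartedSpace EM M] [IsManifold 𝓘(ℝ, EM) ∞ M] [T2Space M]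
  [ContMDiffVectorBundle ∞ F E 𝓘(ℝ, EM)]
  {EG : Type*} [NormedAddCommGroup EG] [NormedSpace ℝ EG] [FiniteDimensional ℝ EG]
  [ChartedSpace EG G] [LieGroup 𝓘(ℝ, EG) ∞ G] [IsEmbeddedLieSubgroup G (EG := EG)]
  [IsGVectorBundle G E]

open FrameBundle

namespace FrameBundle

/-- The differential of the function `secFun t` on the frame bundle. -/
def dSecFun (t : SmoothSec F E EM) (p : FrameBundle G E) :
    TangentSpace (𝓘(ℝ, EM).prod 𝓘(ℝ, EG)) p →L[ℝ] F :=
  mfderiv (𝓘(ℝ, EM).prod 𝓘(ℝ, EG)) 𝓘(ℝ, F) (secFun t) p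

variable (EM EG) in
/-- The differential of the projection of the frame bundle. -/
def dProj (p : FrameBundle G E) :
    TangentSpace (𝓘(ℝ, EM).prod 𝓘(ℝ, EG)) p →L[ℝ] TangentSpace 𝓘(ℝ, EM) p.1 :=
  mfderiv (𝓘(ℝ, EM).prod 𝓘(ℝ, EG)) 𝓘(ℝ, EM) (π G (AdmFrame G E)) p

variable (EM EG) in
/-- The differential of the right action of `g` on the frame bundle. -/
def dRightMul (g : G) (p : FrameBundle G E) :
    TangentSpace (𝓘(ℝ, EM).prod 𝓘(ℝ, EG)) p →L[ℝ]
      TangentSpace (𝓘(ℝ, EM).prod 𝓘(ℝ, EG)) (rightMul g p) :=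
  mfderiv (𝓘(ℝ, EM).prod 𝓘(ℝ, EG)) (𝓘(ℝ, EM).prod 𝓘(ℝ, EG)) (rightMul g) p

variable (EM EG) in
/-- The differential of a section of the frame bundle. -/
def dSection (s : ∀ y, AdmFrame G E y) (x : M) :
    TangentSpace 𝓘(ℝ, EM) x →L[ℝ]
      TangentSpace (𝓘(ℝ, EM).prod 𝓘(ℝ, EG)) (⟨x, s x⟩ : FrameBundle G E) :=
  mfderiv 𝓘(ℝ, EM) (𝓘(ℝ, EM).prod 𝓘(ℝ, EG)) (fun y => (⟨y, s y⟩ : FrameBundle G E)) x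

theorem hasMFDerivAt_secFun (t : SmoothSec F E EM) (p : FrameBundle G E) :
    HasMFDerivAt (𝓘(ℝ, EM).prod 𝓘(ℝ, EG)) 𝓘(ℝ, F) (secFun t) p (dSecFun t p) :=
  ((contMDiffAt_secFun EM EG (t.contMDiff p.1)).mdifferentiableAt (by simp)).hasMFDerivAt

variable (EM EG) in
theorem hasMFDerivAt_rightMul (g : G) (p : FrameBundle G E) :
    HasMFDerivAt (𝓘(ℝ, EM).prod 𝓘(ℝ, EG)) (𝓘(ℝ, EM).prod 𝓘(ℝ, EG)) (rightMul g) p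
      (dRightMul EM EG g p) :=
  ((contMDiff_rightMul EM EG g p).mdifferentiableAt (by simp)).hasMFDerivAt

theorem dSecFun_infActionL (t : SmoothSec F E EM) (p : FrameBundle G E) (X : EG) :
    dSecFun t p (infActionL EM EG p X) = -(lieToEndL G EG X (secFun t p)) :=
  mfderiv_secFun_infActionL (hasMFDerivAt_secFun t p).mdifferentiableAt X

theorem dProj_infActionL (p : FrameBundle G E) (X : EG) :
    dProj EM EG p (infActionL EM EG p X) = 0 :=
  mfderiv_proj_infActionL p X

theorem dSecFun_dRightMul (t : SmoothSec F E EM) (g : G) (p : FrameBundle G E)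
    (w : TangentSpace (𝓘(ℝ, EM).prod 𝓘(ℝ, EG)) p) :
    dSecFun t (rightMul g p) (dRightMul EM EG g p w) = toEnd G g⁻¹ (dSecFun t p w) := by
  have h1 := HasMFDerivAt.comp p (g := secFun t) (f := rightMul g)
    (hasMFDerivAt_secFun (EG := EG) t _) (hasMFDerivAt_rightMul EM EG g p)
  have h2 := HasMFDerivAt.comp p (g := toEnd G g⁻¹) (f := secFun t)
    (ContinuousLinearMap.hasMFDerivAt (toEnd G g⁻¹)) (hasMFDerivAt_secFun (EG := EG) t p)
  exact congrArg (fun L : EM × EG →L[ℝ] F => L w) (hasMFDerivAt_unique h1 h2)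

theorem dProj_dRightMul (g : G) (p : FrameBundle G E)
    (w : TangentSpace (𝓘(ℝ, EM).prod 𝓘(ℝ, EG)) p) :
    dProj EM EG (rightMul g p) (dRightMul EM EG g p w) = dProj EM EG p w := by
  have h1 := HasMFDerivAt.comp p (g := π G (AdmFrame G E)) (f := rightMul g)
    (hasMFDerivAt_proj EM EG _) (hasMFDerivAt_rightMul EM EG g p)
  exact congrArg (fun L : EM × EG →L[ℝ] EM => L w)
    (hasMFDerivAt_unique h1 (hasMFDerivAt_proj EM EG p))

/-- The chain rule for `R_g ∘ R_{g⁻¹} = id`. The frames `(p · g) · g⁻¹` and `p` are only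
propositionally equal, hence the passage through the common model `EM × EG` of the tangent spaces.
-/
theorem dRightMul_dRightMul_inv (g : G) (p : FrameBundle G E)
    (w : TangentSpace (𝓘(ℝ, EM).prod 𝓘(ℝ, EG)) (rightMul g p)) :
    dRightMul EM EG g p (dRightMul EM EG g⁻¹ (rightMul g p) w : EM × EG) = w := by
  have hinv : ∀ q : FrameBundle G E, rightMul g (rightMul g⁻¹ q) = q := fun q => by
    rw [rightMul_rightMul, inv_mul_cancel]; rfl
  have hp : rightMul g⁻¹ (rightMul g p) = p := by
    rw [rightMul_rightMul, mul_inv_cancel]; rfl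
  have h0 := hasMFDerivAt_rightMul EM EG g (rightMul g⁻¹ (rightMul g p))
  have h1 := HasMFDerivAt.comp (rightMul g p) (g := rightMul g) (f := rightMul g⁻¹)
    h0 (hasMFDerivAt_rightMul EM EG g⁻¹ _)
  have h2 : HasMFDerivAt (𝓘(ℝ, EM).prod 𝓘(ℝ, EG)) (𝓘(ℝ, EM).prod 𝓘(ℝ, EG))
      ((rightMul g : FrameBundle G E → FrameBundle G E) ∘ rightMul g⁻¹) (rightMul g p)
      (ContinuousLinearMap.id ℝ _) :=
    (hasMFDerivAt_id (rightMul g p)).congr_of_eventuallyEq (Filter.Eventually.of_forall hinv)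
  have h3 := congrArg (fun L : EM × EG →L[ℝ] EM × EG => L w) (hasMFDerivAt_unique h1 h2)
  have h4 : ∀ q : FrameBundle G E, q = p → ∀ u : EM × EG,
      (dRightMul EM EG g q u : EM × EG) = dRightMul EM EG g p u := by
    rintro q rfl u; rfl
  exact (h4 _ hp _).symm.trans h3

/-- Every vector is the value at `p` of the function given by a global section. -/
theorem exists_secFun_eq (p : FrameBundle G E) (ξ : F) :
    ∃ t : SmoothSec F E EM, secFun t p = ξ := by
  set e := trivializationAt F E p.1
  have h0 : p.1 ∈ e.baseSet := mem_baseSet_trivializationAt _ _ _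
  obtain ⟨ψ, h1, hψ⟩ := exists_bump EM (e.open_baseSet.mem_nhds h0)
  refine ⟨extSec e ψ hψ (e ⟨p.1, p.2.1 ξ⟩).2, ?_⟩
  rw [secFun, (extSec_eventuallyEq e ψ hψ h1 _).self_of_nhds, e.symmL_apply h0,
    e.symm_apply_apply_mk h0]
  exact p.2.1.symm_apply_apply ξ

theorem exists_infActionL_eq {p : FrameBundle G E} {w : TangentSpace (𝓘(ℝ, EM).prod 𝓘(ℝ, EG)) p}
    (hw : dProj EM EG p w = 0) : ∃ X : EG, infActionL EM EG p X = w := by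
  have : w ∈ LinearMap.range (infActionL EM EG p) := by
    rw [range_infActionL]; exact hw
  exact this

/-- A vertical vector is some `I_p X`, and `d(secFun t)` sends it to `-X (secFun t p)`, where
`secFun t p` is an arbitrary vector of `F`; so `X = 0`. This gives uniqueness of horizontal lifts
for every linear connection, admissible or not. -/
theorem eq_zero_of_dSecFun {p : FrameBundle G E} {w : TangentSpace (𝓘(ℝ, EM).prod 𝓘(ℝ, EG)) p}
    (hw : dProj EM EG p w = 0) (h : ∀ t : SmoothSec F E EM, dSecFun t p w = 0) : w = 0 := by
  obtain ⟨X, rfl⟩ := exists_infActionL_eq hw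
  have hX : X = 0 := by
    apply lieToEndL_injective (G := G) (EG := EG)
    rw [map_zero]
    ext ξ
    obtain ⟨t, ht⟩ := exists_secFun_eq (EM := EM) p ξ
    have h1 := h t
    rw [dSecFun_infActionL, ht, neg_eq_zero] at h1
    exact h1
  rw [hX, map_zero]

theorem dProj_dSection {s : ∀ y, AdmFrame G E y} {x : M}
    (hs : ContMDiffAt 𝓘(ℝ, EM) (𝓘(ℝ, EM).prod 𝓘(ℝ, EG)) ∞
      (fun y => (⟨y, s y⟩ : FrameBundle G E)) x) (v : TangentSpace 𝓘(ℝ, EM) x) :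
    dProj EM EG ⟨x, s x⟩ (dSection EM EG s x v) = v :=
  mfderiv_proj_section hs v

theorem dSecFun_dSection {s : ∀ y, AdmFrame G E y} {x : M}
    (hs : ContMDiffAt 𝓘(ℝ, EM) (𝓘(ℝ, EM).prod 𝓘(ℝ, EG)) ∞
      (fun y => (⟨y, s y⟩ : FrameBundle G E)) x) (t : SmoothSec F E EM)
    {f : M → F} (hf : ∀ᶠ y in 𝓝 x, secFun t (⟨y, s y⟩ : FrameBundle G E) = f y) {f' : EM →L[ℝ] F}
    (hf' : HasMFDerivAt 𝓘(ℝ, EM) 𝓘(ℝ, F) f x f') (v : TangentSpace 𝓘(ℝ, EM) x) :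
    dSecFun t ⟨x, s x⟩ (dSection EM EG s x v) = f' v := by
  have h1 := HasMFDerivAt.comp x (g := secFun t) (f := fun y => (⟨y, s y⟩ : FrameBundle G E))
    (hasMFDerivAt_secFun (EG := EG) t _) (hs.mdifferentiableAt (by simp)).hasMFDerivAt
  exact congrArg (fun L : EM →L[ℝ] F => L v)
    (hasMFDerivAt_unique h1 (hf'.congr_of_eventuallyEq hf))

end FrameBundle

namespace LinearConnection

variable (D : LinearConnection F E EM)

variable (G EG) in
/-- The horizontal space at the frame `p` of a connection `D` on `E`: the directions in which the
coordinates in the frame of any section `t` change according to the covariant derivative of `t`. -/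
def horizontal (p : FrameBundle G E) : Submodule ℝ (TangentSpace (𝓘(ℝ, EM).prod 𝓘(ℝ, EG)) p) where
  carrier := {w | ∀ t : SmoothSec F E EM,
    dSecFun t p w = p.2.1.symm (D.toLin t p.1 (dProj EM EG p w))}
  zero_mem' t := by simp
  add_mem' hw hw' t := by rw [map_add, map_add, map_add, map_add, hw t, hw' t]
  smul_mem' c w hw t := by rw [map_smul, map_smul, map_smul, map_smul, hw t]

theorem eq_zero_of_mem_horizontal {p : FrameBundle G E}
    {w : TangentSpace (𝓘(ℝ, EM).prod 𝓘(ℝ, EG)) p} (hw : w ∈ D.horizontal G EG p)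
    (h0 : dProj EM EG p w = 0) : w = 0 :=
  eq_zero_of_dSecFun h0 fun t => by
    rw [hw t, h0, map_zero, map_zero]

theorem dRightMul_mem_horizontal {p : FrameBundle G E}
    {w : TangentSpace (𝓘(ℝ, EM).prod 𝓘(ℝ, EG)) p} (hw : w ∈ D.horizontal G EG p) (g : G) :
    dRightMul EM EG g p w ∈ D.horizontal G EG (rightMul g p) := fun t => by
  rw [dSecFun_dRightMul, dProj_dRightMul, hw t]
  rfl

theorem map_dRightMul_horizontal (g : G) (p : FrameBundle G E) :
    (D.horizontal G EG p).map (dRightMul EM EG g p).toLinearMap =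
      D.horizontal G EG (rightMul g p) := by
  apply le_antisymm
  · rintro _ ⟨w, hw, rfl⟩
    exact D.dRightMul_mem_horizontal hw g
  · intro w hw
    have hp : rightMul g⁻¹ (rightMul g p) = p := by
      rw [rightMul_rightMul, mul_inv_cancel]; rfl
    have h4 : ∀ q : FrameBundle G E, q = p → ∀ u : EM × EG,
        u ∈ D.horizontal G EG q → u ∈ D.horizontal G EG p := by
      rintro q rfl u hu; exact hu
    exact ⟨_, h4 _ hp _ (D.dRightMul_mem_horizontal hw g⁻¹), dRightMul_dRightMul_inv g p w⟩

end LinearConnection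

end HorizontalSpaces

/-! ### The correspondence in terms of horizontal spaces -/

section HorizontalSpaces

variable {F : Type*} [NormedAddCommGroup F] [NormedSpace ℝ F] [FiniteDimensional ℝ F]
  {G : Subgroup (F →L[ℝ] F)ˣ}
  {M : Type*} [TopologicalSpace M] {E : M → Type*} [TopologicalSpace (TotalSpace F E)]
  [∀ x, AddCommGroup (E x)] [∀ x, Module ℝ (E x)] [∀ x, TopologicalSpace (E x)]
  [∀ x, IsTopologicalAddGroup (E x)] [∀ x, ContinuousSMul ℝ (E x)]
  [FiberBundle F E] [VectorBundle ℝ F E]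
  {EM : Type*} [NormedAddCommGroup EM] [NormedSpace ℝ EM] [FiniteDimensional ℝ EM]
  [ChartedSpace EM M] [IsManifold 𝓘(ℝ, EM) ∞ M] [T2Space M]
  [ContMDiffVectorBundle ∞ F E 𝓘(ℝ, EM)]
  {EG : Type*} [NormedAddCommGroup EG] [NormedSpace ℝ EG] [FiniteDimensional ℝ EG]
  [ChartedSpace EG G] [LieGroup 𝓘(ℝ, EG) ∞ G] [IsEmbeddedLieSubgroup G (EG := EG)]
  [IsGVectorBundle G E]

open FrameBundle

/-- A value of the connection form of a principal connection exists, for each tangent vector. -/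
theorem PrincipalConnection.exists_sub_mem (C : PrincipalConnection G E EM EG)
    (p : FrameBundle G E) (w : TangentSpace (𝓘(ℝ, EM).prod 𝓘(ℝ, EG)) p) :
    ∃ X : EG, w - infActionL EM EG p X ∈ C.H p := by
  have h := (C.isCompl p).codisjoint
  rw [codisjoint_iff] at h
  have hw : w ∈ C.H p ⊔
    (mfderiv (𝓘(ℝ, EM).prod 𝓘(ℝ, EG)) 𝓘(ℝ, EM) (π G (AdmFrame G E)) p).ker := h ▸ Submodule.mem_top
  obtain ⟨a, ha, b, hb, rfl⟩ := Submodule.mem_sup.1 hw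
  obtain ⟨X, hX⟩ := exists_infActionL_eq (w := b) hb
  exact ⟨X, by rwa [hX, add_sub_cancel_right]⟩

theorem PrincipalConnection.eq_zero_of_mem (C : PrincipalConnection G E EM EG)
    {p : FrameBundle G E} {w : TangentSpace (𝓘(ℝ, EM).prod 𝓘(ℝ, EG)) p} (hw : w ∈ C.H p)
    (h0 : dProj EM EG p w = 0) : w = 0 :=
  (Submodule.disjoint_def.1 (C.isCompl p).disjoint) w hw h0

theorem contMDiffAt_frame_apply {s : ∀ y, AdmFrame G E y} {x : M}
    (hs : ContMDiffAt 𝓘(ℝ, EM) (𝓘(ℝ, EM).prod 𝓘(ℝ, EG)) ∞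
      (fun y => (⟨y, s y⟩ : FrameBundle G E)) x) {f : M → F}
    (hf : ContMDiffAt 𝓘(ℝ, EM) 𝓘(ℝ, F) ∞ f x) :
    ContMDiffAt 𝓘(ℝ, EM) (𝓘(ℝ, EM).prod 𝓘(ℝ, F)) ∞
      (fun y => TotalSpace.mk' F y ((s y).1 (f y))) x := by
  set e := trivializationAt F E x
  have h0 : x ∈ e.baseSet := mem_baseSet_trivializationAt _ _ _
  rw [e.contMDiffAt_section_iff h0]
  have h1 : ContMDiffAt 𝓘(ℝ, EM) 𝓘(ℝ, F →L[ℝ] F) ∞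
      (fun y => toEnd G (coordMap e (⟨y, s y⟩ : FrameBundle G E))) x :=
    (contMDiff_toEnd (EG := EG) _).comp x
      (ContMDiffAt.comp (g := coordMap e) (f := fun y => (⟨y, s y⟩ : FrameBundle G E)) x
        (contMDiffAt_coordMap EM EG e (p := ⟨x, s x⟩) h0) hs)
  refine (h1.clm_apply hf).congr_of_eventuallyEq ?_
  filter_upwards [e.open_baseSet.mem_nhds h0] with y hy
  exact (toEnd_coordMap e (p := ⟨y, s y⟩) hy (f y)).symm

variable (EM) in
theorem exists_section_eventuallyEq {s : ∀ y, AdmFrame G E y} {U : Set M} (hU : IsOpen U)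
    (hs : ContMDiffOn 𝓘(ℝ, EM) (𝓘(ℝ, EM).prod 𝓘(ℝ, EG)) ∞
      (fun y => (⟨y, s y⟩ : FrameBundle G E)) U) {x : M} (hx : x ∈ U) (ξ : F) :
    ∃ t : SmoothSec F E EM, ∀ᶠ y in 𝓝 x, t y = (s y).1 ξ := by
  obtain ⟨ψ, h1, hψ⟩ := exists_bump EM (hU.mem_nhds hx)
  refine ⟨⟨fun y => ψ y • (s y).1 ξ, ContMDiffOn.smul_section_of_tsupport
    (s := fun y => (s y).1 ξ) (ψ := ψ) ψ.contMDiff.contMDiffOn hU hψ fun y hy =>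
      (contMDiffAt_frame_apply (hs.contMDiffAt (hU.mem_nhds hy))
        (contMDiffAt_const (c := ξ))).contMDiffWithinAt⟩, ?_⟩
  filter_upwards [h1] with y hy
  change ψ y • (s y).1 ξ = _
  rw [hy, one_smul]

namespace LinearConnection

variable (D : LinearConnection F E EM)

/-- Cutting off `s ξ` yields a global section with the same germ at `x`, so the condition defining a
local form value is never vacuous and determines `X ξ` for every `ξ`. -/
theorem HasLocalFormValue.unique {D : LinearConnection F E EM} {s : ∀ y, AdmFrame G E y}
    {U : Set M} (hU : IsOpen U)
    (hs : ContMDiffOn 𝓘(ℝ, EM) (𝓘(ℝ, EM).prod 𝓘(ℝ, EG)) ∞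
      (fun y => (⟨y, s y⟩ : FrameBundle G E)) U) {x : M} (hx : x ∈ U)
    {v : TangentSpace 𝓘(ℝ, EM) x} {X X' : TangentSpace 𝓘(ℝ, EG) (1 : G)}
    (h : D.HasLocalFormValue s x v X) (h' : D.HasLocalFormValue s x v X') : X = X' := by
  apply lieToEndL_injective (G := G) (EG := EG)
  ext ξ
  obtain ⟨t, ht⟩ := exists_section_eventuallyEq EM hU hs hx ξ
  have h1 := (h ξ t ht).symm.trans (h' ξ t ht)
  exact (s x).1.injective h1

/-- If `t` is `s ξ` near `x`, then `secFun t` is constantly `ξ` along `s`. Its derivative along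
`ds(v) - I_p X` therefore comes from the vertical part alone and is `X ξ`; horizontality says that
this is `p⁻¹ (∇_v t)`. -/
theorem hasLocalFormValue_of_mem_horizontal {s : ∀ y, AdmFrame G E y} {x : M}
    (hs : ContMDiffAt 𝓘(ℝ, EM) (𝓘(ℝ, EM).prod 𝓘(ℝ, EG)) ∞
      (fun y => (⟨y, s y⟩ : FrameBundle G E)) x) {v : TangentSpace 𝓘(ℝ, EM) x} {X : EG}
    (h : dSection EM EG s x v - infActionL EM EG (⟨x, s x⟩ : FrameBundle G E) X ∈
      D.horizontal G EG ⟨x, s x⟩) : D.HasLocalFormValue s x v X := by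
  intro ξ t ht
  have h1 := h t
  have h2 : dSecFun t (⟨x, s x⟩ : FrameBundle G E) (dSection EM EG s x v) = 0 := by
    refine dSecFun_dSection hs t (f := fun _ => ξ) (f' := 0) ?_ (hasMFDerivAt_const ξ x) v
    filter_upwards [ht] with y hy
    change (s y).1.symm (t y) = ξ
    rw [hy, ContinuousLinearEquiv.symm_apply_apply]
  have h3 : secFun t (⟨x, s x⟩ : FrameBundle G E) = ξ := by
    change (s x).1.symm (t x) = ξ
    rw [ht.self_of_nhds, ContinuousLinearEquiv.symm_apply_apply]
  rw [map_sub, map_sub, h2, dSecFun_infActionL, h3, dProj_infActionL, dProj_dSection hs, sub_zero,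
    zero_sub, neg_neg] at h1
  change _ = (s x).1 (lieToEndL G EG X ξ)
  rw [h1]
  exact ((s x).1.apply_symm_apply _).symm

/-- A local form value only tests sections with constant coordinates, horizontality tests all
sections; the local expression `d + A` bridges the gap. Sections constant in a trivialization
suffice, as every frame lies on one of them. -/
theorem mem_horizontal_of_hasLocalFormValue (e : Trivialization F (π F E))
    [MemTrivializationAtlas e] (g : G) {x : M} (hx : x ∈ e.baseSet)
    {v : TangentSpace 𝓘(ℝ, EM) x} {X : EG} (h : D.HasLocalFormValue (localSec G e g) x v X) :
    dSection EM EG (localSec G e g) x v -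
      infActionL EM EG (⟨x, localSec G e g x⟩ : FrameBundle G E) X ∈
        D.horizontal G EG ⟨x, localSec G e g x⟩ := by
  intro t
  have hs := contMDiffAt_localSec EM EG e hx g
  obtain ⟨ψ, h1, hψ⟩ := exists_bump EM (e.open_baseSet.mem_nhds hx)
  have hτ : ContMDiffAt 𝓘(ℝ, EM) 𝓘(ℝ, F) ∞ (fun y => (e ⟨y, t y⟩).2) x :=
    (e.contMDiffAt_section_iff hx).1 (t.contMDiff x)
  set p : FrameBundle G E := ⟨x, localSec G e g x⟩
  have hp : p.1 ∈ e.baseSet := hx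
  have hsec : ∀ y ∈ e.baseSet, ∀ t' : ∀ y, E y,
      secFun t' (⟨y, localSec G e g y⟩ : FrameBundle G E) = toEnd G g⁻¹ (e ⟨y, t' y⟩).2 := by
    intro y hy t'
    rw [secFun_eq e t' (p := ⟨y, localSec G e g y⟩) hy, coordMap_localSec e hy]
  let τ' : EM →L[ℝ] F := mfderiv 𝓘(ℝ, EM) 𝓘(ℝ, F) (fun y => (e ⟨y, t y⟩).2) x
  have h2 : dSecFun t p (dSection EM EG (localSec G e g) x v) = toEnd G g⁻¹ (τ' v) := by
    have h3 := HasMFDerivAt.comp x (g := toEnd G g⁻¹) (f := fun y => (e ⟨y, t y⟩).2)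
      (ContinuousLinearMap.hasMFDerivAt (toEnd G g⁻¹))
      (hτ.mdifferentiableAt (by simp)).hasMFDerivAt
    refine dSecFun_dSection hs t (f' := (toEnd G g⁻¹).comp τ') ?_ h3 v
    filter_upwards [e.open_baseSet.mem_nhds hx] with y hy
    exact hsec y hy t
  have h4 : (e ⟨x, D.toLin (extSec e ψ hψ (e ⟨x, t x⟩).2) x v⟩).2 =
      toEnd G g (lieToEndL G EG X (secFun t p)) := by
    have h5 := h (secFun t p) (extSec e ψ hψ (e ⟨x, t x⟩).2) (by
      filter_upwards [extSec_eventuallyEq e ψ hψ h1 (e ⟨x, t x⟩).2, e.open_baseSet.mem_nhds hx]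
        with y hy hye
      rw [hy, localSec_eq_symm e hye, hsec x hx, toEnd_apply_toEnd_inv, e.symmL_apply hye])
    rw [h5]
    exact localSec_apply e hx g _
  have h6 : p.2.1.symm (D.toLin t x v) =
      toEnd G g⁻¹ (τ' v + toEnd G g (lieToEndL G EG X (secFun t p))) := by
    have h7 := D.toLin_localExpr e hψ h1 hx t v
    rw [h4] at h7
    have h8 := hsec x hx (fun y => D.toLin t y (show EM from v))
    exact h8.trans (congrArg (toEnd G g⁻¹) h7)
  rw [map_sub, map_sub, h2, dSecFun_infActionL, dProj_infActionL, dProj_dSection hs, sub_zero,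
    sub_neg_eq_add]
  refine Eq.trans ?_ h6.symm
  rw [map_add, toEnd_inv_apply_toEnd]

end LinearConnection

/-- A linear connection and a principal connection correspond to each other if and only if the
principal connection consists of the horizontal spaces of the linear connection. -/
theorem corresponds_iff (D : LinearConnection F E EM) (C : PrincipalConnection G E EM EG) :
    Corresponds D C ↔ ∀ p, C.H p = D.horizontal G EG p := by
  constructor
  · intro h p
    obtain ⟨g, hg⟩ := exists_localSec_eq p
    set e := trivializationAt F E p.1
    have hx : p.1 ∈ e.baseSet := mem_baseSet_trivializationAt _ _ _
    -- Both spaces meet the vertical space trivially, so they coincide as soon as every `v` has a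
    -- lift common to both.
    have key : ∀ v : TangentSpace 𝓘(ℝ, EM) p.1, ∃ w : TangentSpace (𝓘(ℝ, EM).prod 𝓘(ℝ, EG)) p,
        w ∈ C.H p ∧ w ∈ D.horizontal G EG p ∧ dProj EM EG p w = v := by
      -- The equation for `p` mentions `p` itself through its base point, which must be generalized
      -- before substituting.
      generalize p.1 = x at hg hx
      subst hg
      intro v
      obtain ⟨X, hX⟩ := C.exists_sub_mem _ (dSection EM EG (localSec G e g) x v)
      refine ⟨_, hX, D.mem_horizontal_of_hasLocalFormValue e g hx
        ((h e.baseSet (localSec G e g) e.open_baseSet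
          (fun y hy => (contMDiffAt_localSec EM EG e hy g).contMDiffWithinAt) x hx v X).1 hX), ?_⟩
      rw [map_sub, dProj_infActionL, sub_zero, dProj_dSection (contMDiffAt_localSec EM EG e hx g)]
    apply le_antisymm
    · intro w hw
      obtain ⟨w', h1, h2, h3⟩ := key (dProj EM EG p w)
      have h4 := C.eq_zero_of_mem ((C.H p).sub_mem hw h1) (by rw [map_sub, h3, sub_self])
      rwa [sub_eq_zero.1 h4]
    · intro w hw
      obtain ⟨w', h1, h2, h3⟩ := key (dProj EM EG p w)
      have h4 := D.eq_zero_of_mem_horizontal ((D.horizontal G EG p).sub_mem hw h2)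
        (by rw [map_sub, h3, sub_self])
      rwa [sub_eq_zero.1 h4]
  · intro h U s hU hs x hx v X
    have hs' := hs.contMDiffAt (hU.mem_nhds hx)
    have hfw : ∀ X : EG, dSection EM EG s x v - infActionL EM EG (⟨x, s x⟩ : FrameBundle G E) X ∈
        C.H ⟨x, s x⟩ → D.HasLocalFormValue s x v X := fun X hX =>
      D.hasLocalFormValue_of_mem_horizontal hs' (h _ ▸ hX)
    refine ⟨hfw X, fun hX => ?_⟩
    -- The form of `C` has some value `X'`, which is then also a local form value of `D`; uniqueness
    -- of the latter identifies it with `X`.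
    obtain ⟨X', hX'⟩ := C.exists_sub_mem ⟨x, s x⟩ (dSection EM EG s x v)
    rw [hX.unique hU hs hx (hfw X' hX')]
    exact hX'

end HorizontalSpaces

/-! ### From linear connections with horizontal lifts to principal connections -/

section HorizontalSpaces

variable {F : Type*} [NormedAddCommGroup F] [NormedSpace ℝ F] [FiniteDimensional ℝ F]
  {G : Subgroup (F →L[ℝ] F)ˣ}
  {M : Type*} [TopologicalSpace M] {E : M → Type*} [TopologicalSpace (TotalSpace F E)]
  [∀ x, AddCommGroup (E x)] [∀ x, Module ℝ (E x)] [∀ x, TopologicalSpace (E x)]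
  [∀ x, IsTopologicalAddGroup (E x)] [∀ x, ContinuousSMul ℝ (E x)]
  [FiberBundle F E] [VectorBundle ℝ F E]
  {EM : Type*} [NormedAddCommGroup EM] [NormedSpace ℝ EM] [FiniteDimensional ℝ EM]
  [ChartedSpace EM M] [IsManifold 𝓘(ℝ, EM) ∞ M] [T2Space M]
  [ContMDiffVectorBundle ∞ F E 𝓘(ℝ, EM)]
  {EG : Type*} [NormedAddCommGroup EG] [NormedSpace ℝ EG] [FiniteDimensional ℝ EG]
  [ChartedSpace EG G] [LieGroup 𝓘(ℝ, EG) ∞ G] [IsEmbeddedLieSubgroup G (EG := EG)]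
  [IsGVectorBundle G E]

open FrameBundle

theorem HasMFDerivAt.clm_eq {N : Type*} [TopologicalSpace N] {H : Type*} [TopologicalSpace H]
    {EN : Type*} [NormedAddCommGroup EN] [NormedSpace ℝ EN] {I : ModelWithCorners ℝ EN H}
    [ChartedSpace H N] {V W : Type*} [NormedAddCommGroup V] [NormedSpace ℝ V]
    [NormedAddCommGroup W] [NormedSpace ℝ W] {J : N → V} {q : N} {J' : EN →L[ℝ] V}
    (hJ : HasMFDerivAt I 𝓘(ℝ, V) J q J') (ℓ : V →L[ℝ] W) {f' : EN →L[ℝ] W}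
    (h : HasMFDerivAt I 𝓘(ℝ, W) (fun q => ℓ (J q)) q f') (w : EN) : ℓ (J' w) = f' w := by
  have h1 := HasMFDerivAt.comp q (g := ℓ) (f := J) (ContinuousLinearMap.hasMFDerivAt ℓ) hJ
  exact congrArg (fun L : EN →L[ℝ] W => L w) (hasMFDerivAt_unique h1 h)

namespace LinearConnection

variable (D : LinearConnection F E EM)

variable (G EG) in
/-- Every tangent vector of the base has a horizontal lift to each frame. -/
def HasLifts : Prop :=
  ∀ (p : FrameBundle G E) (v : TangentSpace 𝓘(ℝ, EM) p.1), ∃ w ∈ D.horizontal G EG p,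
    dProj EM EG p w = v

/-- Horizontal lifts of smooth vector fields are smooth. -/
theorem contMDiffAt_lift {p₀ : FrameBundle G E} {x₀ : M}
    (hx₀ : p₀.1 ∈ (chartAt EM x₀).source) (u : EM)
    {Y : ∀ q : FrameBundle G E, TangentSpace (𝓘(ℝ, EM).prod 𝓘(ℝ, EG)) q}
    (hY : ∀ q : FrameBundle G E, q.1 ∈ (chartAt EM x₀).source → Y q ∈ D.horizontal G EG q)
    (hYv : ∀ q : FrameBundle G E, q.1 ∈ (chartAt EM x₀).source → dProj EM EG q (Y q) =
      (trivializationAt EM (TangentSpace 𝓘(ℝ, EM) : M → Type _) x₀).symm q.1 u) :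
    ContMDiffAt (𝓘(ℝ, EM).prod 𝓘(ℝ, EG)) (𝓘(ℝ, EM).prod 𝓘(ℝ, EG)).tangent ∞
      (fun q => (⟨q, Y q⟩ : TangentBundle (𝓘(ℝ, EM).prod 𝓘(ℝ, EG)) (FrameBundle G E))) p₀ := by
  set e := trivializationAt EM (TangentSpace 𝓘(ℝ, EM) : M → Type _) x₀
  have he : e.baseSet = (chartAt EM x₀).source := rfl
  let χ := extChartAt 𝓘(ℝ, EM) x₀
  let m := Module.finrank ℝ F
  -- Finitely many sections suffice to pin down tangent vectors near `p₀`: if their values in the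
  -- frame `p₀` form a basis of `F`, the map `J` below is an immersion at `p₀`. A horizontal lift
  -- `Y` of the field with constant coordinates `u` satisfies `dJ(Y) = b` with `b` smooth, hence is
  -- smooth.
  choose t ht using fun j : Fin m => exists_secFun_eq (EM := EM) p₀ (Module.finBasis ℝ F j)
  let J : FrameBundle G E → EM × (Fin m → F) := fun q => (χ q.1, fun j => secFun (t j) q)
  let b : FrameBundle G E → EM × (Fin m → F) := fun q =>
    (u, fun j => secFun (fun x => D.toLin (t j) x (e.symm x u)) q)
  have hχ : ∀ q : FrameBundle G E, q.1 ∈ (chartAt EM x₀).source →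
      ContMDiffAt (𝓘(ℝ, EM).prod 𝓘(ℝ, EG)) 𝓘(ℝ, EM) ∞ (fun q => χ q.1) q := fun q hq =>
    (contMDiffAt_extChartAt' hq).comp q (contMDiff_proj' EM EG q)
  have hJ : ∀ q : FrameBundle G E, q.1 ∈ (chartAt EM x₀).source →
      ContMDiffAt (𝓘(ℝ, EM).prod 𝓘(ℝ, EG)) 𝓘(ℝ, EM × (Fin m → F)) ∞ J q := fun q hq =>
    (hχ q hq).prodMk_space (contMDiffAt_pi_space.2 fun j =>
      contMDiffAt_secFun EM EG ((t j).contMDiff q.1))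
  have hJ' : ∀ q : FrameBundle G E, q.1 ∈ (chartAt EM x₀).source → HasMFDerivAt
      (𝓘(ℝ, EM).prod 𝓘(ℝ, EG)) 𝓘(ℝ, EM × (Fin m → F)) J q
      (mfderiv (𝓘(ℝ, EM).prod 𝓘(ℝ, EG)) 𝓘(ℝ, EM × (Fin m → F)) J q) := fun q hq =>
    ((hJ q hq).mdifferentiableAt (by simp)).hasMFDerivAt
  have hJ1 : ∀ q : FrameBundle G E, q.1 ∈ (chartAt EM x₀).source → ∀ w : EM × EG,
      (mfderiv (𝓘(ℝ, EM).prod 𝓘(ℝ, EG)) 𝓘(ℝ, EM × (Fin m → F)) J q w : EM × (Fin m → F)).1 =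
        (e ⟨q.1, dProj EM EG q w⟩).2 := by
    intro q hq w
    have h1 := HasMFDerivAt.comp q (g := χ) (f := π G (AdmFrame G E))
      ((contMDiffAt_extChartAt' (n := ∞) hq).mdifferentiableAt (by simp)).hasMFDerivAt
      (hasMFDerivAt_proj EM EG q)
    have h2 := (hJ' q hq).clm_eq (ContinuousLinearMap.fst ℝ EM (Fin m → F)) h1 w
    refine h2.trans ?_
    have h3 := TangentBundle.continuousLinearMapAt_trivializationAt (I := 𝓘(ℝ, EM)) hq
    have h4 := congrArg (fun L : EM →L[ℝ] EM => L (dProj EM EG q w)) h3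
    refine h4.symm.trans ?_
    have hq' : q.1 ∈ e.baseSet := hq
    change e.continuousLinearMapAt ℝ q.1 (dProj EM EG q w) = _
    rw [Trivialization.continuousLinearMapAt_apply, Trivialization.linearMapAt_apply, if_pos hq']
  have hJ2 : ∀ q : FrameBundle G E, q.1 ∈ (chartAt EM x₀).source → ∀ w : EM × EG, ∀ j,
      (mfderiv (𝓘(ℝ, EM).prod 𝓘(ℝ, EG)) 𝓘(ℝ, EM × (Fin m → F)) J q w : EM × (Fin m → F)).2 j =
        dSecFun (t j) q w := fun q hq w j =>
    (hJ' q hq).clm_eq ((ContinuousLinearMap.proj (R := ℝ) (φ := fun _ : Fin m => F) j).comp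
      (ContinuousLinearMap.snd ℝ EM (Fin m → F))) (hasMFDerivAt_secFun (t j) q) w
  have heu : ContMDiffAt 𝓘(ℝ, EM) 𝓘(ℝ, EM).tangent ∞
      (fun x => (⟨x, e.symm x u⟩ : TangentBundle 𝓘(ℝ, EM) M)) p₀.1 := by
    refine (e.contMDiffAt_section_iff (IB := 𝓘(ℝ, EM)) (n := ∞) (s := fun x => e.symm x u) hx₀).2
      ((contMDiffAt_const (c := u)).congr_of_eventuallyEq ?_)
    filter_upwards [e.open_baseSet.mem_nhds hx₀] with x hx
    rw [e.apply_mk_symm hx]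
  have hb : ContMDiffAt (𝓘(ℝ, EM).prod 𝓘(ℝ, EG)) 𝓘(ℝ, EM × (Fin m → F)) ∞ b p₀ := by
    refine contMDiffAt_const.prodMk_space (contMDiffAt_pi_space.2 fun j =>
      contMDiffAt_secFun EM EG ?_)
    exact ContMDiffAt.clm_bundle_apply ((D.toLin (t j)).contMDiff p₀.1) heu
  refine contMDiffAt_vectorField_of_mfderiv (hJ p₀ hx₀) hb ?_ ?_
  · refine (injective_iff_map_eq_zero (mfderiv (𝓘(ℝ, EM).prod 𝓘(ℝ, EG))
      𝓘(ℝ, EM × (Fin m → F)) J p₀).toLinearMap).2 fun w hw => ?_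
    have hw1 : (e ⟨p₀.1, dProj EM EG p₀ w⟩).2 = 0 :=
      (hJ1 p₀ hx₀ w).symm.trans (congrArg Prod.fst hw)
    have hw2 : ∀ j, dSecFun (t j) p₀ w = 0 := fun j =>
      (hJ2 p₀ hx₀ w j).symm.trans (congrFun (congrArg Prod.snd hw) j)
    have hw3 : dProj EM EG p₀ w = 0 :=
      (e.continuousLinearEquivAt ℝ p₀.1 hx₀).map_eq_zero_iff.1 hw1
    obtain ⟨X, rfl⟩ := exists_infActionL_eq hw3
    have hX : lieToEndL G EG X = 0 := by
      refine ContinuousLinearMap.coe_injective ((Module.finBasis ℝ F).ext fun j => ?_)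
      have := hw2 j
      rw [dSecFun_infActionL, ht, neg_eq_zero] at this
      exact this
    rw [lieToEndL_injective (hX.trans (map_zero _).symm), map_zero]
  · filter_upwards [((chartAt EM x₀).open_source.preimage continuous_proj).mem_nhds hx₀] with q hq
    have hq' : q.1 ∈ e.baseSet := hq
    refine Prod.ext ?_ (funext fun j => ?_)
    · refine (hJ1 q hq (Y q)).trans ?_
      rw [hYv q hq, e.apply_mk_symm hq']
    · refine (hJ2 q hq (Y q) j).trans ?_
      rw [hY q hq (t j), hYv q hq]
      rfl

variable {D} in
/-- The horizontal spaces of a connection on `E` which has horizontal lifts form a connection on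
the frame bundle. -/
def HasLifts.toPrincipal (hD : D.HasLifts G EG) : PrincipalConnection G E EM EG where
  H := D.horizontal G EG
  smooth p := by
    classical
    set e := trivializationAt EM (TangentSpace 𝓘(ℝ, EM) : M → Type _) p.1
    let b := Module.finBasis ℝ EM
    -- The local frame of the distribution consists of the lifts of the coordinate fields of the
    -- chart at the base point of `p`.
    choose! Y hY hYv using fun (i : Fin (Module.finrank ℝ EM)) (q : FrameBundle G E) =>
      hD q (e.symm q.1 (b i))
    refine ⟨π G (AdmFrame G E) ⁻¹' (chartAt EM p.1).source,
      (chartAt EM p.1).open_source.preimage continuous_proj, mem_chart_source EM p.1, Y,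
      fun i q hq => (D.contMDiffAt_lift hq (b i) (fun q _ => hY i q)
        (fun q _ => hYv i q)).contMDiffWithinAt, fun q hq => ?_⟩
    have hq' : q.1 ∈ e.baseSet := hq
    let B := b.map (e.continuousLinearEquivAt ℝ q.1 hq').toLinearEquiv.symm
    have hB : ∀ i, B i = dProj EM EG q (Y i q) := fun i => (hYv i q).symm
    constructor
    · refine LinearIndependent.of_comp (dProj EM EG q).toLinearMap ?_
      have := B.linearIndependent
      rwa [show ⇑B = _ from funext hB] at this
    · apply le_antisymm
      · rw [Submodule.span_le]
        rintro _ ⟨i, rfl⟩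
        exact hY i q
      · intro w hw
        have h1 : w - ∑ i, B.repr (dProj EM EG q w) i • Y i q = 0 := by
          refine D.eq_zero_of_mem_horizontal (Submodule.sub_mem _ hw (Submodule.sum_mem _ fun i _ =>
            Submodule.smul_mem _ _ (hY i q))) ?_
          rw [map_sub, map_sum, sub_eq_zero]
          simp_rw [map_smul, ← hB]
          exact (B.sum_repr _).symm
        rw [sub_eq_zero.1 h1]
        exact Submodule.sum_mem _ fun i _ => Submodule.smul_mem _ _
          (Submodule.subset_span ⟨i, rfl⟩)
  isCompl p := by
    constructor
    · rw [Submodule.disjoint_def]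
      exact fun w hw h0 => D.eq_zero_of_mem_horizontal hw h0
    · rw [codisjoint_iff, Submodule.eq_top_iff']
      intro w
      obtain ⟨w', hw', hv⟩ := hD p (dProj EM EG p w)
      refine Submodule.mem_sup.2 ⟨w', hw', w - w', ?_, by rw [add_sub_cancel]⟩
      change dProj EM EG p (w - w') = 0
      rw [map_sub, hv, sub_self]
  invariant g p := D.map_dRightMul_horizontal g p

end LinearConnection

end HorizontalSpaces

/-! ### From principal connections to linear connections -/

section HorizontalSpaces

variable {F : Type*} [NormedAddCommGroup F] [NormedSpace ℝ F] [FiniteDimensional ℝ F]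
  {G : Subgroup (F →L[ℝ] F)ˣ}
  {M : Type*} [TopologicalSpace M] {E : M → Type*} [TopologicalSpace (TotalSpace F E)]
  [∀ x, AddCommGroup (E x)] [∀ x, Module ℝ (E x)] [∀ x, TopologicalSpace (E x)]
  [∀ x, IsTopologicalAddGroup (E x)] [∀ x, ContinuousSMul ℝ (E x)]
  [FiberBundle F E] [VectorBundle ℝ F E]
  {EM : Type*} [NormedAddCommGroup EM] [NormedSpace ℝ EM] [FiniteDimensional ℝ EM]
  [ChartedSpace EM M] [IsManifold 𝓘(ℝ, EM) ∞ M] [T2Space M]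
  [ContMDiffVectorBundle ∞ F E 𝓘(ℝ, EM)]
  {EG : Type*} [NormedAddCommGroup EG] [NormedSpace ℝ EG] [FiniteDimensional ℝ EG]
  [ChartedSpace EG G] [LieGroup 𝓘(ℝ, EG) ∞ G] [IsEmbeddedLieSubgroup G (EG := EG)]
  [IsGVectorBundle G E]

open FrameBundle

theorem HasMFDerivAt.smul_vector {N : Type*} [TopologicalSpace N] {H : Type*} [TopologicalSpace H]
    {EN : Type*} [NormedAddCommGroup EN] [NormedSpace ℝ EN] {I : ModelWithCorners ℝ EN H}
    [ChartedSpace H N] {V : Type*} [NormedAddCommGroup V] [NormedSpace ℝ V]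
    {f : N → ℝ} {g : N → V} {q : N} {f' : EN →L[ℝ] ℝ} {g' : EN →L[ℝ] V}
    (hf : HasMFDerivAt I 𝓘(ℝ, ℝ) f q f') (hg : HasMFDerivAt I 𝓘(ℝ, V) g q g') :
    HasMFDerivAt I 𝓘(ℝ, V) (fun q => f q • g q) q (f q • g' + f'.smulRight (g q)) := by
  refine ⟨hf.1.smul hg.1, ?_⟩
  have h := hf.2.smul hg.2
  simpa only [writtenInExtChartAt, extChartAt_model_space_eq_id, PartialEquiv.refl_coe,
    Function.comp_apply, id_eq, extChartAt_to_inv] using! h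

namespace FrameBundle

theorem dSecFun_add (t t' : SmoothSec F E EM) (p : FrameBundle G E) :
    dSecFun (EG := EG) (t + t') p = dSecFun t p + dSecFun t' p := by
  have h1 := HasMFDerivAt.add (hasMFDerivAt_secFun (EG := EG) t p) (hasMFDerivAt_secFun t' p)
  refine hasMFDerivAt_unique (hasMFDerivAt_secFun (EG := EG) (t + t') p)
    (h1.congr_of_eventuallyEq (Filter.Eventually.of_forall fun q => ?_))
  exact map_add q.2.1.symm (t q.1) (t' q.1)

theorem dSecFun_smul (c : ℝ) (t : SmoothSec F E EM) (p : FrameBundle G E) :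
    dSecFun (EG := EG) (c • t) p = c • dSecFun t p := by
  have h1 := HasMFDerivAt.const_smul (hasMFDerivAt_secFun (EG := EG) t p) c
  refine hasMFDerivAt_unique (hasMFDerivAt_secFun (EG := EG) (c • t) p)
    (h1.congr_of_eventuallyEq (Filter.Eventually.of_forall fun q => ?_))
  exact map_smul q.2.1.symm c (t q.1)

theorem dSecFun_fsmul (f : C^∞⟮𝓘(ℝ, EM), M; ℝ⟯) (t : SmoothSec F E EM) (p : FrameBundle G E)
    (w : TangentSpace (𝓘(ℝ, EM).prod 𝓘(ℝ, EG)) p) :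
    dSecFun (EG := EG) (SmoothSec.fsmul f t) p w = f p.1 • dSecFun t p w +
      (show ℝ from mfderiv 𝓘(ℝ, EM) 𝓘(ℝ, ℝ) f p.1 (dProj EM EG p w)) • secFun t p := by
  have hf := HasMFDerivAt.comp p (g := f) (f := π G (AdmFrame G E))
    ((f.contMDiff p.1).mdifferentiableAt (by simp)).hasMFDerivAt (hasMFDerivAt_proj EM EG p)
  have h1 := HasMFDerivAt.smul_vector hf (hasMFDerivAt_secFun (EG := EG) t p)
  have h2 := hasMFDerivAt_unique (hasMFDerivAt_secFun (EG := EG) (SmoothSec.fsmul f t) p)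
    (h1.congr_of_eventuallyEq (Filter.Eventually.of_forall fun q =>
      map_smul q.2.1.symm (f q.1) (t q.1)))
  exact congrArg (fun L : EM × EG →L[ℝ] F => L w) h2

theorem exists_dProj_eq (p : FrameBundle G E) (v : TangentSpace 𝓘(ℝ, EM) p.1) :
    ∃ w, dProj EM EG p w = v :=
  mfderiv_proj_surjective p v

end FrameBundle

namespace PrincipalConnection

variable (C : PrincipalConnection G E EM EG)

theorem exists_lift (p : FrameBundle G E) (v : TangentSpace 𝓘(ℝ, EM) p.1) :
    ∃ w ∈ C.H p, dProj EM EG p w = v := by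
  obtain ⟨w, hw⟩ := exists_dProj_eq (EG := EG) p v
  obtain ⟨X, hX⟩ := C.exists_sub_mem p w
  exact ⟨_, hX, by rw [map_sub, dProj_infActionL, sub_zero, hw]⟩

theorem eq_of_mem {p : FrameBundle G E} {w w' : TangentSpace (𝓘(ℝ, EM).prod 𝓘(ℝ, EG)) p}
    (hw : w ∈ C.H p) (hw' : w' ∈ C.H p) (h : dProj EM EG p w = dProj EM EG p w') : w = w' :=
  sub_eq_zero.1 (C.eq_zero_of_mem ((C.H p).sub_mem hw hw') (by rw [map_sub, h, sub_self]))

/-- The horizontal lift of a tangent vector. -/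
def lift (p : FrameBundle G E) : TangentSpace 𝓘(ℝ, EM) p.1 →ₗ[ℝ]
    TangentSpace (𝓘(ℝ, EM).prod 𝓘(ℝ, EG)) p where
  toFun v := (C.exists_lift p v).choose
  map_add' v v' := C.eq_of_mem (C.exists_lift p _).choose_spec.1
    ((C.H p).add_mem (C.exists_lift p v).choose_spec.1 (C.exists_lift p v').choose_spec.1) (by
      rw [map_add, (C.exists_lift p _).choose_spec.2, (C.exists_lift p v).choose_spec.2,
        (C.exists_lift p v').choose_spec.2])
  map_smul' c v := C.eq_of_mem (C.exists_lift p _).choose_spec.1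
    ((C.H p).smul_mem c (C.exists_lift p v).choose_spec.1) (by
      rw [RingHom.id_apply, map_smul, (C.exists_lift p _).choose_spec.2,
        (C.exists_lift p v).choose_spec.2])

theorem lift_mem (p : FrameBundle G E) (v : TangentSpace 𝓘(ℝ, EM) p.1) : C.lift p v ∈ C.H p :=
  (C.exists_lift p v).choose_spec.1

theorem dProj_lift (p : FrameBundle G E) (v : TangentSpace 𝓘(ℝ, EM) p.1) :
    dProj EM EG p (C.lift p v) = v :=
  (C.exists_lift p v).choose_spec.2

/-- The covariant derivative of a section, computed in the frame `p`. -/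
def frameDeriv (t : SmoothSec F E EM) (p : FrameBundle G E) :
    TangentSpace 𝓘(ℝ, EM) p.1 →ₗ[ℝ] E p.1 :=
  p.2.1.toLinearEquiv.toLinearMap ∘ₗ (dSecFun t p).toLinearMap ∘ₗ C.lift p

theorem frameDeriv_apply (t : SmoothSec F E EM) (p : FrameBundle G E)
    (v : TangentSpace 𝓘(ℝ, EM) p.1) :
    C.frameDeriv t p v = p.2.1 (dSecFun t p (C.lift p v)) := rfl

/-- By invariance, `dR_g` carries the lift at `p` to the lift at `p ∘ g`. The factor `g⁻¹` from
equivariance of `secFun t` cancels against the frame `p ∘ g`. -/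
theorem frameDeriv_rightMul (t : SmoothSec F E EM) (p : FrameBundle G E) (g : G)
    (v : TangentSpace 𝓘(ℝ, EM) p.1) :
    C.frameDeriv t (rightMul g p) v = C.frameDeriv t p v := by
  have h1 : dRightMul EM EG g p (C.lift p v) ∈ C.H (rightMul g p) := by
    rw [← C.invariant g p]
    exact ⟨_, C.lift_mem p v, rfl⟩
  have h2 : C.lift (rightMul g p) v = dRightMul EM EG g p (C.lift p v) :=
    C.eq_of_mem (C.lift_mem (rightMul g p) v) h1
      ((C.dProj_lift (rightMul g p) v).trans
        ((dProj_dRightMul g p (C.lift p v)).trans (C.dProj_lift p v)).symm)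
  change (rightMul g p).2.1 (dSecFun t (rightMul g p) (C.lift (rightMul g p) v)) =
    p.2.1 (dSecFun t p (C.lift p v))
  refine (congrArg (fun w => (rightMul g p).2.1 (dSecFun t (rightMul g p) w)) h2).trans ?_
  refine (congrArg (rightMul g p).2.1 (dSecFun_dRightMul t g p (C.lift p v))).trans ?_
  exact congrArg p.2.1 (toEnd_apply_toEnd_inv g _)

/-- A frame at each point. -/
def basePoint (x : M) : AdmFrame G E x := localSec G (trivializationAt F E x) 1 x

theorem frameDeriv_eq (t : SmoothSec F E EM) {x : M} (u u' : AdmFrame G E x)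
    (v : TangentSpace 𝓘(ℝ, EM) x) :
    C.frameDeriv t ⟨x, u⟩ v = C.frameDeriv t ⟨x, u'⟩ v := by
  have hx : x ∈ (trivializationAt F E x).baseSet := mem_baseSet_trivializationAt _ _ _
  have key : ∀ u : AdmFrame G E x, C.frameDeriv t ⟨x, u⟩ v = C.frameDeriv t ⟨x, basePoint x⟩ v := by
    intro u
    have h1 : (⟨x, u⟩ : FrameBundle G E) = rightMul (coordMap (trivializationAt F E x) ⟨x, u⟩)
        ⟨x, localSec G (trivializationAt F E x) 1 x⟩ := by
      rw [rightMul_localSec _ hx, one_mul]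
      exact (pretriv_symm_coordMap (trivializationAt F E x) (p := ⟨x, u⟩) hx).symm
    have h2 : u = (localSec G (trivializationAt F E x) 1 x).rightMul
      (coordMap (trivializationAt F E x) ⟨x, u⟩) := TotalSpace.mk_inj.1 h1
    rw [h2]
    exact C.frameDeriv_rightMul t ⟨x, localSec G (trivializationAt F E x) 1 x⟩ _ v
  rw [key u, key u']

/-- The covariant derivative of a section. -/
def covDeriv (t : SmoothSec F E EM) (x : M) : TangentSpace 𝓘(ℝ, EM) x →L[ℝ] E x :=
  haveI : FiniteDimensional ℝ (TangentSpace 𝓘(ℝ, EM) x) := inferInstanceAs (FiniteDimensional ℝ EM)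
  haveI : T2Space (TangentSpace 𝓘(ℝ, EM) x) := inferInstanceAs (T2Space EM)
  LinearMap.toContinuousLinearMap (C.frameDeriv t ⟨x, basePoint x⟩)

/-- Frees the covariant derivative from its arbitrary base frame and its chosen lift: any frame and
any horizontal vector compute it. -/
theorem covDeriv_eq (t : SmoothSec F E EM) (p : FrameBundle G E)
    {w : TangentSpace (𝓘(ℝ, EM).prod 𝓘(ℝ, EG)) p} (hw : w ∈ C.H p) :
    C.covDeriv t p.1 (dProj EM EG p w) = p.2.1 (dSecFun t p w) := by
  change C.frameDeriv t ⟨p.1, basePoint p.1⟩ (dProj EM EG p w) = _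
  rw [C.frameDeriv_eq t (basePoint p.1) p.2, frameDeriv_apply,
    C.eq_of_mem (C.lift_mem _ _) hw (C.dProj_lift _ _)]

theorem covDeriv_apply (t : SmoothSec F E EM) (p : FrameBundle G E)
    (v : TangentSpace 𝓘(ℝ, EM) p.1) :
    C.covDeriv t p.1 v = p.2.1 (dSecFun t p (C.lift p v)) := by
  conv_lhs => rw [← C.dProj_lift p v]
  exact C.covDeriv_eq t p (C.lift_mem p v)

/-- The base frames used in the definition need not vary smoothly. Near `x₀` they are replaced by a
smooth local section `s`, and smoothness is tested on the projections of a local frame of `C.H`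
along `s`; these span at `x₀` because `dπ` maps `C.H` onto the tangent space. -/
theorem contMDiff_covDeriv (t : SmoothSec F E EM) :
    ContMDiff 𝓘(ℝ, EM) (𝓘(ℝ, EM).prod 𝓘(ℝ, EM →L[ℝ] F)) ∞
      (fun x => TotalSpace.mk' (EM →L[ℝ] F)
        (E := fun x : M => TangentSpace 𝓘(ℝ, EM) x →L[ℝ] E x) x (C.covDeriv t x)) := by
  intro x₀
  set e := trivializationAt F E x₀
  have h0 : x₀ ∈ e.baseSet := mem_baseSet_trivializationAt _ _ _
  let s : M → FrameBundle G E := fun x => ⟨x, localSec G e 1 x⟩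
  have hs : ContMDiffAt 𝓘(ℝ, EM) (𝓘(ℝ, EM).prod 𝓘(ℝ, EG)) ∞ s x₀ :=
    contMDiffAt_localSec EM EG e h0 1
  obtain ⟨U, hU, hsU, Y, hY, hYH⟩ := C.smooth (s x₀)
  have hYs : ∀ i, ContMDiffAt 𝓘(ℝ, EM) (𝓘(ℝ, EM).prod 𝓘(ℝ, EG)).tangent ∞
      (fun x => (⟨s x, Y i (s x)⟩ :
        TangentBundle (𝓘(ℝ, EM).prod 𝓘(ℝ, EG)) (FrameBundle G E))) x₀ := fun i =>
    ((hY i).contMDiffAt (hU.mem_nhds hsU)).comp x₀ hs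
  have hsUx : ∀ᶠ x in 𝓝 x₀, s x ∈ U := hs.continuousAt.preimage_mem_nhds (hU.mem_nhds hsU)
  have hYmem : ∀ q ∈ U, ∀ i, Y i q ∈ C.H q := fun q hq i => by
    rw [← (hYH q hq).2]
    exact Submodule.subset_span ⟨i, rfl⟩
  refine contMDiffAt_hom_of_apply (v := fun i x => dProj EM EG (s x) (Y i (s x))) ?_ ?_ ?_
  · intro i
    exact ((contMDiff_proj' EM EG).contMDiff_tangentMap (m := ∞) (by simp)).contMDiffAt.comp x₀ (hYs i)
  · have h1 : (Submodule.span ℝ (range fun i => Y i (s x₀))).map (dProj EM EG (s x₀)).toLinearMap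
        = ⊤ := by
      rw [(hYH _ hsU).2, Submodule.eq_top_iff']
      exact fun v => ⟨_, C.lift_mem (s x₀) v, C.dProj_lift (s x₀) v⟩
    rw [Submodule.map_span, ← range_comp] at h1
    exact h1
  · intro i
    have h1 : ContMDiff (𝓘(ℝ, EM).prod 𝓘(ℝ, EG)) 𝓘(ℝ, F) ∞
        (secFun t : FrameBundle G E → F) := fun q => contMDiffAt_secFun EM EG (t.contMDiff q.1)
    have h2 : ContMDiffAt 𝓘(ℝ, EM) 𝓘(ℝ, F) ∞ (fun x => dSecFun t (s x) (Y i (s x))) x₀ :=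
      (contMDiff_snd_tangentBundle_modelSpace F 𝓘(ℝ, F)).contMDiffAt.comp x₀
        ((h1.contMDiff_tangentMap (m := ∞) (by simp)).contMDiffAt.comp x₀ (hYs i))
    refine (contMDiffAt_frame_apply hs h2).congr_of_eventuallyEq ?_
    filter_upwards [hsUx] with x hx
    exact congrArg (TotalSpace.mk' F x) (C.covDeriv_eq t (s x) (hYmem _ hx i))

/-- The linear connection on `E` given by a principal connection on the frame bundle. -/
def toLinear : LinearConnection F E EM where
  toLin :=
    { toFun := fun t => ⟨C.covDeriv t, C.contMDiff_covDeriv t⟩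
      map_add' := fun t t' => by
        refine ContMDiffSection.ext fun x => ContinuousLinearMap.ext fun v => ?_
        have h := C.covDeriv_apply (t + t') ⟨x, basePoint x⟩ v
        rw [dSecFun_add] at h
        refine h.trans ?_
        rw [_root_.add_apply, map_add, ← C.covDeriv_apply, ← C.covDeriv_apply]
        rfl
      map_smul' := fun c t => by
        refine ContMDiffSection.ext fun x => ContinuousLinearMap.ext fun v => ?_
        have h := C.covDeriv_apply (c • t) ⟨x, basePoint x⟩ v
        rw [dSecFun_smul] at h
        refine h.trans ?_
        rw [_root_.smul_apply, map_smul, ← C.covDeriv_apply]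
        rfl }
  leibniz f t x v := by
    have h := C.covDeriv_apply (SmoothSec.fsmul f t) ⟨x, basePoint x⟩ v
    rw [dSecFun_fsmul, map_add, map_smul, map_smul, ← C.covDeriv_apply, frame_secFun,
      C.dProj_lift] at h
    exact h

/-- One inclusion is the formula for the covariant derivative. The other follows since `C.H p`
already contains a lift of every vector and lifts in the larger space are unique. -/
theorem horizontal_toLinear (p : FrameBundle G E) : C.toLinear.horizontal G EG p = C.H p := by
  have hle : C.H p ≤ C.toLinear.horizontal G EG p := by
    intro w hw t
    rw [ContinuousLinearEquiv.eq_symm_apply]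
    exact (C.covDeriv_eq t p hw).symm
  refine le_antisymm (fun w hw => ?_) hle
  have h1 := C.toLinear.eq_zero_of_mem_horizontal
    (Submodule.sub_mem _ hw (hle (C.lift_mem p (dProj EM EG p w))))
    (by rw [map_sub, C.dProj_lift, sub_self])
  rw [sub_eq_zero.1 h1]
  exact C.lift_mem p _

theorem hasLifts_toLinear : C.toLinear.HasLifts G EG := fun p v =>
  ⟨C.lift p v, by rw [horizontal_toLinear]; exact C.lift_mem p v, C.dProj_lift p v⟩

end PrincipalConnection

/-- A connection with horizontal lifts is determined by its horizontal spaces. -/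
theorem LinearConnection.eq_of_horizontal_eq {D D' : LinearConnection F E EM}
    (hD : D.HasLifts G EG) (h : ∀ p, D.horizontal G EG p = D'.horizontal G EG p) : D = D' := by
  refine LinearConnection.ext (LinearMap.ext fun t => ContMDiffSection.ext fun x =>
    ContinuousLinearMap.ext fun v => ?_)
  obtain ⟨w, hw, hv⟩ := hD ⟨x, PrincipalConnection.basePoint x⟩ v
  have h1 := hw t
  have h2 := (h ⟨x, PrincipalConnection.basePoint x⟩ ▸ hw :
    w ∈ D'.horizontal G EG ⟨x, PrincipalConnection.basePoint x⟩) t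
  rw [hv] at h1 h2
  exact (PrincipalConnection.basePoint x).1.symm.injective (h1.symm.trans h2)

end HorizontalSpaces

/-! ### Parallel sections along a curve as solutions of a linear differential equation -/

section LinearConnectionCalculus

variable {F : Type*} [NormedAddCommGroup F] [NormedSpace ℝ F] [FiniteDimensional ℝ F]
  {M : Type*} [TopologicalSpace M] {E : M → Type*} [TopologicalSpace (TotalSpace F E)]
  [∀ x, AddCommGroup (E x)] [∀ x, Module ℝ (E x)] [∀ x, TopologicalSpace (E x)]
  [∀ x, IsTopologicalAddGroup (E x)] [∀ x, ContinuousSMul ℝ (E x)]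
  [FiberBundle F E] [VectorBundle ℝ F E]
  {EM : Type*} [NormedAddCommGroup EM] [NormedSpace ℝ EM] [FiniteDimensional ℝ EM]
  [ChartedSpace EM M] [IsManifold 𝓘(ℝ, EM) ∞ M] [T2Space M]
  [ContMDiffVectorBundle ∞ F E 𝓘(ℝ, EM)]

namespace LinearConnection

variable (D : LinearConnection F E EM)

section

variable (e : Trivialization F (π F E)) [MemTrivializationAtlas e]
  (ψ : C^∞⟮𝓘(ℝ, EM), M; ℝ⟯) (hψ : tsupport ψ ⊆ e.baseSet)

/-- The connection matrix of `D` in a trivialization `e`, where the constant sections are cut off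
by the function `ψ`. -/
def connMap (x : M) (v : TangentSpace 𝓘(ℝ, EM) x) : F →L[ℝ] F :=
  LinearMap.toContinuousLinearMap
    { toFun := fun ξ => e.continuousLinearMapAt ℝ x (D.toLin (extSec e ψ hψ ξ) x v)
      map_add' := fun ξ η => by
        rw [map_add, map_add]
        exact map_add (e.continuousLinearMapAt ℝ x) _ _
      map_smul' := fun c ξ => by
        rw [map_smul, map_smul]
        exact map_smul (e.continuousLinearMapAt ℝ x) c _ }

variable {x : M}

theorem connMap_smul (c : ℝ) (v : TangentSpace 𝓘(ℝ, EM) x) :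
    D.connMap e ψ hψ x (c • v) = c • D.connMap e ψ hψ x v := by
  refine ContinuousLinearMap.ext fun ξ => ?_
  change e.continuousLinearMapAt ℝ x (D.toLin (extSec e ψ hψ ξ) x (c • v)) =
    c • e.continuousLinearMapAt ℝ x (D.toLin (extSec e ψ hψ ξ) x v)
  rw [map_smul, map_smul]

theorem connMap_apply (hx : x ∈ e.baseSet) (v : TangentSpace 𝓘(ℝ, EM) x) (ξ : F) :
    D.connMap e ψ hψ x v ξ = (e ⟨x, D.toLin (extSec e ψ hψ ξ) x v⟩).2 := by
  change e.continuousLinearMapAt ℝ x (D.toLin (extSec e ψ hψ ξ) x v) = _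
  rw [Trivialization.continuousLinearMapAt_apply, Trivialization.linearMapAt_apply, if_pos hx]

theorem symmL_connMap (hx : x ∈ e.baseSet) (v : TangentSpace 𝓘(ℝ, EM) x) (ξ : F) :
    e.symmL ℝ x (D.connMap e ψ hψ x v ξ) = D.toLin (extSec e ψ hψ ξ) x v :=
  e.symmL_continuousLinearMapAt hx _

/-- A smooth curve defined on `[0, 1]` has a continuous velocity field. -/
theorem continuousOn_velocity {σ : ℝ → M} (hσ : ContMDiffOn 𝓘(ℝ, ℝ) 𝓘(ℝ, EM) ∞ σ (Icc 0 1)) :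
    ContinuousOn (fun t => (⟨σ t, velocity EM σ t⟩ : TangentBundle 𝓘(ℝ, EM) M)) (Icc 0 1) := by
  have h1 := hσ.continuousOn_tangentMapWithin (by simp)
    (uniqueMDiffOn_iff_uniqueDiffOn.2 (uniqueDiffOn_Icc zero_lt_one))
  have h2 : Continuous (fun t : ℝ => (⟨t, (1 : ℝ)⟩ : TangentBundle 𝓘(ℝ, ℝ) ℝ)) := by
    exact (tangentBundleModelSpaceHomeomorph 𝓘(ℝ, ℝ)).symm.continuous.comp
      (continuous_id.prodMk (continuous_const (y := (1 : ℝ))))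
  exact h1.comp h2.continuousOn fun t ht => ht

theorem continuousOn_connMap {σ : ℝ → M} (hσ : ContMDiffOn 𝓘(ℝ, ℝ) 𝓘(ℝ, EM) ∞ σ (Icc 0 1)) :
    ContinuousOn (fun t => D.connMap e ψ hψ (σ t) (velocity EM σ t))
      (Icc 0 1 ∩ σ ⁻¹' e.baseSet) := by
  rw [continuousOn_clm_apply]
  intro ξ
  have h1 : ContinuousOn (fun t => (⟨σ t, D.toLin (extSec e ψ hψ ξ) (σ t) (velocity EM σ t)⟩ :
      TotalSpace F E)) (Icc 0 1) := fun t ht =>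
    ContinuousWithinAt.clm_bundle_apply
      (((D.toLin (extSec e ψ hψ ξ)).contMDiff.continuous.continuousAt).comp_continuousWithinAt
        (hσ.continuousOn t ht)) (continuousOn_velocity hσ t ht)
  have h2 : ContinuousOn (fun t => (e ⟨σ t, D.toLin (extSec e ψ hψ ξ) (σ t)
      (velocity EM σ t)⟩).2) (Icc 0 1 ∩ σ ⁻¹' e.baseSet) :=
    continuous_snd.comp_continuousOn (e.continuousOn.comp (h1.mono inter_subset_left)
      fun t ht => e.mem_source.2 ht.2)
  exact h2.congr fun t ht => D.connMap_apply e ψ hψ ht.2 _ _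

variable {e ψ hψ} {σ : ℝ → M} {t : ℝ}

theorem _root_.ContMDiffOn.hasDerivWithinAt_comp_curve
    (hσ : ContMDiffOn 𝓘(ℝ, ℝ) 𝓘(ℝ, EM) ∞ σ (Icc 0 1)) (ht : t ∈ Icc (0 : ℝ) 1) {f : M → F}
    (hf : ContMDiffAt 𝓘(ℝ, EM) 𝓘(ℝ, F) ∞ f (σ t)) :
    HasDerivWithinAt (fun τ => f (σ τ))
      (show F from mfderiv 𝓘(ℝ, EM) 𝓘(ℝ, F) f (σ t) (velocity EM σ t)) (Icc 0 1) t := by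
  have h1 := ((hσ t ht).mdifferentiableWithinAt (by simp)).hasMFDerivWithinAt
  have h2 := (hf.mdifferentiableAt (by simp)).hasMFDerivAt.comp_hasMFDerivWithinAt t h1
  have h3 : HasFDerivWithinAt (fun τ => f (σ τ))
      ((show EM →L[ℝ] F from mfderiv 𝓘(ℝ, EM) 𝓘(ℝ, F) f (σ t)).comp
        (show ℝ →L[ℝ] EM from mfderivWithin 𝓘(ℝ, ℝ) 𝓘(ℝ, EM) σ (Icc 0 1) t)) (Icc 0 1) t :=
    h2.hasFDerivWithinAt
  exact h3.hasDerivWithinAt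

/-- Sections which are parallel along a curve solve a linear differential equation. -/
theorem HasCovDerivAlong.hasDerivWithinAt
    (hσ : ContMDiffOn 𝓘(ℝ, ℝ) 𝓘(ℝ, EM) ∞ σ (Icc 0 1)) (ht : t ∈ Icc (0 : ℝ) 1)
    (hx : σ t ∈ e.baseSet) (h1 : ∀ᶠ y in 𝓝 (σ t), ψ y = 1) {V : ∀ t, E (σ t)}
    (hV : D.HasCovDerivAlong σ V t 0) :
    HasDerivWithinAt (fun τ => (e ⟨σ τ, V τ⟩).2)
      (-(D.connMap e ψ hψ (σ t) (velocity EM σ t) (e ⟨σ t, V t⟩).2)) (Icc 0 1) t := by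
  obtain ⟨n, s, c, c', hVs, hc, hW⟩ := hV
  have hlin : ∀ y ∈ e.baseSet, ∀ w : E y, (e ⟨y, w⟩).2 = e.continuousLinearMapAt ℝ y w := by
    intro y hy w
    rw [Trivialization.continuousLinearMapAt_apply, Trivialization.linearMapAt_apply, if_pos hy]
  have hs : ∀ i, HasDerivWithinAt (fun τ => (e ⟨σ τ, s i (σ τ)⟩).2)
      (show F from mfderiv 𝓘(ℝ, EM) 𝓘(ℝ, F) (fun y => (e ⟨y, s i y⟩).2) (σ t)
        (velocity EM σ t)) (Icc 0 1) t := fun i =>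
    hσ.hasDerivWithinAt_comp_curve ht ((e.contMDiffAt_section_iff hx).1 ((s i).contMDiff (σ t)))
  have hd : ∀ i, HasDerivWithinAt (fun τ => c i τ • (e ⟨σ τ, s i (σ τ)⟩).2)
      (c i t • (show F from mfderiv 𝓘(ℝ, EM) 𝓘(ℝ, F) (fun y => (e ⟨y, s i y⟩).2) (σ t)
        (velocity EM σ t)) + c' i • (e ⟨σ t, s i (σ t)⟩).2) (Icc 0 1) t := fun i =>
    (hc i).fun_smul (hs i)
  have hsum := HasDerivWithinAt.fun_sum (u := Finset.univ) fun i _ => hd i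
  have hexp : ∀ τ, σ τ ∈ e.baseSet → V τ = ∑ i, c i τ • s i (σ τ) →
      (e ⟨σ τ, V τ⟩).2 = ∑ i, c i τ • (e ⟨σ τ, s i (σ τ)⟩).2 := by
    intro τ hτ h
    rw [h, hlin _ hτ, map_sum]
    refine Finset.sum_congr rfl fun i _ => ?_
    rw [map_smul, hlin _ hτ]
  have hVt := hVs.self_of_nhdsWithin ht
  have hev : ∀ᶠ τ in 𝓝[Icc 0 1] t, (e ⟨σ τ, V τ⟩).2 = ∑ i, c i τ • (e ⟨σ τ, s i (σ τ)⟩).2 := by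
    filter_upwards [hVs, (hσ.continuousOn t ht) (e.open_baseSet.mem_nhds hx)] with τ h h'
    exact hexp τ h' h
  refine (hsum.congr_of_eventuallyEq hev (hexp t hx hVt)).congr_deriv ?_
  have hW2 := congrArg (e.continuousLinearMapAt ℝ (σ t)) hW
  rw [map_zero, map_sum] at hW2
  have hA : D.connMap e ψ hψ (σ t) (velocity EM σ t) (e ⟨σ t, V t⟩).2 =
      ∑ i, c i t • D.connMap e ψ hψ (σ t) (velocity EM σ t) (e ⟨σ t, s i (σ t)⟩).2 := by
    rw [hexp t hx hVt, map_sum]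
    simp_rw [map_smul]
  -- With `sᵢ` read in `e`, the vanishing covariant derivative is `∑ (cᵢ' sᵢ + cᵢ (sᵢ' + A sᵢ)) =
  -- 0`, which is `y' + A y = 0` for `y = ∑ cᵢ sᵢ`.
  rw [hA, eq_neg_iff_add_eq_zero, ← Finset.sum_add_distrib, hW2]
  refine Finset.sum_congr rfl fun i _ => ?_
  rw [map_add, map_smul, map_smul, ← hlin _ hx, ← hlin _ hx, D.toLin_localExpr e hψ h1 hx,
    ← D.connMap_apply e ψ hψ hx, smul_add]
  abel

/-- Solutions of the linear differential equation given by the connection matrix are parallel. -/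
theorem hasCovDerivAlong_of_hasDerivWithinAt
    (hσ : ContinuousWithinAt σ (Icc 0 1) t)
    (hx : σ t ∈ e.baseSet) (h1 : ∀ᶠ y in 𝓝 (σ t), ψ y = 1) {V : ∀ t, E (σ t)} {y : ℝ → F}
    (hV : ∀ᶠ τ in 𝓝[Icc 0 1] t, V τ = e.symmL ℝ (σ τ) (y τ))
    (hy : HasDerivWithinAt y (-(D.connMap e ψ hψ (σ t) (velocity EM σ t) (y t))) (Icc 0 1) t) :
    D.HasCovDerivAlong σ V t 0 := by
  let b := Module.finBasis ℝ F
  let β : Fin (Module.finrank ℝ F) → F →L[ℝ] ℝ := fun j =>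
    LinearMap.toContinuousLinearMap (b.coord j)
  have hb : ∀ u : F, ∑ j, β j u • b j = u := b.sum_repr
  set A := D.connMap e ψ hψ (σ t) (velocity EM σ t) with hA
  -- The witnesses are the cut-off constant sections of a basis of `F`, with the coordinates of `y`
  -- as coefficients.
  refine ⟨_, fun j => extSec e ψ hψ (b j), fun j τ => β j (y τ), fun j => β j (-(A (y t))),
    ?_, fun j => (β j).hasFDerivAt.comp_hasDerivWithinAt t hy, ?_⟩
  · filter_upwards [hV, hσ h1] with τ h h'
    rw [h]
    conv_lhs => rw [← hb (y τ), map_sum]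
    refine Finset.sum_congr rfl fun j _ => ?_
    rw [extSec_apply, show ψ (σ τ) = 1 from h', one_smul, map_smul]
  · rw [Finset.sum_add_distrib]
    have e1 : ∑ j, β j (-(A (y t))) • extSec e ψ hψ (b j) (σ t) =
        e.symmL ℝ (σ t) (-(A (y t))) := by
      conv_rhs => rw [← hb (-(A (y t))), map_sum]
      refine Finset.sum_congr rfl fun j _ => ?_
      rw [extSec_apply, h1.self_of_nhds, one_smul, map_smul]
    have e2 : ∑ j, β j (y t) • D.toLin (extSec e ψ hψ (b j)) (σ t) (velocity EM σ t) =
        e.symmL ℝ (σ t) (A (y t)) := by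
      conv_rhs => rw [← hb (y t), map_sum, map_sum]
      refine Finset.sum_congr rfl fun j _ => ?_
      rw [map_smul, map_smul, hA, D.symmL_connMap e ψ hψ hx]
    rw [e1, e2, map_neg, neg_add_cancel]

end

end LinearConnection

end LinearConnectionCalculus

/-! ### Admissible connections have horizontal lifts -/

section HorizontalSpaces

variable {F : Type*} [NormedAddCommGroup F] [NormedSpace ℝ F] [FiniteDimensional ℝ F]
  {G : Subgroup (F →L[ℝ] F)ˣ}
  {M : Type*} [TopologicalSpace M] {E : M → Type*} [TopologicalSpace (TotalSpace F E)]
  [∀ x, AddCommGroup (E x)] [∀ x, Module ℝ (E x)] [∀ x, TopologicalSpace (E x)]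
  [∀ x, IsTopologicalAddGroup (E x)] [∀ x, ContinuousSMul ℝ (E x)]
  [FiberBundle F E] [VectorBundle ℝ F E]
  {EM : Type*} [NormedAddCommGroup EM] [NormedSpace ℝ EM] [FiniteDimensional ℝ EM]
  [ChartedSpace EM M] [IsManifold 𝓘(ℝ, EM) ∞ M] [T2Space M]
  [ContMDiffVectorBundle ∞ F E 𝓘(ℝ, EM)]
  {EG : Type*} [NormedAddCommGroup EG] [NormedSpace ℝ EG] [FiniteDimensional ℝ EG]
  [ChartedSpace EG G] [LieGroup 𝓘(ℝ, EG) ∞ G] [IsEmbeddedLieSubgroup G (EG := EG)]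
  [IsGVectorBundle G E]

open FrameBundle

/-- The velocities of curves in `G` starting at `1` are elements of its Lie algebra. -/
theorem mem_range_lieToEndL {c : ℝ → F →L[ℝ] F} {c' : F →L[ℝ] F} (h0 : c 0 = toEnd G 1)
    (hc : ∀ t ∈ Icc (0 : ℝ) 1, ∃ g : G, toEnd G g = c t)
    (hd : HasDerivWithinAt c c' (Icc 0 1) 0) : ∃ X : EG, lieToEndL G EG X = c' := by
  obtain ⟨r, hr, hr'⟩ := exists_contMDiffAt_leftInverse (EG := EG) (1 : G)
  have hr1 : r (toEnd G 1) = 1 := hr'.self_of_nhds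
  have h1 := (hr.mdifferentiableAt (by simp)).hasMFDerivAt
  have h2 : HasMFDerivAt 𝓘(ℝ, EG) 𝓘(ℝ, F →L[ℝ] F) (toEnd G) (r (toEnd G 1))
      (mfderiv 𝓘(ℝ, EG) 𝓘(ℝ, F →L[ℝ] F) (toEnd G) 1 : EG →L[ℝ] F →L[ℝ] F) := by
    rw [hr1]
    exact hasMFDerivAt_toEnd
  have h3 := (h2.comp (toEnd G 1) h1).hasFDerivAt
  rw [← h0] at h3
  have h4 := h3.comp_hasDerivWithinAt (0 : ℝ) hd
  -- Near `0` the curve factors through `toEnd G ∘ r`, so its velocity is in the range of the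
  -- differential of `toEnd G` at `1`. This needs the underlying curve `g` in `G` to be continuous
  -- at `0`, which holds because the topology of `G` is induced from `End F`.
  have h5 : ∀ᶠ t in 𝓝[Icc 0 1] (0 : ℝ), c t = (toEnd G ∘ r) (c t) := by
    choose! g hg using hc
    have hg0 : g 0 = 1 := by
      have := (hg 0 (by simp)).trans h0
      exact Subtype.ext (Units.ext this)
    have hcont : Filter.Tendsto g (𝓝[Icc 0 1] 0) (𝓝 1) := by
      have hind : IsInducing (toEnd G) :=
        Units.isOpenEmbedding_val.isInducing.comp IsInducing.subtypeVal
      rw [hind.tendsto_nhds_iff, ← h0]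
      refine hd.continuousWithinAt.tendsto.congr' ?_
      filter_upwards [self_mem_nhdsWithin] with t ht
      exact (hg t ht).symm
    filter_upwards [hcont hr', self_mem_nhdsWithin] with t ht ht1
    rw [Function.comp_apply, ← hg t ht1]
    exact congrArg (toEnd G) (show r (toEnd G (g t)) = g t from ht).symm
  have h6 := (h4.congr_of_eventuallyEq h5 (by
    rw [Function.comp_apply, Function.comp_apply, h0, hr1]))
  exact ⟨_, ((uniqueDiffOn_Icc zero_lt_one 0 (by simp)).eq_deriv _ h6 hd)⟩

theorem hasDerivWithinAt_of_clm_apply {c : ℝ → F →L[ℝ] F} {c' : F →L[ℝ] F} {S : Set ℝ} {t : ℝ}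
    (h : ∀ ξ, HasDerivWithinAt (fun τ => c τ ξ) (c' ξ) S t) : HasDerivWithinAt c c' S t := by
  let b := Module.finBasis ℝ F
  let β : Fin (Module.finrank ℝ F) → F →L[ℝ] ℝ := fun j =>
    LinearMap.toContinuousLinearMap (b.coord j)
  have hb : ∀ L : F →L[ℝ] F, L = ∑ j, ContinuousLinearMap.smulRightL ℝ F F (β j) (L (b j)) := by
    intro L
    refine ContinuousLinearMap.ext fun u => ?_
    conv_lhs => rw [← b.sum_repr u, map_sum]
    rw [_root_.sum_apply]
    refine Finset.sum_congr rfl fun j _ => ?_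
    rw [map_smul]
    rfl
  have h2 := HasDerivWithinAt.fun_sum (u := Finset.univ) fun j _ =>
    (ContinuousLinearMap.smulRightL ℝ F F (β j)).hasFDerivAt.comp_hasDerivWithinAt t (h (b j))
  rw [← hb c'] at h2
  exact h2.congr_of_eventuallyEq (Filter.Eventually.of_forall fun τ => hb (c τ)) (hb (c t))

/-- The norms of the coefficients are bounded on the compact interval, which gives a uniform
Lipschitz constant for the uniqueness theorem. -/
theorem eq_of_hasDerivWithinAt_linear {a : ℝ → F →L[ℝ] F} (ha : ContinuousOn a (Icc 0 1))
    {f g : ℝ → F} (hf : ∀ t ∈ Icc (0 : ℝ) 1, HasDerivWithinAt f (a t (f t)) (Icc 0 1) t)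
    (hg : ∀ t ∈ Icc (0 : ℝ) 1, HasDerivWithinAt g (a t (g t)) (Icc 0 1) t) (h0 : f 0 = g 0) :
    f 1 = g 1 := by
  obtain ⟨K, hK⟩ := isCompact_Icc.exists_bound_of_continuousOn ha
  refine ODE_solution_unique_of_mem_Icc_right (v := fun t => a t) (s := fun _ => univ)
    (K := K.toNNReal) (a := 0) (b := 1) (fun t ht => ?_)
    (fun t ht => (hf t ht).continuousWithinAt) (fun t ht => ?_) (fun _ _ => mem_univ _)
    (fun t ht => (hg t ht).continuousWithinAt) (fun t ht => ?_) (fun _ _ => mem_univ _) h0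
    (right_mem_Icc.2 zero_le_one)
  · refine ((a t).lipschitz.weaken ?_).lipschitzOnWith
    exact NNReal.le_toNNReal_of_coe_le (hK t (Ico_subset_Icc_self ht))
  · exact (hf t (Ico_subset_Icc_self ht)).mono_of_mem_nhdsWithin (Icc_mem_nhdsGE_of_mem ht)
  · exact (hg t (Ico_subset_Icc_self ht)).mono_of_mem_nhdsWithin (Icc_mem_nhdsGE_of_mem ht)

namespace LinearConnection

variable (EM) in
-- Admissibility concerns curves on the whole of `[0, 1]`, so it is the velocity and not the
-- interval that is shrunk to stay in `O`. The curve is a segment in the chart at `x`, where the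
-- tangent space at `x` is identified with the model.
theorem exists_short_curve {x : M} {O : Set M} (hO : O ∈ 𝓝 x) (v : EM) :
    ∃ ε : ℝ, 0 < ε ∧ ∃ σ : ℝ → M, ContMDiffOn 𝓘(ℝ, ℝ) 𝓘(ℝ, EM) ∞ σ (Icc 0 1) ∧
      (∀ t ∈ Icc (0 : ℝ) 1, σ t ∈ O) ∧ σ 0 = x ∧ (velocity EM σ 0 : EM) = ε • v := by
  let χ := extChartAt 𝓘(ℝ, EM) x
  have hmem : χ.symm ⁻¹' O ∩ χ.target ∈ 𝓝 (χ x) := by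
    refine Filter.inter_mem ?_ (extChartAt_target_mem_nhds x)
    refine (continuousAt_extChartAt_symm (I := 𝓘(ℝ, EM)) x) ?_
    rwa [extChartAt_to_inv]
  obtain ⟨ρ, hρ, hball⟩ := Metric.mem_nhds_iff.1 hmem
  obtain ⟨ε, hε, hε'⟩ : ∃ ε : ℝ, 0 < ε ∧ ε * ‖v‖ < ρ := by
    refine ⟨ρ / (‖v‖ + 1), by positivity, ?_⟩
    rw [div_mul_eq_mul_div, div_lt_iff₀ (by positivity)]
    nlinarith [norm_nonneg v]
  have hline : ∀ t ∈ Icc (0 : ℝ) 1, χ x + t • ε • v ∈ χ.symm ⁻¹' O ∩ χ.target := by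
    intro t ht
    refine hball ?_
    rw [Metric.mem_ball, dist_self_add_left, norm_smul, norm_smul, Real.norm_of_nonneg ht.1,
      Real.norm_of_nonneg hε.le]
    refine lt_of_le_of_lt (mul_le_of_le_one_left (by positivity) ht.2) hε'
  have hl : ContMDiff 𝓘(ℝ, ℝ) 𝓘(ℝ, EM) ∞ (fun t : ℝ => χ x + t • ε • v) :=
    (contDiff_const.add (contDiff_id.smul contDiff_const)).contMDiff
  refine ⟨ε, hε, fun t => χ.symm (χ x + t • ε • v), ?_, fun t ht => (hline t ht).1, ?_, ?_⟩
  · exact (contMDiffOn_extChartAt_symm x).comp hl.contMDiffOn fun t ht => (hline t ht).2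
  · simp [χ]
  · have h1 : HasMFDerivAt 𝓘(ℝ, EM) 𝓘(ℝ, EM) χ.symm (χ x) (ContinuousLinearMap.id ℝ EM) := by
      have h := mfderivWithin_range_extChartAt_symm (I := 𝓘(ℝ, EM)) (x := x)
      have h' := (mdifferentiableWithinAt_extChartAt_symm (I := 𝓘(ℝ, EM))
        (mem_extChartAt_target (I := 𝓘(ℝ, EM)) x)).hasMFDerivWithinAt
      rw [h] at h'
      exact h'.hasMFDerivAt (by simp)
    have h2 : HasMFDerivAt 𝓘(ℝ, ℝ) 𝓘(ℝ, EM) (fun t : ℝ => χ x + t • ε • v) 0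
        (ContinuousLinearMap.toSpanSingleton ℝ (ε • v)) := by
      have := ((hasDerivAt_id (0 : ℝ)).smul_const (ε • v)).const_add (χ x)
      rw [one_smul] at this
      exact this.hasFDerivAt.hasMFDerivAt
    have h1' : HasMFDerivAt 𝓘(ℝ, EM) 𝓘(ℝ, EM) χ.symm (χ x + (0 : ℝ) • ε • v)
        (ContinuousLinearMap.id ℝ EM) := by
      rw [zero_smul, add_zero]
      exact h1
    have h3 := (HasMFDerivAt.comp (0 : ℝ) h1' h2).hasMFDerivWithinAt (s := Icc 0 1)
    have h4 := h3.mfderivWithin (uniqueMDiffOn_iff_uniqueDiffOn.2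
      (uniqueDiffOn_Icc zero_lt_one) 0 (by simp))
    refine (congrArg (fun L : ℝ →L[ℝ] EM => L 1) h4).trans ?_
    change (1 : ℝ) • ε • v = _
    rw [one_smul]

theorem velocity_comp_mul {σ : ℝ → M} (hσ : ContMDiffOn 𝓘(ℝ, ℝ) 𝓘(ℝ, EM) ∞ σ (Icc 0 1))
    {r t : ℝ} (hr : r ∈ Icc (0 : ℝ) 1) (ht : t ∈ Icc (0 : ℝ) 1) :
    velocity EM (fun t => σ (r * t)) t = r • velocity EM σ (r * t) := by
  have hrt : ∀ t ∈ Icc (0 : ℝ) 1, r * t ∈ Icc (0 : ℝ) 1 := fun t ht =>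
    ⟨mul_nonneg hr.1 ht.1, mul_le_one₀ hr.2 ht.1 ht.2⟩
  have h1 := ((hσ _ (hrt t ht)).mdifferentiableWithinAt (by simp)).hasMFDerivWithinAt
  have h2 : HasMFDerivWithinAt 𝓘(ℝ, ℝ) 𝓘(ℝ, ℝ) (fun t : ℝ => r * t) (Icc 0 1) t
      (ContinuousLinearMap.toSpanSingleton ℝ r) := by
    have := ((hasDerivAt_id t).const_mul r)
    rw [mul_one] at this
    exact this.hasFDerivAt.hasMFDerivAt.hasMFDerivWithinAt
  have h3 := HasMFDerivWithinAt.comp t h1 h2 hrt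
  have h4 := h3.mfderivWithin (uniqueMDiffOn_iff_uniqueDiffOn.2
      (uniqueDiffOn_Icc zero_lt_one) t ht)
  refine (congrArg (fun L : ℝ →L[ℝ] EM => L 1) h4).trans ?_
  have h5 : ∀ L : ℝ →L[ℝ] EM, L ((1 : ℝ) • r) = r • L 1 := fun L => by
    rw [← map_smul, smul_eq_mul, smul_eq_mul, mul_comm]
  exact h5 (mfderivWithin 𝓘(ℝ, ℝ) 𝓘(ℝ, EM) σ (Icc 0 1) (r * t))

variable {D : LinearConnection F E EM}

/-- The connection matrices of an admissible connection are elements of the Lie algebra. -/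
theorem IsAdmissible.exists_lieToEndL_eq (hD : D.IsAdmissible G)
    (e : Trivialization F (π F E)) [MemTrivializationAtlas e]
    {ψ : C^∞⟮𝓘(ℝ, EM), M; ℝ⟯} (hψ : tsupport ψ ⊆ e.baseSet) {x : M} (hx : x ∈ e.baseSet)
    (h1 : ∀ᶠ y in 𝓝 x, ψ y = 1) (v : TangentSpace 𝓘(ℝ, EM) x) :
    ∃ X : EG, lieToEndL G EG X = D.connMap e ψ hψ x v := by
  obtain ⟨ε, hε, σ, hσ, hσO, hσ0, hv⟩ := exists_short_curve EM
    (Filter.inter_mem h1.eventually_nhds (e.open_baseSet.mem_nhds hx)) v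
  have hrt : ∀ r ∈ Icc (0 : ℝ) 1, ∀ t ∈ Icc (0 : ℝ) 1, r * t ∈ Icc (0 : ℝ) 1 := fun r hr t ht =>
    ⟨mul_nonneg hr.1 ht.1, mul_le_one₀ hr.2 ht.1 ht.2⟩
  set a : ℝ → F →L[ℝ] F := fun t => -D.connMap e ψ hψ (σ t) (velocity EM σ t) with ha_def
  have ha : ContinuousOn a (Icc 0 1) :=
    ((D.continuousOn_connMap e ψ hψ hσ).mono fun t ht => ⟨ht, (hσO t ht).2⟩).neg
  have hsm : ∀ r ∈ Icc (0 : ℝ) 1, ContMDiffOn 𝓘(ℝ, ℝ) 𝓘(ℝ, EM) ∞ (fun t => σ (r * t)) (Icc 0 1) :=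
    fun r hr => hσ.comp (contDiff_const.mul contDiff_id).contMDiff.contMDiffOn (hrt r hr)
  -- Admissibility only speaks of the endpoint of a curve. Applied to `t ↦ σ (r t)` for each `r`, it
  -- shows that transport along `σ` up to time `r`, read in `e`, is an element `g r` of `G`.
  have hpt : ∀ r ∈ Icc (0 : ℝ) 1, ∃ g : G, ∀ ξ : F, ∃ y : ℝ → F, y 0 = ξ ∧ y 1 = toEnd G g ξ ∧
      ∀ t ∈ Icc (0 : ℝ) 1, HasDerivWithinAt y (r • a (r * t) (y t)) (Icc 0 1) t := by
    intro r hr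
    have h01 : (0 : ℝ) ∈ Icc (0 : ℝ) 1 := by simp
    have h11 : (1 : ℝ) ∈ Icc (0 : ℝ) 1 := by simp
    obtain ⟨u', hu'⟩ := hD _ (hsm r hr) (localSec G e 1 (σ (r * 0)))
    refine ⟨coordMap e ⟨_, u'⟩, fun ξ => ?_⟩
    obtain ⟨V, hV, hV0, hV1⟩ := hu' ξ
    refine ⟨fun t => (e ⟨σ (r * t), V t⟩).2, ?_, ?_, fun t ht => ?_⟩
    · change (e ⟨σ (r * 0), V 0⟩).2 = ξ
      rw [hV0, localSec_apply e (hσO _ (hrt r hr 0 h01)).2 1 ξ]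
      rfl
    · change (e ⟨σ (r * 1), V 1⟩).2 = _
      rw [hV1, toEnd_coordMap e (hσO _ (hrt r hr 1 h11)).2 ξ]
    · have := (hV t ht).hasDerivWithinAt (e := e) (ψ := ψ) (hψ := hψ) D (hsm r hr) ht
        (hσO _ (hrt r hr t ht)).2 (hσO _ (hrt r hr t ht)).1
      rw [velocity_comp_mul hσ hr ht, connMap_smul] at this
      refine this.congr_deriv ?_
      rw [ha_def]
      simp
  choose! g Y hY0 hY1 hY using hpt
  have h01 : (0 : ℝ) ∈ Icc (0 : ℝ) 1 := by simp
  have h11 : (1 : ℝ) ∈ Icc (0 : ℝ) 1 := by simp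
  have hY' : ∀ ξ, ∀ t ∈ Icc (0 : ℝ) 1, HasDerivWithinAt (Y 1 ξ) (a t (Y 1 ξ t)) (Icc 0 1) t := by
    intro ξ t ht
    have := hY 1 h11 ξ t ht
    rwa [one_mul, one_smul] at this
  -- The elements `g r` come from separate curves; uniqueness of solutions shows that they form the
  -- fundamental solution of the single equation `y' = a y`, so `r ↦ g r` has derivative `a 0` at
  -- `0`.
  have hc : ∀ r ∈ Icc (0 : ℝ) 1, ∀ ξ, toEnd G (g r) ξ = Y 1 ξ r := by
    intro r hr ξ
    have h2 := eq_of_hasDerivWithinAt_linear (a := fun t => r • a (r * t))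
      (f := Y r ξ) (g := fun t => Y 1 ξ (r * t))
      ((ha.comp (continuous_const.mul continuous_id).continuousOn (hrt r hr)).const_smul r)
      (hY r hr ξ) (fun t ht => ?_) ?_
    · rw [← hY1 r hr, h2, mul_one]
    · have h3 : HasDerivWithinAt (fun t : ℝ => r * t) r (Icc 0 1) t := by
        simpa using ((hasDerivAt_id t).const_mul r).hasDerivWithinAt
      exact (hY' ξ _ (hrt r hr t ht)).scomp t h3 (hrt r hr)
    · rw [mul_zero, hY0 r hr, hY0 1 h11]
  have hd : HasDerivWithinAt (fun r => toEnd G (g r)) (a 0) (Icc 0 1) 0 := by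
    refine hasDerivWithinAt_of_clm_apply fun ξ => ?_
    refine ((hY' ξ 0 h01).congr (fun r hr => hc r hr ξ) (hc 0 h01 ξ)).congr_deriv ?_
    rw [hY0 1 h11]
  have h0 : toEnd G (g 0) = toEnd G 1 :=
    ContinuousLinearMap.ext fun ξ => by rw [hc 0 h01, hY0 1 h11]; rfl
  obtain ⟨X, hX⟩ := mem_range_lieToEndL (EG := EG) h0 (fun t _ => ⟨g t, rfl⟩) hd
  have htr : ∀ (y : M), y = x → ∀ w : EM, D.connMap e ψ hψ y w = D.connMap e ψ hψ x w := by
    rintro y rfl w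
    rfl
  have ha0 : a 0 = -(ε • D.connMap e ψ hψ x v) := by
    rw [← connMap_smul]
    exact congrArg Neg.neg ((htr _ hσ0 _).trans (congrArg (D.connMap e ψ hψ x) hv))
  -- This undoes the scaling of the velocity by `ε` and the sign in `a`.
  refine ⟨-(ε⁻¹ • X), ?_⟩
  rw [map_neg, map_smul, hX, ha0, smul_neg, neg_neg, smul_smul, inv_mul_cancel₀ hε.ne', one_smul]

theorem IsAdmissible.hasLifts (hD : D.IsAdmissible G) : D.HasLifts G EG := by
  rintro ⟨x, u⟩ v
  set e := trivializationAt F E x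
  have hx : x ∈ e.baseSet := mem_baseSet_trivializationAt _ _ _
  obtain ⟨ψ, h1, hψ⟩ := exists_bump EM (e.open_baseSet.mem_nhds hx)
  obtain ⟨X, hX⟩ := hD.exists_lieToEndL_eq (EG := EG) e hψ hx h1 v
  have hloc : D.HasLocalFormValue (localSec G e 1) x v X := by
    intro ξ t ht
    have h2 : ∀ᶠ y in 𝓝 x, t y = extSec e ψ hψ ξ y := by
      filter_upwards [ht, extSec_eventuallyEq e ψ hψ h1 ξ, e.open_baseSet.mem_nhds hx]
        with y hy hy' hyb
      rw [hy, hy', localSec_eq_symm e hyb, e.symmL_apply hyb]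
      rfl
    rw [D.toLin_congr h2, ← D.symmL_connMap e ψ hψ hx, ← hX, localSec_eq_symm e hx, e.symmL_apply hx]
    rfl
  have hw := D.mem_horizontal_of_hasLocalFormValue e 1 hx hloc
  have h2 : u = (localSec G e 1 x).rightMul (coordMap e ⟨x, u⟩) := by
    have h3 : (⟨x, u⟩ : FrameBundle G E) =
        rightMul (coordMap e ⟨x, u⟩) ⟨x, localSec G e 1 x⟩ := by
      rw [rightMul_localSec _ hx, one_mul]
      exact (pretriv_symm_coordMap e (p := ⟨x, u⟩) hx).symm
    exact TotalSpace.mk_inj.1 h3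
  -- The lift was built at the frame of the constant local section; right translation carries it to
  -- `u` without changing its projection.
  rw [h2]
  refine ⟨_, D.dRightMul_mem_horizontal hw (coordMap e ⟨x, u⟩), ?_⟩
  refine (dProj_dRightMul (coordMap e ⟨x, u⟩) (⟨x, localSec G e 1 x⟩ : FrameBundle G E) _).trans ?_
  rw [map_sub, dProj_infActionL, sub_zero, dProj_dSection (contMDiffAt_localSec EM EG e hx 1)]

end LinearConnection

end HorizontalSpaces

/-! ### Linear differential equations with solutions in `G` -/

section HorizontalSpaces

variable {F : Type*} [NormedAddCommGroup F] [NormedSpace ℝ F] [FiniteDimensional ℝ F]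
  {G : Subgroup (F →L[ℝ] F)ˣ}
  {M : Type*} [TopologicalSpace M] {E : M → Type*} [TopologicalSpace (TotalSpace F E)]
  [∀ x, AddCommGroup (E x)] [∀ x, Module ℝ (E x)] [∀ x, TopologicalSpace (E x)]
  [∀ x, IsTopologicalAddGroup (E x)] [∀ x, ContinuousSMul ℝ (E x)]
  [FiberBundle F E] [VectorBundle ℝ F E]
  {EM : Type*} [NormedAddCommGroup EM] [NormedSpace ℝ EM] [FiniteDimensional ℝ EM]
  [ChartedSpace EM M] [IsManifold 𝓘(ℝ, EM) ∞ M] [T2Space M]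
  [ContMDiffVectorBundle ∞ F E 𝓘(ℝ, EM)]
  {EG : Type*} [NormedAddCommGroup EG] [NormedSpace ℝ EG] [FiniteDimensional ℝ EG]
  [ChartedSpace EG G] [LieGroup 𝓘(ℝ, EG) ∞ G] [IsEmbeddedLieSubgroup G (EG := EG)]
  [IsGVectorBundle G E]

open FrameBundle

variable (G EG) in
/-- Right-invariant vector fields on `G`, in coordinates near `1`. -/
theorem exists_rightInvariant_chart : ∃ (ι : EG → F →L[ℝ] F) (Z : EG → EG →L[ℝ] EG) (y₀ : EG),
    (∀ y, ∃ g : G, toEnd G g = ι y) ∧ ContDiffAt ℝ 1 Z y₀ ∧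
    ∀ᶠ y in 𝓝 y₀, ∃ ι' : EG →L[ℝ] F →L[ℝ] F, HasFDerivAt ι ι' y ∧
      ∀ X, ι' (Z y X) = (lieToEndL G EG X).comp (ι y) := by
  obtain ⟨r, hr, hr'⟩ := exists_contMDiffAt_leftInverse (EG := EG) (1 : G)
  have hr1 : r (toEnd G 1) = 1 := hr'.self_of_nhds
  let φ := extChartAt 𝓘(ℝ, EG) (1 : G)
  let ι : EG → F →L[ℝ] F := fun y => toEnd G (φ.symm y)
  let R : (F →L[ℝ] F) → EG := fun u => φ (r u)
  have hφ1 : φ.symm (φ 1) = 1 := extChartAt_to_inv (1 : G)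
  have hι : ∀ᶠ y in 𝓝 (φ 1), ContDiffAt ℝ ∞ ι y := by
    filter_upwards [(isOpen_extChartAt_target (I := 𝓘(ℝ, EG)) (1 : G)).mem_nhds
      (mem_extChartAt_target (I := 𝓘(ℝ, EG)) (1 : G))] with y hy
    exact ((contMDiff_toEnd (EG := EG) _).comp y ((contMDiffOn_extChartAt_symm (1 : G)).contMDiffAt
      ((isOpen_extChartAt_target (I := 𝓘(ℝ, EG)) (1 : G)).mem_nhds hy))).contDiffAt
  have hR : ContDiffAt ℝ ∞ R (toEnd G 1) := by
    refine ContMDiffAt.contDiffAt (ContMDiffAt.comp (toEnd G 1) (g := φ) (f := r) ?_ hr)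
    rw [hr1]
    exact contMDiffAt_extChartAt
  have hι1 : ι (φ 1) = toEnd G 1 := by
    change toEnd G (φ.symm (φ 1)) = _
    rw [hφ1]
  have hιc : ContinuousAt ι (φ 1) := hι.self_of_nhds.continuousAt
  have hRι : ∀ᶠ y in 𝓝 (φ 1), R (ι y) = y := by
    have h1 : Filter.Tendsto φ.symm (𝓝 (φ 1)) (𝓝 1) := by
      have := continuousAt_extChartAt_symm (I := 𝓘(ℝ, EG)) (1 : G)
      rwa [ContinuousAt, extChartAt_to_inv] at this
    filter_upwards [h1 hr', extChartAt_target_mem_nhds (I := 𝓘(ℝ, EG)) (1 : G)] with y hy hy'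
    change φ (r (toEnd G (φ.symm y))) = y
    rw [show r (toEnd G (φ.symm y)) = φ.symm y from hy]
    exact φ.right_inv hy'
  let N : (F →L[ℝ] F) → EG →L[ℝ] F →L[ℝ] F := fun u =>
    ((ContinuousLinearMap.compL ℝ F F F).flip u).comp (LinearMap.toContinuousLinearMap (lieToEndL G EG))
  have hN : ContDiff ℝ ∞ N := by
    have h1 : ContDiff ℝ ∞ (fun u => (ContinuousLinearMap.compL ℝ F F F).flip u) :=
      (ContinuousLinearMap.compL ℝ F F F).flip.contDiff
    exact h1.clm_comp contDiff_const
  -- `N u` is `X ↦ X ∘ u`, and `R` is a smooth left inverse of the parametrization `ι`. So `Z y X`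
  -- is the coordinate vector of the right-invariant field `X ∘ ι y`, once that is known to be
  -- tangent to the image of `ι`.
  let Z : EG → EG →L[ℝ] EG := fun y => (fderiv ℝ R (ι y)).comp (N (ι y))
  refine ⟨ι, Z, φ 1, fun y => ⟨_, rfl⟩, ?_, ?_⟩
  · have h1 : ContDiffAt ℝ 1 (fderiv ℝ R) (ι (φ 1)) := by
      rw [hι1]
      exact (hR.fderiv_right (m := ∞) (by simp)).of_le (by simp)
    have h2 : ContDiffAt ℝ 1 ι (φ 1) := hι.self_of_nhds.of_le (by simp)
    exact (h1.comp (φ 1) h2).clm_comp ((hN.of_le (by simp)).contDiffAt.comp (φ 1) h2)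
  · have hRev : ∀ᶠ y in 𝓝 (φ 1), DifferentiableAt ℝ R (ι y) := by
      have h1 : ∀ᶠ u in 𝓝 (toEnd G 1), DifferentiableAt ℝ R u := by
        have h2 : ContDiffAt ℝ 1 R (toEnd G 1) := hR.of_le (by simp)
        filter_upwards [h2.eventually (by simp)] with u hu using hu.differentiableAt (by simp)
      rw [← hι1] at h1
      exact hιc h1
    filter_upwards [hι, hRι.eventually_nhds, hRev,
      extChartAt_target_mem_nhds (I := 𝓘(ℝ, EG)) (1 : G)] with y hy hRy hRd hyt
    have hd := (hy.differentiableAt (by simp)).hasFDerivAt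
    refine ⟨_, hd, fun X => ?_⟩
    set h₀ : G := φ.symm y with hh₀
    have hφh : φ h₀ = y := φ.right_inv hyt
    have hsrc : h₀ ∈ φ.source := φ.map_target hyt
    have e1 : HasMFDerivAt 𝓘(ℝ, EG) 𝓘(ℝ, F →L[ℝ] F) (fun h : G => toEnd G (h * h₀)) 1
        (((ContinuousLinearMap.compL ℝ F F F).flip (toEnd G h₀)).comp
          (mfderiv 𝓘(ℝ, EG) 𝓘(ℝ, F →L[ℝ] F) (toEnd G) 1 : EG →L[ℝ] F →L[ℝ] F)) :=
      HasMFDerivAt.comp (1 : G) (g := (ContinuousLinearMap.compL ℝ F F F).flip (toEnd G h₀))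
        (ContinuousLinearMap.hasMFDerivAt _) hasMFDerivAt_toEnd
    have e2 : ContMDiffAt 𝓘(ℝ, EG) 𝓘(ℝ, EG) ∞ (fun h : G => φ (h * h₀)) 1 := by
      -- Tangency: `X ∘ ι y` is the derivative at `1`, in direction `X`, of `h ↦ h * h₀`, which near
      -- `1` factors through `ι`.
      refine ContMDiffAt.comp (1 : G) (g := φ) (f := fun h : G => h * h₀) ?_
        (contMDiff_mul_right (I := 𝓘(ℝ, EG)) (a := h₀) 1)
      rw [one_mul]
      exact contMDiffAt_extChartAt' (by simpa [φ] using hsrc)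
    have e3 := (e2.mdifferentiableAt (by simp)).hasMFDerivAt
    have hd' : HasMFDerivAt 𝓘(ℝ, EG) 𝓘(ℝ, F →L[ℝ] F) ι (φ (1 * h₀)) (fderiv ℝ ι y) := by
      rw [one_mul, hφh]
      exact hd.hasMFDerivAt
    have e4 := HasMFDerivAt.comp (1 : G) hd' e3
    have e5 : (fun h : G => toEnd G (h * h₀)) =ᶠ[𝓝 1] ι ∘ fun h : G => φ (h * h₀) := by
      have : ∀ᶠ h in 𝓝 (1 : G), h * h₀ ∈ φ.source := by
        refine (continuous_mul_const h₀).continuousAt.preimage_mem_nhds ?_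
        rw [one_mul]
        exact (isOpen_extChartAt_source (I := 𝓘(ℝ, EG)) (1 : G)).mem_nhds hsrc
      filter_upwards [this] with h hh
      change _ = toEnd G (φ.symm (φ (h * h₀)))
      rw [φ.left_inv hh]
    have e6 := hasMFDerivAt_unique e1 (e4.congr_of_eventuallyEq e5)
    obtain ⟨w, hw⟩ : ∃ w : EG, fderiv ℝ ι y w = (lieToEndL G EG X).comp (ι y) :=
      ⟨_, (congrArg (fun L : EG →L[ℝ] F →L[ℝ] F => L X) e6).symm⟩
    have h7 : fderiv ℝ R (ι y) (fderiv ℝ ι y w) = w := by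
      have h8 := (hRd.hasFDerivAt.comp y hd).congr_of_eventuallyEq
        (f₁ := id) (by filter_upwards [hRy] with z hz using hz.symm)
      exact congrArg (fun L : EG →L[ℝ] EG => L w) (h8.unique (hasFDerivAt_id y))
    change fderiv ℝ ι y (fderiv ℝ R (ι y) ((lieToEndL G EG X).comp (ι y))) = _
    rw [← hw, h7]

/-- Linear differential equations with coefficients in the Lie algebra of `G` have local
solutions in `G`. -/
theorem exists_local_solution {tmin tmax t₀ : ℝ} (ht₀ : t₀ ∈ Icc tmin tmax) {a : ℝ → EG}
    (ha : ContinuousOn a (Icc tmin tmax)) : ∃ δ > 0, ∃ g : ℝ → G, ∀ t ∈ Icc tmin tmax,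
      |t - t₀| < δ → HasDerivWithinAt (fun t => toEnd G (g t))
        ((lieToEndL G EG (a t)).comp (toEnd G (g t))) (Icc tmin tmax) t := by
  obtain ⟨ι, Z, y₀, hιG, hZ, hι⟩ := exists_rightInvariant_chart G EG
  obtain ⟨K, S, hS, hK⟩ := hZ.exists_lipschitzOnWith
  obtain ⟨A, hA⟩ := isCompact_Icc.exists_bound_of_continuousOn ha
  obtain ⟨ρ, hρ, hball⟩ := Metric.nhds_basis_closedBall.mem_iff.1 hS
  have hA0 : 0 ≤ A := (norm_nonneg _).trans (hA t₀ ht₀)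
  have hB : ∀ y ∈ Metric.closedBall y₀ ρ, ‖Z y‖ ≤ ‖Z y₀‖ + K * ρ := by
    intro y hy
    have h1 := hK.dist_le_mul y (hball hy) y₀ (hball (Metric.mem_closedBall_self hρ.le))
    have h2 : ‖Z y - Z y₀‖ ≤ K * ρ := by
      rw [← dist_eq_norm]
      exact h1.trans (mul_le_mul_of_nonneg_left hy K.2)
    calc ‖Z y‖ = ‖Z y₀ + (Z y - Z y₀)‖ := by rw [add_sub_cancel]
      _ ≤ _ := (norm_add_le _ _).trans (add_le_add_right h2 _)
  set L : ℝ := (‖Z y₀‖ + K * ρ) * A with hL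
  have hL0 : 0 ≤ L := by positivity
  -- `L` bounds the speed of `y' = Z y (a t)` in the ball of radius `ρ`, so a solution cannot leave
  -- that ball within time `η`.
  obtain ⟨η, hη, hη'⟩ : ∃ η : ℝ, 0 < η ∧ L * η ≤ ρ := by
    refine ⟨ρ / (L + 1), by positivity, ?_⟩
    rw [mul_div_assoc', div_le_iff₀ (by positivity)]
    nlinarith
  have hsub : Icc (max tmin (t₀ - η)) (min tmax (t₀ + η)) ⊆ Icc tmin tmax :=
    Icc_subset_Icc (le_max_left _ _) (min_le_left _ _)
  have ht₀' : t₀ ∈ Icc (max tmin (t₀ - η)) (min tmax (t₀ + η)) :=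
    ⟨max_le ht₀.1 (by linarith), le_min ht₀.2 (by linarith)⟩
  have hPL : IsPicardLindelof (fun t y => Z y (a t)) (⟨t₀, ht₀'⟩ :
      Icc (max tmin (t₀ - η)) (min tmax (t₀ + η))) y₀ ⟨ρ, hρ.le⟩ 0 ⟨L, hL0⟩ (K * ⟨A, hA0⟩) := by
    constructor
    · intro t ht
      refine LipschitzOnWith.of_dist_le_mul fun y hy z hz => ?_
      have h1 := hK.dist_le_mul y (hball hy) z (hball hz)
      rw [dist_eq_norm, ← sub_apply]
      refine (ContinuousLinearMap.le_opNorm _ _).trans ?_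
      rw [← dist_eq_norm]
      refine (mul_le_mul h1 (hA t (hsub ht)) (norm_nonneg _) (by positivity)).trans (le_of_eq ?_)
      change (K : ℝ) * dist y z * A = (K : ℝ) * A * dist y z
      ring
    · intro y _
      exact (Z y).continuous.comp_continuousOn (ha.mono hsub)
    · intro t ht y hy
      exact ((Z y).le_opNorm _).trans (mul_le_mul (hB y hy) (hA t (hsub ht)) (norm_nonneg _)
        (by positivity))
    · change L * max (min tmax (t₀ + η) - t₀) (t₀ - max tmin (t₀ - η)) ≤ ρ - 0
      rw [sub_zero]
      refine (mul_le_mul_of_nonneg_left (max_le ?_ ?_) hL0).trans hη'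
      · linarith [min_le_right tmax (t₀ + η)]
      · linarith [le_max_right tmin (t₀ - η)]
  obtain ⟨α, hα0, hα⟩ := hPL.exists_eq_forall_mem_Icc_hasDerivWithinAt₀
  -- The description of `Z` is valid only near `y₀`, so the time interval is shortened once more by
  -- continuity of the solution.
  have hnear : ∀ᶠ t in 𝓝[Icc (max tmin (t₀ - η)) (min tmax (t₀ + η))] t₀,
      ∃ ι' : EG →L[ℝ] F →L[ℝ] F, HasFDerivAt ι ι' (α t) ∧
        ∀ X, ι' (Z (α t) X) = (lieToEndL G EG X).comp (ι (α t)) := by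
    rw [← show α t₀ = y₀ from hα0] at hι
    exact (hα t₀ ht₀').continuousWithinAt.tendsto.eventually hι
  obtain ⟨δ, hδ, hδ'⟩ := Metric.mem_nhdsWithin_iff.1 hnear
  choose g hg using hιG
  refine ⟨min δ η, lt_min hδ hη, fun t => g (α t), fun t ht htδ => ?_⟩
  have h1 := abs_lt.1 (htδ.trans_le (min_le_right _ _))
  have htm : t ∈ Icc (max tmin (t₀ - η)) (min tmax (t₀ + η)) :=
    ⟨max_le ht.1 (by linarith), le_min ht.2 (by linarith)⟩
  obtain ⟨ι', hι', hι''⟩ := hδ' ⟨by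
    rw [Metric.mem_ball, Real.dist_eq]
    exact htδ.trans_le (min_le_left _ _), htm⟩
  simp_rw [hg]
  have h2 := hι'.comp_hasDerivWithinAt t (hα t htm)
  rw [hι''] at h2
  refine h2.mono_of_mem_nhdsWithin ?_
  have h3 : Ioo (t₀ - η) (t₀ + η) ∈ 𝓝 t := Ioo_mem_nhds (by linarith) (by linarith)
  filter_upwards [self_mem_nhdsWithin, mem_nhdsWithin_of_mem_nhds h3] with z hz hz'
  exact ⟨max_le hz.1 hz'.1.le, le_min hz.2 hz'.2.le⟩

end HorizontalSpaces

/-! ### Connections with horizontal lifts are admissible -/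

section HorizontalSpaces

variable {F : Type*} [NormedAddCommGroup F] [NormedSpace ℝ F] [FiniteDimensional ℝ F]
  {G : Subgroup (F →L[ℝ] F)ˣ}
  {M : Type*} [TopologicalSpace M] {E : M → Type*} [TopologicalSpace (TotalSpace F E)]
  [∀ x, AddCommGroup (E x)] [∀ x, Module ℝ (E x)] [∀ x, TopologicalSpace (E x)]
  [∀ x, IsTopologicalAddGroup (E x)] [∀ x, ContinuousSMul ℝ (E x)]
  [FiberBundle F E] [VectorBundle ℝ F E]
  {EM : Type*} [NormedAddCommGroup EM] [NormedSpace ℝ EM] [FiniteDimensional ℝ EM]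
  [ChartedSpace EM M] [IsManifold 𝓘(ℝ, EM) ∞ M] [T2Space M]
  [ContMDiffVectorBundle ∞ F E 𝓘(ℝ, EM)]
  {EG : Type*} [NormedAddCommGroup EG] [NormedSpace ℝ EG] [FiniteDimensional ℝ EG]
  [ChartedSpace EG G] [LieGroup 𝓘(ℝ, EG) ∞ G] [IsEmbeddedLieSubgroup G (EG := EG)]
  [IsGVectorBundle G E]

open FrameBundle

namespace LinearConnection

variable {D : LinearConnection F E EM}

/-- The connection matrices of a connection with horizontal lifts are elements of the Lie
algebra. -/
theorem HasLifts.exists_lieToEndL_eq (hD : D.HasLifts G EG)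
    (e : Trivialization F (π F E)) [MemTrivializationAtlas e]
    {ψ : C^∞⟮𝓘(ℝ, EM), M; ℝ⟯} (hψ : tsupport ψ ⊆ e.baseSet) {x : M} (hx : x ∈ e.baseSet)
    (h1 : ∀ᶠ y in 𝓝 x, ψ y = 1) (v : TangentSpace 𝓘(ℝ, EM) x) :
    ∃ X : EG, lieToEndL G EG X = D.connMap e ψ hψ x v := by
  have hs := contMDiffAt_localSec EM EG e hx (1 : G)
  obtain ⟨w, hw, hv⟩ := hD ⟨x, localSec G e 1 x⟩ v
  obtain ⟨X, hX⟩ := exists_infActionL_eq (p := (⟨x, localSec G e 1 x⟩ : FrameBundle G E))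
    (w := dSection EM EG (localSec G e 1) x v - w)
    (by rw [map_sub, dProj_dSection hs, hv]; exact sub_self v)
  have hloc : D.HasLocalFormValue (localSec G e 1) x v X := by
    refine D.hasLocalFormValue_of_mem_horizontal hs ?_
    rw [hX, sub_sub_cancel]
    exact hw
  refine ⟨X, ContinuousLinearMap.ext fun ξ => ?_⟩
  have h2 := hloc ξ (extSec e ψ hψ ξ) (by
    filter_upwards [extSec_eventuallyEq e ψ hψ h1 ξ, e.open_baseSet.mem_nhds hx] with y hy hyb
    rw [hy, localSec_eq_symm e hyb, e.symmL_apply hyb]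
    rfl)
  rw [D.connMap_apply e ψ hψ hx, h2, localSec_apply e hx]
  rfl

theorem HasCovDerivAlong.congr {σ : ℝ → M} {V V' : ∀ t, E (σ t)} {t : ℝ} {W : E (σ t)}
    (h : D.HasCovDerivAlong σ V t W) (hV : ∀ᶠ τ in 𝓝[Icc 0 1] t, V' τ = V τ) :
    D.HasCovDerivAlong σ V' t W := by
  obtain ⟨n, s, c, c', hVs, hc, hW⟩ := h
  refine ⟨n, s, c, c', ?_, hc, hW⟩
  filter_upwards [hVs, hV] with τ h h'
  rw [h', h]

/-- The two sides may be expressed through different families of sections, so their witnesses cannot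
be joined directly. In a trivialization both are solutions of the same equation with the same value
at `t`, and their one-sided derivatives agree. -/
theorem HasCovDerivAlong.glue {σ : ℝ → M} (hσ : ContMDiffOn 𝓘(ℝ, ℝ) 𝓘(ℝ, EM) ∞ σ (Icc 0 1))
    {t : ℝ} (ht : t ∈ Icc (0 : ℝ) 1) {V V' : ∀ t, E (σ t)} (h : D.HasCovDerivAlong σ V t 0)
    (h' : D.HasCovDerivAlong σ V' t 0) (hVV' : V' t = V t) :
    D.HasCovDerivAlong σ (fun τ => if τ ≤ t then V τ else V' τ) t 0 := by
  set e := trivializationAt F E (σ t)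
  have hx : σ t ∈ e.baseSet := mem_baseSet_trivializationAt _ _ _
  obtain ⟨ψ, h1, hψ⟩ := exists_bump EM (e.open_baseSet.mem_nhds hx)
  have d := h.hasDerivWithinAt (hψ := hψ) D hσ ht hx h1
  have d' := h'.hasDerivWithinAt (hψ := hψ) D hσ ht hx h1
  rw [hVV'] at d'
  refine D.hasCovDerivAlong_of_hasDerivWithinAt (e := e) (hψ := hψ) (hσ.continuousOn t ht) hx h1
    (y := fun τ => (e ⟨σ τ, if τ ≤ t then V τ else V' τ⟩).2) ?_ ?_
  · filter_upwards [(hσ.continuousOn t ht) (e.open_baseSet.mem_nhds hx)] with τ hτ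
    have hτ' : σ τ ∈ e.baseSet := hτ
    rw [e.symmL_apply hτ', e.symm_apply_apply_mk hτ']
  · simp only [le_refl, if_true]
    have hl : HasDerivWithinAt (fun τ => (e ⟨σ τ, if τ ≤ t then V τ else V' τ⟩).2)
        (-(D.connMap e ψ hψ (σ t) (velocity EM σ t) (e ⟨σ t, V t⟩).2)) (Icc 0 1 ∩ Iic t) t := by
      refine (d.mono inter_subset_left).congr (fun τ hτ => ?_) ?_
      · rw [if_pos (show τ ≤ t from hτ.2)]
      · rw [if_pos le_rfl]
    have hr : HasDerivWithinAt (fun τ => (e ⟨σ τ, if τ ≤ t then V τ else V' τ⟩).2)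
        (-(D.connMap e ψ hψ (σ t) (velocity EM σ t) (e ⟨σ t, V t⟩).2)) (Icc 0 1 ∩ Ici t) t := by
      have hVt : (if t ≤ t then V t else V' t) = V' t := by rw [if_pos le_rfl, hVV']
      refine (d'.mono inter_subset_left).congr (fun τ hτ => ?_) (by rw [hVt])
      rcases eq_or_lt_of_le (show t ≤ τ from hτ.2) with rfl | hlt
      · rw [hVt]
      · rw [if_neg hlt.not_ge]
    have := hl.union hr
    rwa [← inter_union_distrib_left, Iic_union_Ici, inter_univ] at this

/-- Local existence of parallel admissible frames along a curve. -/
theorem HasLifts.exists_local_parallel (hD : D.HasLifts G EG) {σ : ℝ → M}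
    (hσ : ContMDiffOn 𝓘(ℝ, ℝ) 𝓘(ℝ, EM) ∞ σ (Icc 0 1)) {t₀ : ℝ} (ht₀ : t₀ ∈ Icc (0 : ℝ) 1) :
    ∃ δ > 0, ∀ t₁ ∈ Icc (0 : ℝ) 1, |t₁ - t₀| < δ → ∀ u : AdmFrame G E (σ t₁),
      ∃ s : ∀ t, AdmFrame G E (σ t), s t₁ = u ∧ ∀ t ∈ Icc (0 : ℝ) 1, |t - t₀| < δ →
        ∀ ξ : F, D.HasCovDerivAlong σ (fun τ => (s τ).1 ξ) t 0 := by
  set e := trivializationAt F E (σ t₀)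
  have hx : σ t₀ ∈ e.baseSet := mem_baseSet_trivializationAt _ _ _
  obtain ⟨ψ, h1, hψ⟩ := exists_bump EM (e.open_baseSet.mem_nhds hx)
  obtain ⟨η, hη, hη'⟩ := Metric.mem_nhdsWithin_iff.1 ((hσ.continuousOn t₀ ht₀)
    (Filter.inter_mem h1.eventually_nhds (e.open_baseSet.mem_nhds hx)))
  have hO : ∀ t ∈ Icc (0 : ℝ) 1, |t - t₀| < η →
      (∀ᶠ y in 𝓝 (σ t), ψ y = 1) ∧ σ t ∈ e.baseSet := fun t ht h =>
    hη' ⟨by rwa [Metric.mem_ball, Real.dist_eq], ht⟩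
  -- A linear left inverse of `𝔤 → End F` turns the continuous connection matrices into a continuous
  -- coefficient curve in `𝔤`.
  obtain ⟨ℓ, hℓ⟩ := (lieToEndL G EG).exists_leftInverse_of_injective
    (LinearMap.ker_eq_bot.2 lieToEndL_injective)
  let a : ℝ → EG := fun t => -ℓ (D.connMap e ψ hψ (σ t) (velocity EM σ t))
  have haL : ∀ t ∈ Icc (0 : ℝ) 1, |t - t₀| < η →
      lieToEndL G EG (a t) = -D.connMap e ψ hψ (σ t) (velocity EM σ t) := by
    intro t ht h
    obtain ⟨X, hX⟩ := hD.exists_lieToEndL_eq e hψ (hO t ht h).2 (hO t ht h).1 (velocity EM σ t)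
    have h2 : ℓ (lieToEndL G EG X) = X := LinearMap.congr_fun hℓ X
    change lieToEndL G EG (-ℓ (D.connMap e ψ hψ (σ t) (velocity EM σ t))) = _
    rw [← hX, h2, map_neg]
  have hsub : Icc (max 0 (t₀ - η / 2)) (min 1 (t₀ + η / 2)) ⊆ Icc 0 1 :=
    Icc_subset_Icc (le_max_left _ _) (min_le_left _ _)
  have hlt : ∀ t ∈ Icc (max 0 (t₀ - η / 2)) (min 1 (t₀ + η / 2)), |t - t₀| < η := by
    intro t ht
    rw [abs_lt]
    constructor
    · linarith [(le_max_right _ _).trans ht.1]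
    · linarith [ht.2.trans (min_le_right _ _)]
  have ha : ContinuousOn a (Icc (max 0 (t₀ - η / 2)) (min 1 (t₀ + η / 2))) := by
    have hℓc : Continuous ℓ := ℓ.continuous_of_finiteDimensional
    refine (hℓc.comp_continuousOn ((D.continuousOn_connMap e ψ hψ hσ).mono fun t ht => ?_)).neg
    exact ⟨hsub ht, (hO t (hsub ht) (hlt t ht)).2⟩
  obtain ⟨δ, hδ, g, hg⟩ := exists_local_solution (G := G) (t₀ := t₀)
    ⟨max_le ht₀.1 (by linarith), le_min ht₀.2 (by linarith)⟩ ha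
  refine ⟨min δ (η / 2), lt_min hδ (by positivity), fun t₁ ht₁ ht₁δ u => ?_⟩
  have hη2 : ∀ t, |t - t₀| < min δ (η / 2) → |t - t₀| < η := fun t h =>
    h.trans_le ((min_le_right _ _).trans (by linarith))
  -- The equation `g' = a g` is preserved by right multiplication with constants, so a single
  -- solution, multiplied by `k`, meets any initial frame at any time `t₁` near `t₀`.
  set k : G := (g t₁)⁻¹ * coordMap e ⟨σ t₁, u⟩ with hk
  refine ⟨fun t => localSec G e (g t * k) (σ t), ?_, fun t ht htδ ξ => ?_⟩
  · change localSec G e (g t₁ * ((g t₁)⁻¹ * coordMap e ⟨σ t₁, u⟩)) (σ t₁) = u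
    rw [mul_inv_cancel_left]
    exact TotalSpace.mk_inj.1 (pretriv_symm_coordMap e (p := ⟨σ t₁, u⟩) (hO t₁ ht₁ (hη2 _ ht₁δ)).2)
  · refine D.hasCovDerivAlong_of_hasDerivWithinAt (e := e) (hψ := hψ) (hσ.continuousOn t ht)
      (hO t ht (hη2 t htδ)).2 (hO t ht (hη2 t htδ)).1 (y := fun τ => toEnd G (g τ) (toEnd G k ξ))
      ?_ ?_
    · filter_upwards [(hσ.continuousOn t ht) (e.open_baseSet.mem_nhds (hO t ht (hη2 t htδ)).2)]
        with τ hτ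
      have hτ' : σ τ ∈ e.baseSet := hτ
      rw [localSec_eq_symm e hτ', e.symmL_apply hτ']
      rfl
    · have h3 := abs_lt.1 (htδ.trans_le (min_le_right _ _))
      have h2 := hg t ⟨max_le ht.1 (by linarith), le_min ht.2 (by linarith)⟩
        (htδ.trans_le (min_le_left _ _))
      rw [haL t ht (hη2 t htδ)] at h2
      have h4 := ((ContinuousLinearMap.apply ℝ F (toEnd G k ξ)).hasFDerivAt).comp_hasDerivWithinAt
        t h2
      refine HasDerivWithinAt.mono_of_mem_nhdsWithin (t := Icc (max 0 (t₀ - η / 2))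
        (min 1 (t₀ + η / 2))) h4 ?_
      have h5 : Ioo (t₀ - η / 2) (t₀ + η / 2) ∈ 𝓝 t := Ioo_mem_nhds (by linarith) (by linarith)
      filter_upwards [self_mem_nhdsWithin, mem_nhdsWithin_of_mem_nhds h5] with z hz hz'
      exact ⟨max_le hz.1 hz'.1.le, le_min hz.2 hz'.2.le⟩

theorem HasLifts.isAdmissible (hD : D.HasLifts G EG) : D.IsAdmissible G := by
  intro σ hσ u
  choose! δ hδ hloc using fun t₀ (ht₀ : t₀ ∈ Icc (0 : ℝ) 1) => hD.exists_local_parallel hσ ht₀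
  -- A partition of `[0, 1]` each piece of which lies in one of the neighbourhoods of local
  -- solvability. The left endpoint of a piece need not be the centre of its neighbourhood, which is
  -- why local existence allows any initial time there.
  obtain ⟨τ, hτ0, hmono, ⟨N, hN⟩, hτc⟩ := exists_monotone_Icc_subset_open_cover_unitInterval
    (c := fun t₀ : unitInterval => {t : unitInterval | |(t : ℝ) - t₀| < δ t₀})
    (fun t₀ => isOpen_lt (by fun_prop) continuous_const)
    (fun t _ => mem_iUnion.2 ⟨t, by simpa using hδ t t.2⟩)
  have key : ∀ n, ∃ s : ∀ t, AdmFrame G E (σ t), s 0 = u ∧ ∀ t ∈ Icc (0 : ℝ) 1, t ≤ τ n →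
      ∀ ξ : F, D.HasCovDerivAlong σ (fun τ => (s τ).1 ξ) t 0 := by
    intro n
    induction n with
    | zero =>
      have h0 : (0 : ℝ) ∈ Icc (0 : ℝ) 1 := by simp
      -- Being parallel at the single time `0` already involves later times, so even the base case
      -- needs a local solution.
      obtain ⟨s, hs, hs'⟩ := hloc 0 h0 0 h0 (by simpa using hδ 0 h0) u
      refine ⟨s, hs, fun t ht htn ξ => ?_⟩
      have : t = 0 := le_antisymm (by simpa [hτ0] using htn) ht.1
      subst this
      exact hs' 0 h0 (by simpa using hδ 0 h0) ξ
    | succ n ih =>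
      obtain ⟨s, hs0, hs⟩ := ih
      obtain ⟨t₀, ht₀⟩ := hτc n
      have hle : τ n ≤ τ (n + 1) := hmono n.le_succ
      obtain ⟨s', hs'0, hs'⟩ := hloc t₀ t₀.2 (τ n) (τ n).2 (ht₀ ⟨le_rfl, hle⟩) (s (τ n))
      have hite : ∀ (ξ : F) (t : ℝ), ((if t ≤ τ n then s t else s' t : AdmFrame G E (σ t)).1 ξ) =
          if t ≤ τ n then (s t).1 ξ else (s' t).1 ξ := fun ξ t => by split_ifs <;> rfl
      refine ⟨fun t => if t ≤ τ n then s t else s' t, ?_, fun t ht htn ξ => ?_⟩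
      · change (if (0 : ℝ) ≤ τ n then s 0 else s' 0) = u
        rw [if_pos (τ n).2.1, hs0]
      · simp_rw [hite]
        rcases lt_trichotomy t (τ n) with hlt | heq | hgt
        · refine (hs t ht hlt.le ξ).congr ?_
          filter_upwards [mem_nhdsWithin_of_mem_nhds (Iio_mem_nhds hlt)] with z hz
          rw [if_pos (le_of_lt hz)]
        · rw [← heq]
          refine (hs t ht heq.le ξ).glue hσ ht (hs' t ht ?_ ξ) ?_
          · rw [heq]
            exact ht₀ ⟨le_rfl, hle⟩
          · rw [heq, hs'0]
        · refine (hs' t ht (ht₀ (a := ⟨t, ht⟩) ⟨hgt.le, htn⟩) ξ).congr ?_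
          filter_upwards [mem_nhdsWithin_of_mem_nhds (Ioi_mem_nhds hgt)] with z hz
          rw [if_neg (not_le.2 hz)]
  obtain ⟨s, hs0, hs⟩ := key N
  refine ⟨s 1, fun ξ => ⟨fun t => (s t).1 ξ, fun t ht => hs t ht ?_ ξ,
    congrArg (fun w : AdmFrame G E (σ 0) => w.1 ξ) hs0, rfl⟩⟩
  rw [hN N le_rfl]
  exact ht.2

end LinearConnection

end HorizontalSpaces

end

/-! ### The bijection -/

theorem mainTheorem8 {k : ℕ}
    {EM : Type*} [NormedAddCommGroup EM] [NormedSpace ℝ EM] [FiniteDimensional ℝ EM]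
    {M : Type*} [TopologicalSpace M] [ChartedSpace EM M] [IsManifold 𝓘(ℝ, EM) ∞ M]
    [T2Space M] [SigmaCompactSpace M]
    (E : M → Type*) [TopologicalSpace (TotalSpace (EuclideanSpace ℝ (Fin k)) E)]
    [∀ x, AddCommGroup (E x)] [∀ x, Module ℝ (E x)] [∀ x, TopologicalSpace (E x)]
    [∀ x, IsTopologicalAddGroup (E x)] [∀ x, ContinuousSMul ℝ (E x)]
    [FiberBundle (EuclideanSpace ℝ (Fin k)) E] [VectorBundle ℝ (EuclideanSpace ℝ (Fin k)) E]
    [ContMDiffVectorBundle ∞ (EuclideanSpace ℝ (Fin k)) E 𝓘(ℝ, EM)]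
    (G : Subgroup (EuclideanSpace ℝ (Fin k) →L[ℝ] EuclideanSpace ℝ (Fin k))ˣ)
    {EG : Type*} [NormedAddCommGroup EG] [NormedSpace ℝ EG] [FiniteDimensional ℝ EG]
    [ChartedSpace EG G] [LieGroup 𝓘(ℝ, EG) ∞ G] [IsEmbeddedLieSubgroup G (EG := EG)]
    [IsGVectorBundle G E] :
    ∃ Φ : {D : LinearConnection (EuclideanSpace ℝ (Fin k)) E EM // D.IsAdmissible G} ≃
        PrincipalConnection G E EM EG,
      ∀ (D : {D : LinearConnection (EuclideanSpace ℝ (Fin k)) E EM // D.IsAdmissible G})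
        (C : PrincipalConnection G E EM EG),
        Φ D = C ↔ Corresponds D.1 C := by
  let Φ : {D : LinearConnection (EuclideanSpace ℝ (Fin k)) E EM // D.IsAdmissible G} →
      PrincipalConnection G E EM EG := fun D => D.2.hasLifts.toPrincipal
  have hΦ : ∀ D C, Φ D = C ↔ Corresponds D.1 C := by
    intro D C
    rw [corresponds_iff]
    constructor
    · rintro rfl p
      rfl
    · exact fun h => PrincipalConnection.ext (funext fun p => (h p).symm)
  refine ⟨Equiv.ofBijective Φ ⟨fun D D' h => ?_, fun C => ?_⟩, hΦ⟩
  · exact Subtype.ext (LinearConnection.eq_of_horizontal_eq (G := G) (EG := EG) D.2.hasLifts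
      fun p => congrArg (fun C => PrincipalConnection.H C p) h)
  · exact ⟨⟨C.toLinear, C.hasLifts_toLinear.isAdmissible⟩,
      PrincipalConnection.ext (funext fun p => C.horizontal_toLinear p)⟩
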